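/- Let $\Gamma=\langle S,T\mid ST^{-1}S^{-1}TS=TST^{-1}S^{-1}T\rangle$ be the group of the figure eight knot, and let $a=T^{-1}STS^{-1}$. For $G=\mathrm{SL}(3,\mathbb C)$ or $\mathrm{GL}(2,\mathbb C)$ let $X(\Gamma,G)$ be the (reduced) character variety, whose points are the characters $\chi_\rho(\gamma)=\operatorname{tr}\rho(\gamma)$ of the representations $\rho\colon\Gamma\to G$ and whose regular functions are the polynomials in the functions $\chi\mapsto\chi(\gamma)$, $\gamma\in\Gamma$. On $X(\Gamma,\mathrm{SL}(3,\mathbb C))$ put $$y=\chi(S),\quad \bar y=\chi(S^{-1}),\quad z=\chi(ST),\quad \bar z=\chi(S^{-1}T^{-1}),\quad \alpha=\chi([T,S]),\quad \bar\alpha=\chi([S,T]),\quad \beta=\chi(S^{-1}T),\quad \bar\beta=\chi(ST^{-1}),$$ where $[g,h]=ghg^{-1}h^{-1}$. Let $X_{\mathrm{red}}\subset X(\Gamma,\mathrm{SL}(3,\mathbb C))$ be the set of characters of reducible representations. Let $X_{\mathrm{TR}}$ be the set of characters of totally reducible representations (direct sums of three one-dimensional ones), and let $X_{\mathrm{PR}}$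 be the Zariski closure of the set of characters of partially reducible representations (direct sums of a one-dimensional and an irreducible two-dimensional one). Let $X_2\subset X(\Gamma,\mathrm{GL}(2,\mathbb C))$ be the Zariski closure of the set of characters of irreducible representations; it has the coordinates $v=\operatorname{tr}\rho_2(S)$, $w=\det\rho_2(S)$, $x_1=\operatorname{tr}\rho_2(a)$. A primitive third root of unity $\varpi$ acts by $\varpi\cdot(y,\bar y,z,\bar z,\alpha,\bar\alpha,\beta,\bar\beta)=(\varpi y,\varpi^2\bar y,\varpi^2z,\varpi\bar z,\alpha,\bar\alpha,\beta,\bar\beta)$, which defines the action of $\mu_3=\{1,\varpi,\varpi^2\}$. Proposition. The locus $X_{\mathrm{red}}$ has exactly two irreducible components, $X_{\mathrm{TR}}$ and $X_{\mathrm{PR}}$. The eight coordinates map $X_{\mathrm{red}}$ isomorphically onto its image in $\mathbb C^8$, and in these coordinates the following holds. 1. $X_{\mathrm{TR}}$ is the set $$\{\alpha=\bar\alpha=\beta=\bar\beta=3,\ z=y^2-2\bar y,\ \bar z=\bar y^2-2y\},$$ and $(y,\bar y)$ maps it isomorphically onto $\mathbb C^2$. 2. $X_{\mathrm{PR}}$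 contains only characters of reducible representations and is parametrized by $X_2$. More precisely, $X_2$ is an irreducible component of $X(\Gamma,\mathrm{GL}(2,\mathbb C))$, the coordinates $(v,w,x_1)$ map it isomorphically onto $$\mathcal P=\Big\{(v,w,x_1)\in\mathbb C\times\mathbb C^*\times(\mathbb C-\{1\})\ \Big|\ \frac{x_1^2+x_1-1}{x_1-1}\,w=v^2\Big\},$$ and the map $\Phi$ given on $\mathcal P$ by $$\alpha=\bar\alpha=x_1+1,\quad \beta=\bar\beta=\frac{x_1}{x_1-1}+1,\quad y=v+\frac1w,\quad \bar y=w+\frac vw,\quad z=w\alpha+\frac1{w^2},\quad \bar z=\frac{\alpha}{w}+w^2$$ has image $X_{\mathrm{PR}}$ and is injective outside the preimage of $\mu_3\cdot(4,4,8,8,3,3,3,3)$. 3. The singular points of $X_{\mathrm{PR}}$ are exactly the three points $\mu_3\cdot(4,4,8,8,3,3,3,3)$, and they lie in $X_{\mathrm{TR}}\cap X_{\mathrm{PR}}$. 4. $X_{\mathrm{TR}}\cap X_{\mathrm{PR}}$ is the set of points of $X_{\mathrm{TR}}$ with $$64-28y\bar y-y^2\bar y^2+5(y^3+\bar y^3)=0,$$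 and $(y,\bar y)$ maps it isomorphically onto the plane curve in $\mathbb C^2$ with this equation. -/

import Mathlib

namespace FigureEight

open MvPolynomial

/-! ### Algebraic sets in the affine space `σ → ℂ` (the index set `σ` may be infinite) -/

/-- The Zariski topology on affine space: the nonvanishing sets of polynomials form a basis. -/
@[reducible] def zariskiTopology (σ : Type) : TopologicalSpace (σ → ℂ) :=
  TopologicalSpace.generateFrom
    {U | ∃ f : MvPolynomial σ ℂ, U = {x | eval x f ≠ 0}}

/-- The Zariski closure of a set. -/
def zariskiClosure {σ : Type} (Y : Set (σ → ℂ)) : Set (σ → ℂ) :=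
  @closure _ (zariskiTopology σ) Y

/-- `Y` is an irreducible component of `X`, i.e. a maximal irreducible subset of `X`. -/
def IsIrreducibleComponent {σ : Type} (X Y : Set (σ → ℂ)) : Prop :=
  Maximal (fun Z => Z ⊆ X ∧ @IsIrreducible _ (zariskiTopology σ) Z) Y

/-- The (Krull) dimension of `Y` with the topology induced by the Zariski topology. -/
noncomputable def zariskiDim {σ : Type} (Y : Set (σ → ℂ)) : WithBot ℕ∞ :=
  @topologicalKrullDim Y (TopologicalSpace.induced Subtype.val (zariskiTopology σ))

/-- The Zariski tangent space of `Y` at `p`: all `d` that are annihilated by the differentials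
at `p` of all polynomials vanishing on `Y`. -/
noncomputable def tangentSpace {σ : Type} (Y : Set (σ → ℂ)) (p : σ → ℂ) :
    Submodule ℂ (σ → ℂ) where
  carrier := {d | ∀ f : MvPolynomial σ ℂ, (∀ y ∈ Y, eval y f = 0) →
    ∑ i ∈ f.vars, eval p (pderiv i f) * d i = 0}
  zero_mem' := by intro f _; simp
  add_mem' := by
    intro d e hd he f hf
    simp [mul_add, Finset.sum_add_distrib, hd f hf, he f hf]
  smul_mem' := by
    intro c d hd f hf
    have h := hd f hf
    calc ∑ i ∈ f.vars, eval p (pderiv i f) * (c • d) i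
        = c * ∑ i ∈ f.vars, eval p (pderiv i f) * d i := by
          rw [Finset.mul_sum]
          refine Finset.sum_congr rfl fun i _ => ?_
          simp only [Pi.smul_apply, smul_eq_mul]
          ring
      _ = 0 := by rw [h, mul_zero]

/-- `p` is a smooth point of the irreducible algebraic set `Y`: the dimension of the Zariski
tangent space at `p` equals the dimension of `Y`. -/
def IsSmoothPoint {σ : Type} (Y : Set (σ → ℂ)) (p : σ → ℂ) : Prop :=
  p ∈ Y ∧ ((Cardinal.toENat (Module.rank ℂ (tangentSpace Y p)) : ℕ∞) : WithBot ℕ∞) = zariskiDim Y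

/-- `f` is a regular function on `Y`: locally on `Y` it is a quotient of polynomials. -/
def IsRegularFunction {σ : Type} (Y : Set (σ → ℂ)) (f : (σ → ℂ) → ℂ) : Prop :=
  ∀ p ∈ Y, ∃ g h : MvPolynomial σ ℂ, eval p h ≠ 0 ∧
    ∀ q ∈ Y, eval q h ≠ 0 → f q = eval q g / eval q h

/-- `F` is a regular map on `Y`: all its coordinates are regular functions. -/
def IsRegularMap {σ τ : Type} (Y : Set (σ → ℂ)) (F : (σ → ℂ) → (τ → ℂ)) : Prop :=
  ∀ j, IsRegularFunction Y (fun x => F x j)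

/-- `F` restricts to an isomorphism of the (quasi-)affine algebraic sets `Y` and `Z`. -/
def IsIsomorphismOn {σ τ : Type} (F : (σ → ℂ) → (τ → ℂ)) (Y : Set (σ → ℂ))
    (Z : Set (τ → ℂ)) : Prop :=
  Set.BijOn F Y Z ∧ IsRegularMap Y F ∧
    ∃ G : (τ → ℂ) → (σ → ℂ), Set.InvOn G F Y Z ∧ IsRegularMap Z G

/-! ### The group -/

/-- The relation `S T⁻¹ S⁻¹ T S = T S T⁻¹ S⁻¹ T`, with `S` and `T` the generators `0` and `1`. -/
def knotRelator : FreeGroup (Fin 2) :=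
  (FreeGroup.of 0 * (FreeGroup.of 1)⁻¹ * (FreeGroup.of 0)⁻¹ * FreeGroup.of 1 * FreeGroup.of 0) *
  (FreeGroup.of 1 * FreeGroup.of 0 * (FreeGroup.of 1)⁻¹ * (FreeGroup.of 0)⁻¹ * FreeGroup.of 1)⁻¹

/-- The group `⟨S, T ∣ S T⁻¹ S⁻¹ T S = T S T⁻¹ S⁻¹ T⟩` of the figure eight knot. -/
abbrev KnotGroup : Type := PresentedGroup {knotRelator}

/-- The generator `S`, a meridian. -/
def S : KnotGroup := PresentedGroup.of 0

/-- The generator `T`, a meridian. -/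
def T : KnotGroup := PresentedGroup.of 1

/-- The element `a = T⁻¹ S T S⁻¹`, one of the two free generators of the fibre group. -/
def a : KnotGroup := T⁻¹ * S * T * S⁻¹

/-! ### Representations and characters -/

/-- The subspace `V` is invariant under the representation `ρ`. -/
def IsInvariant {n : ℕ} (ρ : KnotGroup →* GL (Fin n) ℂ) (V : Submodule ℂ (Fin n → ℂ)) : Prop :=
  ∀ γ, ∀ x ∈ V, (ρ γ).val.mulVec x ∈ V

/-- A representation is reducible if it has a proper nonzero invariant subspace. -/
def IsReducible {n : ℕ} (ρ : KnotGroup →* GL (Fin n) ℂ) : Prop :=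
  ∃ V : Submodule ℂ (Fin n → ℂ), V ≠ ⊥ ∧ V ≠ ⊤ ∧ IsInvariant ρ V

/-- Totally reducible: a direct sum of three one-dimensional representations. -/
def IsTotallyReducible (ρ : KnotGroup →* GL (Fin 3) ℂ) : Prop :=
  ∃ e : Module.Basis (Fin 3) ℂ (Fin 3 → ℂ), ∀ i, IsInvariant ρ (Submodule.span ℂ {e i})

/-- Partially reducible: the direct sum of a one-dimensional representation and of a
two-dimensional irreducible representation. -/
def IsPartiallyReducible (ρ : KnotGroup →* GL (Fin 3) ℂ) : Prop :=
  ∃ L W : Submodule ℂ (Fin 3 → ℂ), IsCompl L W ∧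
    Module.finrank ℂ L = 1 ∧ Module.finrank ℂ W = 2 ∧ IsInvariant ρ L ∧ IsInvariant ρ W ∧
    ∀ U : Submodule ℂ (Fin 3 → ℂ), U ≤ W → IsInvariant ρ U → U = ⊥ ∨ U = W

/-- The character `γ ↦ tr ρ(γ)`, a point of the affine space with coordinates indexed by the
group. -/
def character {n : ℕ} (ρ : KnotGroup →* GL (Fin n) ℂ) : KnotGroup → ℂ :=
  fun γ => (ρ γ).val.trace

/-- A representation in `SL(3,ℂ)` as a representation in `GL(3,ℂ)`. -/
def toGLRep (ρ : KnotGroup →* Matrix.SpecialLinearGroup (Fin 3) ℂ) : KnotGroup →* GL (Fin 3) ℂ :=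
  Matrix.SpecialLinearGroup.toGL.comp ρ

/-- The character variety of the group in `SL(3,ℂ)`: its points are the characters of
representations, and its regular functions are the polynomials in the trace functions
`χ ↦ χ γ`. -/
def charVarietySL3 : Set (KnotGroup → ℂ) :=
  {χ | ∃ ρ : KnotGroup →* Matrix.SpecialLinearGroup (Fin 3) ℂ, χ = character (toGLRep ρ)}

/-- The locus of reducible representations in the character variety in `SL(3,ℂ)`. -/
def reducibleLocus : Set (KnotGroup → ℂ) :=
  {χ | χ ∈ charVarietySL3 ∧ ∃ ρ : KnotGroup →* Matrix.SpecialLinearGroup (Fin 3) ℂ,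
    IsReducible (toGLRep ρ) ∧ χ = character (toGLRep ρ)}

/-- `X_TR`: the characters of totally reducible representations in `SL(3,ℂ)`. -/
def XTR : Set (KnotGroup → ℂ) :=
  {χ | ∃ ρ : KnotGroup →* Matrix.SpecialLinearGroup (Fin 3) ℂ,
    IsTotallyReducible (toGLRep ρ) ∧ χ = character (toGLRep ρ)}

/-- `X_PR`: the Zariski closure of the set of characters of partially reducible
representations in `SL(3,ℂ)`. -/
def XPR : Set (KnotGroup → ℂ) :=
  zariskiClosure {χ | ∃ ρ : KnotGroup →* Matrix.SpecialLinearGroup (Fin 3) ℂ,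
    IsPartiallyReducible (toGLRep ρ) ∧ χ = character (toGLRep ρ)}

/-- The character variety of the group in `GL(2,ℂ)`. -/
def charVarietyGL2 : Set (KnotGroup → ℂ) :=
  {χ | ∃ ρ : KnotGroup →* GL (Fin 2) ℂ, χ = character ρ}

/-- `X₂`: the Zariski closure of the set of characters of irreducible representations in
`GL(2,ℂ)`. -/
def X2 : Set (KnotGroup → ℂ) :=
  zariskiClosure {χ | ∃ ρ : KnotGroup →* GL (Fin 2) ℂ, ¬ IsReducible ρ ∧ χ = character ρ}

/-! ### Coordinates -/

/-- The coordinates `(y, ȳ, z, z̄, α, ᾱ, β, β̄)`, where `α` and `ᾱ` are the values at the commutators `[T, S]` and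
`[S, T]`, with `[g, h] = g h g⁻¹ h⁻¹`. -/
def coords (χ : KnotGroup → ℂ) : Fin 8 → ℂ :=
  ![χ S, χ S⁻¹, χ (S * T), χ (S⁻¹ * T⁻¹),
    χ (T * S * T⁻¹ * S⁻¹), χ (S * T * S⁻¹ * T⁻¹), χ (S⁻¹ * T), χ (S * T⁻¹)]

/-- The two coordinates `(y, ȳ)`. -/
def coordsY (χ : KnotGroup → ℂ) : Fin 2 → ℂ := ![χ S, χ S⁻¹]

/-- The coordinates `(v, w, x₁) = (tr ρ(S), det ρ(S), tr ρ(a))` of the character `χ` of a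
two-dimensional representation `ρ`, where `det A = (tr(A)² - tr(A²)) / 2`
(see `coordsGL2_character`). -/
noncomputable def coordsGL2 (χ : KnotGroup → ℂ) : Fin 3 → ℂ :=
  ![χ S, ((χ S) ^ 2 - χ (S ^ 2)) / 2, χ a]

theorem coordsGL2_character (ρ : KnotGroup →* GL (Fin 2) ℂ) :
    coordsGL2 (character ρ) = ![(ρ S).val.trace, (ρ S).val.det, (ρ a).val.trace] := by
  have h : ((ρ S).val.trace ^ 2 - (ρ (S ^ 2)).val.trace) / 2 = (ρ S).val.det := by
    rw [map_pow, Units.val_pow_eq_pow_val, pow_two (ρ S).val, Matrix.trace_fin_two,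
      Matrix.trace_fin_two, Matrix.det_fin_two]
    simp only [Matrix.mul_apply, Fin.sum_univ_two]
    ring
  simp only [coordsGL2, character, h]

/-- The surface `(x₁² + x₁ - 1) / (x₁ - 1) · w = v²` in `ℂ × ℂ^* × (ℂ - {1})`, with coordinates
`(v, w, x₁)`. -/
def surfaceP : Set (Fin 3 → ℂ) :=
  {p | p 1 ≠ 0 ∧ p 2 ≠ 1 ∧ (p 2 ^ 2 + p 2 - 1) / (p 2 - 1) * p 1 = p 0 ^ 2}

/-- The parametrization, for parameters `(v, w, x₁)` and with values in the order
`(y, ȳ, z, z̄, α, ᾱ, β, β̄)`. -/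
noncomputable def Phi (p : Fin 3 → ℂ) : Fin 8 → ℂ :=
  ![p 0 + 1 / p 1,
    p 1 + p 0 / p 1,
    p 1 * (p 2 + 1) + 1 / p 1 ^ 2,
    (p 2 + 1) / p 1 + p 1 ^ 2,
    p 2 + 1,
    p 2 + 1,
    p 2 / (p 2 - 1) + 1,
    p 2 / (p 2 - 1) + 1]

/-- The action of a third root of unity on the coordinates `(y, ȳ, z, z̄, α, ᾱ, β, β̄)`. -/
def mu3Act (ζ : ℂ) (p : Fin 8 → ℂ) : Fin 8 → ℂ :=
  ![ζ * p 0, ζ ^ 2 * p 1, ζ ^ 2 * p 2, ζ * p 3, p 4, p 5, p 6, p 7]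

/-- The three points `μ₃ · (4, 4, 8, 8, 3, 3, 3, 3)`. -/
def nodes : Set (Fin 8 → ℂ) :=
  {p | ∃ ζ : ℂ, ζ ^ 3 = 1 ∧ p = mu3Act ζ ![4, 4, 8, 8, 3, 3, 3, 3]}

/-- The set `α = ᾱ = β = β̄ = 3`, `z = y² - 2ȳ`, `z̄ = ȳ² - 2y` in `ℂ⁸`. -/
def planeTR : Set (Fin 8 → ℂ) :=
  {p | p 4 = 3 ∧ p 5 = 3 ∧ p 6 = 3 ∧ p 7 = 3 ∧
    p 2 = p 0 ^ 2 - 2 * p 1 ∧ p 3 = p 1 ^ 2 - 2 * p 0}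

/-- The plane curve `64 - 28 y ȳ - y² ȳ² + 5 (y³ + ȳ³) = 0`. -/
def planeCurve : Set (Fin 2 → ℂ) :=
  {q | 64 - 28 * q 0 * q 1 - q 0 ^ 2 * q 1 ^ 2 + 5 * (q 0 ^ 3 + q 1 ^ 3) = 0}

end FigureEight

namespace FigureEight

open MvPolynomial
open scoped Topology

/-! ### Generalities on the Zariski topology -/

section Zariski

variable {σ τ : Type}

/-! The two meridians are conjugate (`conj_S_eq_T`), so in dimension two S and T have the same trace
v and determinant w. By Cayley–Hamilton every trace is then a polynomial in v, w, w⁻¹ and tr(ST)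
(`exists_trace_polynomials`). For 2×2 matrices with equal trace and determinant, the difference of
the two sides of the knot relation is a scalar times S − T (`mul_adjugate_identity`). Since S = T
forces reducibility, an irreducible representation satisfies one trace equation; writing tr(ST) =
w(x₁ + 1), this is the equation of the surface 𝒫, and x₁ turns out to be tr(a). Conversely, an
explicit pair of triangular matrices realizes every point of 𝒫 (`exists_hasParams`). This identifies
X₂ with the family `chi` over 𝒫.

A reducible character in SL(3) is the sum of a character of exponent-sum type and a two-dimensional
character, and determinant one makes the first the inverse determinant of the second. Either the
plane is irreducible, which gives the family `psi` over 𝒫, or all three constituents are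
one-dimensional, and then the character is a power sum of three eigenvalues with product one,
governed by (y, ȳ). Hence the locus is X_TR ∪ X_PR, both closed and irreducible.

The eight coordinates suffice because a trace differs from that of the diagonal representation with
the same v and w by a multiple of (β − 3)w. The functions on 𝒫 are generated by 1, w, w⁻¹ over the
polynomials in the coordinates, and (β − 3)w = y² − 2ȳ − z and (β − 3)w⁻¹ = ȳ² − 2y − z̄ are
themselves such polynomials (`exists_coordinate_polynomial`). The correction vanishes identically on
X_TR, so a single polynomial serves both components.

The image of Φ is cut out by nine equations (`exists_Phi_eq`). Where β ≠ 3 one solves for w. Where β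
= 3 the point lies on X_TR, and it comes from 𝒫 exactly when two of the eigenvalues satisfy (l + m)²
= 5lm. Eliminating the choice of the pair gives a cubic in K = (l + m)²/(lm), whose value at K = 5
is the plane curve.

Off the three nodes, w is a fraction in the coordinates with denominator β − 3 or (α + 1)² − yȳ
(`exists_fraction`). This gives injectivity, and it identifies the tangent space of X_PR with that
of 𝒫, which has dimension two. A node has the eigenvalues ζ, ζs, ζt with s + t = 3 and st = 1; the
pairs {ζ, ζs} and {ζ, ζt} both have K = 5, so two branches meet there and their tangent planes
contain three independent vectors. The dimension of X_PR is two: the coordinates are integral over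
ℂ[α + β, y + ȳ], and a chain point ⊂ curve ⊂ X_PR gives the lower bound. -/

theorem isTopologicalBasis_zariski :
    @TopologicalSpace.IsTopologicalBasis _ (zariskiTopology σ)
      {U | ∃ f : MvPolynomial σ ℂ, U = {x | eval x f ≠ 0}} := by
  let _ := zariskiTopology σ
  refine ⟨?_, ?_, rfl⟩
  · rintro _ ⟨f, rfl⟩ _ ⟨g, rfl⟩ x ⟨hf, hg⟩
    refine ⟨_, ⟨f * g, rfl⟩, ?_, ?_⟩
    · simpa using ⟨hf, hg⟩
    · intro z hz
      simpa using hz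
  · refine Set.eq_univ_of_forall fun x => ⟨_, ⟨1, rfl⟩, ?_⟩
    simp

theorem isOpen_nonvanishing (f : MvPolynomial σ ℂ) :
    IsOpen[zariskiTopology σ] {x | eval x f ≠ 0} :=
  TopologicalSpace.isOpen_generateFrom_of_mem ⟨f, rfl⟩

theorem isClosed_vanishing (f : MvPolynomial σ ℂ) :
    IsClosed[zariskiTopology σ] {x | eval x f = 0} := by
  let _ := zariskiTopology σ
  rw [← isOpen_compl_iff]
  exact isOpen_nonvanishing f

/-- Nonvanishing sets form a basis, so a single polynomial separates a point from a closed set.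
Nothing here needs σ to be finite, which matters because characters live in the affine space indexed
by the group. -/
theorem mem_zariskiClosure_iff {Y : Set (σ → ℂ)} {x : σ → ℂ} :
    x ∈ zariskiClosure Y ↔
      ∀ f : MvPolynomial σ ℂ, (∀ y ∈ Y, eval y f = 0) → eval x f = 0 := by
  let _ := zariskiTopology σ
  constructor
  · intro hx f hf
    exact closure_minimal (s := Y) (t := {x | eval x f = 0}) hf (isClosed_vanishing f) hx
  · intro h
    refine (isTopologicalBasis_zariski.mem_closure_iff).2 ?_
    rintro _ ⟨f, rfl⟩ hx
    by_contra hne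
    refine hx (h f fun y hy => ?_)
    by_contra h0
    exact hne ⟨y, h0, hy⟩

theorem isClosed_zariskiClosure (Y : Set (σ → ℂ)) :
    IsClosed[zariskiTopology σ] (zariskiClosure Y) :=
  @isClosed_closure _ (zariskiTopology σ) Y

theorem subset_zariskiClosure (Y : Set (σ → ℂ)) : Y ⊆ zariskiClosure Y :=
  @subset_closure _ (zariskiTopology σ) Y

theorem zariskiClosure_eq_of_isClosed {Y : Set (σ → ℂ)} (h : IsClosed[zariskiTopology σ] Y) :
    zariskiClosure Y = Y :=
  @IsClosed.closure_eq _ (zariskiTopology σ) Y h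

theorem isClosed_of_forall {Y : Set (σ → ℂ)}
    (h : ∀ x, (∀ f : MvPolynomial σ ℂ, (∀ y ∈ Y, eval y f = 0) → eval x f = 0) → x ∈ Y) :
    IsClosed[zariskiTopology σ] Y := by
  have : zariskiClosure Y = Y :=
    Set.Subset.antisymm (fun x hx => h x (mem_zariskiClosure_iff.1 hx)) (subset_zariskiClosure Y)
  rw [← this]
  exact isClosed_zariskiClosure Y

theorem exists_eval_ne_zero {Y : Set (σ → ℂ)} (hY : IsClosed[zariskiTopology σ] Y)
    {x : σ → ℂ} (hx : x ∉ Y) :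
    ∃ f : MvPolynomial σ ℂ, (∀ y ∈ Y, eval y f = 0) ∧ eval x f ≠ 0 := by
  rw [← zariskiClosure_eq_of_isClosed hY, mem_zariskiClosure_iff] at hx
  push Not at hx
  exact hx

/-- Irreducibility is primality of the vanishing ideal, so it can be tested on pairs of polynomials.
-/
theorem isIrreducible_zariski_iff {Y : Set (σ → ℂ)} :
    @IsIrreducible _ (zariskiTopology σ) Y ↔ Y.Nonempty ∧
      ∀ f g : MvPolynomial σ ℂ, (∀ y ∈ Y, eval y f * eval y g = 0) →
        (∀ y ∈ Y, eval y f = 0) ∨ ∀ y ∈ Y, eval y g = 0 := by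
  let _ := zariskiTopology σ
  constructor
  · rintro ⟨hne, hY⟩
    refine ⟨hne, fun f g hfg => ?_⟩
    by_contra! hcon
    obtain ⟨⟨a, ha, hfa⟩, b, hb, hgb⟩ := hcon
    obtain ⟨c, hc, h1, h2⟩ := hY _ _ (isOpen_nonvanishing f) (isOpen_nonvanishing g)
      ⟨a, ha, hfa⟩ ⟨b, hb, hgb⟩
    exact (mul_ne_zero h1 h2) (hfg c hc)
  · rintro ⟨hne, hY⟩
    refine ⟨hne, fun U V hU hV ⟨a, ha, haU⟩ ⟨b, hb, hbV⟩ => ?_⟩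
    obtain ⟨_, ⟨f, rfl⟩, hfa, hfU⟩ := isTopologicalBasis_zariski.exists_subset_of_mem_open haU hU
    obtain ⟨_, ⟨g, rfl⟩, hgb, hgV⟩ := isTopologicalBasis_zariski.exists_subset_of_mem_open hbV hV
    by_contra hcon
    have hfg : ∀ y ∈ Y, eval y f * eval y g = 0 := by
      intro y hy
      by_contra h0
      exact hcon ⟨y, hy, hfU (left_ne_zero_of_mul h0), hgV (right_ne_zero_of_mul h0)⟩
    rcases hY f g hfg with h | h
    · exact hfa (h a ha)
    · exact hgb (h b hb)

theorem isIrreducible_zariskiClosure {Y : Set (σ → ℂ)}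
    (h : @IsIrreducible _ (zariskiTopology σ) Y) :
    @IsIrreducible _ (zariskiTopology σ) (zariskiClosure Y) :=
  @IsIrreducible.closure _ (zariskiTopology σ) Y h

/-- The function `f` is a fraction whose denominator is a power of `h`. -/
def IsFraction (h : MvPolynomial σ ℂ) (f : (σ → ℂ) → ℂ) : Prop :=
  ∃ (a : MvPolynomial σ ℂ) (k : ℕ), ∀ x, eval x h ≠ 0 → f x * eval x h ^ k = eval x a

theorem isFraction_eval (h a : MvPolynomial σ ℂ) : IsFraction h fun x => eval x a :=
  ⟨a, 0, fun x _ => by simp⟩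

theorem IsFraction.add {h : MvPolynomial σ ℂ} {f g : (σ → ℂ) → ℂ} (hf : IsFraction h f)
    (hg : IsFraction h g) : IsFraction h fun x => f x + g x := by
  obtain ⟨a, k, ha⟩ := hf
  obtain ⟨b, l, hb⟩ := hg
  refine ⟨a * h ^ l + b * h ^ k, k + l, fun x hx => ?_⟩
  simp only [map_add, map_mul, map_pow, ← ha x hx, ← hb x hx]
  ring

theorem IsFraction.mul {h : MvPolynomial σ ℂ} {f g : (σ → ℂ) → ℂ} (hf : IsFraction h f)
    (hg : IsFraction h g) : IsFraction h fun x => f x * g x := by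
  obtain ⟨a, k, ha⟩ := hf
  obtain ⟨b, l, hb⟩ := hg
  refine ⟨a * b, k + l, fun x hx => ?_⟩
  simp only [map_mul, ← ha x hx, ← hb x hx]
  ring

theorem isFraction_inv {h g : MvPolynomial σ ℂ} (hg : g ∣ h) :
    IsFraction h fun x => (eval x g)⁻¹ := by
  obtain ⟨k, rfl⟩ := hg
  refine ⟨k, 1, fun x hx => ?_⟩
  rw [map_mul] at hx ⊢
  rw [pow_one, inv_mul_cancel_left₀ (left_ne_zero_of_mul hx)]

theorem isFraction_comp {h : MvPolynomial σ ℂ} {F : (σ → ℂ) → (τ → ℂ)}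
    (hF : ∀ j, IsFraction h fun x => F x j) (f : MvPolynomial τ ℂ) :
    IsFraction h fun x => eval (F x) f := by
  induction f using MvPolynomial.induction_on with
  | C c => simpa using isFraction_eval h (C c)
  | add p q hp hq => simpa using hp.add hq
  | mul_X p j hp => simpa using hp.mul (hF j)

/-- If `F` is given by fractions whose denominators are powers of `h`, then the image of the
nonvanishing set of `h` is irreducible. -/
theorem isIrreducible_image_nonvanishing (h : MvPolynomial σ ℂ) (h0 : h ≠ 0)
    (F : (σ → ℂ) → (τ → ℂ)) (hF : ∀ j, IsFraction h fun x => F x j) :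
    @IsIrreducible _ (zariskiTopology τ) (F '' {x | eval x h ≠ 0}) := by
  rw [isIrreducible_zariski_iff]
  constructor
  · by_contra hne
    refine h0 (MvPolynomial.funext fun x => ?_)
    by_contra hx
    exact hne ⟨_, x, by simpa using hx, rfl⟩
  · intro f g hfg
    obtain ⟨a, k, ha⟩ := isFraction_comp hF f
    obtain ⟨b, l, hb⟩ := isFraction_comp hF g
    -- The factor h makes the product vanish also where the fractions are undefined, so it is zero
    -- as a polynomial.
    have hab : a * b * h = 0 := by
      refine MvPolynomial.funext fun x => ?_
      by_cases hx : eval x h = 0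
      · simp [hx]
      · have := hfg _ ⟨x, hx, rfl⟩
        simp only [map_mul, ← ha x hx, ← hb x hx, map_zero]
        linear_combination eval x h ^ k * eval x h ^ l * eval x h * this
    rcases mul_eq_zero.1 ((mul_eq_zero.1 hab).resolve_right h0) with h1 | h1
    · left
      rintro _ ⟨x, hx, rfl⟩
      have := ha x hx
      rw [h1, map_zero] at this
      exact (mul_eq_zero.1 this).resolve_right (pow_ne_zero _ hx)
    · right
      rintro _ ⟨x, hx, rfl⟩
      have := hb x hx
      rw [h1, map_zero] at this
      exact (mul_eq_zero.1 this).resolve_right (pow_ne_zero _ hx)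

/-- A set between an irreducible set and its closure is irreducible. -/
theorem isIrreducible_of_subset_zariskiClosure {A Y : Set (σ → ℂ)}
    (hA : @IsIrreducible _ (zariskiTopology σ) A) (hAY : A ⊆ Y) (hYA : Y ⊆ zariskiClosure A) :
    @IsIrreducible _ (zariskiTopology σ) Y := by
  rw [isIrreducible_zariski_iff] at hA ⊢
  refine ⟨hA.1.mono hAY, fun f g hfg => ?_⟩
  exact (hA.2 f g fun y hy => hfg y (hAY hy)).imp
    (fun h y hy => mem_zariskiClosure_iff.1 (hYA hy) f h)
    (fun h y hy => mem_zariskiClosure_iff.1 (hYA hy) g h)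

theorem isIrreducible_subset_union {Z A B : Set (σ → ℂ)}
    (hZ : @IsIrreducible _ (zariskiTopology σ) Z) (hA : IsClosed[zariskiTopology σ] A)
    (hB : IsClosed[zariskiTopology σ] B) (h : Z ⊆ A ∪ B) : Z ⊆ A ∨ Z ⊆ B := by
  let _ := zariskiTopology σ
  exact isPreirreducible_iff_isClosed_union_isClosed.1 hZ.2 A B hA hB h

/-- The irreducible components of a union of two irreducible closed sets, none of which contains
the other. -/
theorem irreducibleComponents_union {A B : Set (σ → ℂ)}
    (hA : IsClosed[zariskiTopology σ] A) (hB : IsClosed[zariskiTopology σ] B)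
    (hA' : @IsIrreducible _ (zariskiTopology σ) A) (hB' : @IsIrreducible _ (zariskiTopology σ) B)
    (hAB : ¬ A ⊆ B) (hBA : ¬ B ⊆ A) :
    {Y | IsIrreducibleComponent (A ∪ B) Y} = {A, B} := by
  ext Y
  simp only [Set.mem_ofPred_eq, Set.mem_insert_iff, Set.mem_singleton_iff]
  constructor
  · rintro ⟨⟨h1, h2⟩, h3⟩
    rcases isIrreducible_subset_union h2 hA hB h1 with h | h
    · exact Or.inl (h.antisymm (h3 ⟨Set.subset_union_left, hA'⟩ h))
    · exact Or.inr (h.antisymm (h3 ⟨Set.subset_union_right, hB'⟩ h))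
  · rintro (rfl | rfl)
    · refine ⟨⟨Set.subset_union_left, hA'⟩, fun Z hZ hYZ => ?_⟩
      rcases isIrreducible_subset_union hZ.2 hA hB hZ.1 with h | h
      · exact h
      · exact (hAB (hYZ.trans h)).elim
    · refine ⟨⟨Set.subset_union_right, hB'⟩, fun Z hZ hYZ => ?_⟩
      rcases isIrreducible_subset_union hZ.2 hA hB hZ.1 with h | h
      · exact (hBA (hYZ.trans h)).elim
      · exact h

/-! ### Regular functions -/

theorem isRegularFunction_of_eq_eval {Y : Set (σ → ℂ)} {f : (σ → ℂ) → ℂ} (g : MvPolynomial σ ℂ)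
    (h : ∀ x ∈ Y, f x = eval x g) : IsRegularFunction Y f :=
  fun p _ => ⟨g, 1, by simp, fun q hq _ => by simp [h q hq]⟩

theorem IsRegularFunction.add {Y : Set (σ → ℂ)} {f f' : (σ → ℂ) → ℂ}
    (hf : IsRegularFunction Y f) (hf' : IsRegularFunction Y f') :
    IsRegularFunction Y (fun x => f x + f' x) := by
  intro p hp
  obtain ⟨g, h, h1, h2⟩ := hf p hp
  obtain ⟨g', h', h1', h2'⟩ := hf' p hp
  refine ⟨g * h' + g' * h, h * h', by simpa using ⟨h1, h1'⟩, fun q hq hk => ?_⟩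
  simp only [map_mul, ne_eq, mul_eq_zero, not_or] at hk
  have := hk.1
  have := hk.2
  simp only [h2 q hq hk.1, h2' q hq hk.2, map_add, map_mul]
  field_simp

theorem IsRegularFunction.mul {Y : Set (σ → ℂ)} {f f' : (σ → ℂ) → ℂ}
    (hf : IsRegularFunction Y f) (hf' : IsRegularFunction Y f') :
    IsRegularFunction Y (fun x => f x * f' x) := by
  intro p hp
  obtain ⟨g, h, h1, h2⟩ := hf p hp
  obtain ⟨g', h', h1', h2'⟩ := hf' p hp
  refine ⟨g * g', h * h', by simpa using ⟨h1, h1'⟩, fun q hq hk => ?_⟩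
  simp only [map_mul, ne_eq, mul_eq_zero, not_or] at hk
  have := hk.1
  have := hk.2
  simp only [h2 q hq hk.1, h2' q hq hk.2, map_mul]
  field_simp

theorem IsRegularFunction.inv {Y : Set (σ → ℂ)} {f : (σ → ℂ) → ℂ}
    (hf : IsRegularFunction Y f) (h0 : ∀ x ∈ Y, f x ≠ 0) :
    IsRegularFunction Y (fun x => (f x)⁻¹) := by
  intro p hp
  obtain ⟨g, h, h1, h2⟩ := hf p hp
  have hg : eval p g ≠ 0 := by
    intro hg
    exact h0 p hp (by rw [h2 p hp h1, hg, zero_div])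
  refine ⟨h * h, g * h, by simpa using ⟨hg, h1⟩, fun q hq hk => ?_⟩
  simp only [map_mul, ne_eq, mul_eq_zero, not_or] at hk
  have := hk.1
  have := hk.2
  simp only [h2 q hq hk.2, map_mul]
  field_simp

theorem IsRegularMap.eval {Y : Set (σ → ℂ)} {F : (σ → ℂ) → (τ → ℂ)} (hF : IsRegularMap Y F)
    (g : MvPolynomial τ ℂ) : IsRegularFunction Y (fun x => eval (F x) g) := by
  induction g using MvPolynomial.induction_on with
  | C c => exact isRegularFunction_of_eq_eval (C c) (by simp)
  | add p q hp hq => simpa using hp.add hq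
  | mul_X p j hp => simpa using hp.mul (hF j)

/-! ### Tangent vectors -/

/-- The differential at `p` of `f` in the direction `d`. -/
noncomputable def differential (p d : σ → ℂ) (f : MvPolynomial σ ℂ) : ℂ :=
  ∑ i ∈ f.vars, eval p (pderiv i f) * d i

theorem mem_tangentSpace_iff {Y : Set (σ → ℂ)} {p d : σ → ℂ} :
    d ∈ tangentSpace Y p ↔
      ∀ f : MvPolynomial σ ℂ, (∀ y ∈ Y, eval y f = 0) → differential p d f = 0 :=
  Iff.rfl

theorem differential_eq_sum (p d : σ → ℂ) {f : MvPolynomial σ ℂ} {s : Finset σ}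
    (hs : f.vars ⊆ s) : differential p d f = ∑ i ∈ s, eval p (pderiv i f) * d i := by
  refine Finset.sum_subset hs fun i _ hi => ?_
  rw [pderiv_eq_zero_of_notMem_vars hi, map_zero, zero_mul]

@[simp] theorem differential_C (p d : σ → ℂ) (c : ℂ) : differential p d (C c) = 0 := by
  simp [differential]

@[simp] theorem differential_one (p d : σ → ℂ) : differential p d 1 = 0 := by
  rw [← map_one (C : ℂ →+* MvPolynomial σ ℂ)]
  exact differential_C p d _

@[simp] theorem differential_X (p d : σ → ℂ) (i : σ) : differential p d (X i) = d i := by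
  classical
  simp [differential, vars_X]

@[simp] theorem differential_add (p d : σ → ℂ) (f g : MvPolynomial σ ℂ) :
    differential p d (f + g) = differential p d f + differential p d g := by
  classical
  rw [differential_eq_sum p d (vars_add_subset f g),
    differential_eq_sum p d (Finset.subset_union_left (s₁ := f.vars) (s₂ := g.vars)),
    differential_eq_sum p d (Finset.subset_union_right (s₁ := f.vars) (s₂ := g.vars)),
    ← Finset.sum_add_distrib]
  exact Finset.sum_congr rfl fun i _ => by rw [map_add, map_add, add_mul]

@[simp] theorem differential_mul (p d : σ → ℂ) (f g : MvPolynomial σ ℂ) :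
    differential p d (f * g) =
      differential p d f * eval p g + eval p f * differential p d g := by
  classical
  rw [differential_eq_sum p d (vars_mul f g),
    differential_eq_sum p d (Finset.subset_union_left (s₁ := f.vars) (s₂ := g.vars)),
    differential_eq_sum p d (Finset.subset_union_right (s₁ := f.vars) (s₂ := g.vars)),
    Finset.sum_mul, Finset.mul_sum, ← Finset.sum_add_distrib]
  refine Finset.sum_congr rfl fun i _ => ?_
  rw [pderiv_mul, map_add, map_mul, map_mul]
  ring

@[simp] theorem differential_neg (p d : σ → ℂ) (f : MvPolynomial σ ℂ) :
    differential p d (-f) = - differential p d f := by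
  have := differential_add p d f (-f)
  rw [add_neg_cancel, ← map_zero (C : ℂ →+* MvPolynomial σ ℂ), differential_C] at this
  linear_combination -this

@[simp] theorem differential_sub (p d : σ → ℂ) (f g : MvPolynomial σ ℂ) :
    differential p d (f - g) = differential p d f - differential p d g := by
  rw [sub_eq_add_neg, differential_add, differential_neg, sub_eq_add_neg]

theorem differential_add_right (p d e : σ → ℂ) (f : MvPolynomial σ ℂ) :
    differential p (d + e) f = differential p d f + differential p e f := by
  simp [differential, mul_add, Finset.sum_add_distrib]

theorem differential_smul_right (p d : σ → ℂ) (c : ℂ) (f : MvPolynomial σ ℂ) :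
    differential p (c • d) f = c * differential p d f := by
  simp only [differential, Pi.smul_apply, smul_eq_mul, Finset.mul_sum]
  exact Finset.sum_congr rfl fun i _ => by ring

/-- The chain rule. Differentiability is needed one coordinate at a time, so σ may be infinite. -/
theorem hasDerivAt_eval {c : ℂ → σ → ℂ} {d : σ → ℂ} {t : ℂ}
    (hc : ∀ i, HasDerivAt (fun s => c s i) (d i) t) (f : MvPolynomial σ ℂ) :
    HasDerivAt (fun s => eval (c s) f) (differential (c t) d f) t := by
  induction f using MvPolynomial.induction_on with
  | C a => simpa using hasDerivAt_const t a
  | add p q hp hq => simpa [Pi.add_def] using HasDerivAt.fun_add hp hq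
  | mul_X p j hp => simpa using HasDerivAt.fun_mul hp (hc j)

/-- The velocity of a curve in `Y` is a tangent vector of `Y`. -/
theorem mem_tangentSpace_of_hasDerivAt {Y : Set (σ → ℂ)} {c : ℂ → σ → ℂ} {d : σ → ℂ} {t : ℂ}
    (hc : ∀ i, HasDerivAt (fun s => c s i) (d i) t) (hY : ∀ᶠ s in nhds t, c s ∈ Y) :
    d ∈ tangentSpace Y (c t) := by
  rw [mem_tangentSpace_iff]
  intro f hf
  refine (hasDerivAt_eval hc f).unique ?_
  refine (hasDerivAt_const t (0 : ℂ)).congr_of_eventuallyEq ?_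
  filter_upwards [hY] with s hs using hf _ hs

theorem continuous_eval_coord (f : MvPolynomial σ ℂ) : Continuous fun x : σ → ℂ => eval x f :=
  MvPolynomial.continuous_eval f

/-- A limit of points of `Y` lies in the Zariski closure of `Y`. -/
theorem mem_zariskiClosure_of_tendsto {ι : Type} {l : Filter ι} [l.NeBot] {Y : Set (σ → ℂ)}
    {c : ι → σ → ℂ} {x : σ → ℂ} (hc : ∀ i, Filter.Tendsto (fun s => c s i) l (nhds (x i)))
    (hY : ∀ᶠ s in l, c s ∈ Y) : x ∈ zariskiClosure Y := by
  rw [mem_zariskiClosure_iff]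
  intro f hf
  have h1 : Filter.Tendsto (fun s => eval (c s) f) l (nhds (eval x f)) :=
    ((continuous_eval_coord f).tendsto x).comp (tendsto_pi_nhds.2 hc)
  refine tendsto_nhds_unique h1 (tendsto_const_nhds.congr' ?_)
  filter_upwards [hY] with s hs using (hf _ hs).symm

/-! ### Dimension -/

/-- The ideal of the polynomials that vanish on a set. -/
noncomputable def idealOf (Y : Set (σ → ℂ)) : Ideal (MvPolynomial σ ℂ) where
  carrier := {f | ∀ y ∈ Y, eval y f = 0}
  zero_mem' := by simp
  add_mem' := by
    intro f g hf hg y hy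
    simp [hf y hy, hg y hy]
  smul_mem' := by
    intro c f hf y hy
    simp [hf y hy]

theorem mem_idealOf {Y : Set (σ → ℂ)} {f : MvPolynomial σ ℂ} :
    f ∈ idealOf Y ↔ ∀ y ∈ Y, eval y f = 0 := Iff.rfl

theorem idealOf_isPrime {Y : Set (σ → ℂ)} (h : @IsIrreducible _ (zariskiTopology σ) Y) :
    (idealOf Y).IsPrime := by
  obtain ⟨⟨y, hy⟩, h2⟩ := isIrreducible_zariski_iff.1 h
  refine ⟨fun htop => ?_, fun {f g} hfg => h2 f g fun y hy => ?_⟩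
  · have h1 : (1 : MvPolynomial σ ℂ) ∈ idealOf Y := htop ▸ Submodule.mem_top
    simpa using h1 y hy
  · simpa using hfg y hy

/-- If all polynomials are integral over `ℂ[x₁, …, xₙ]` modulo those that vanish on `Y`, then
`Y` has dimension at most `n`. -/
theorem zariskiDim_le_of_integral {n : ℕ} {Y : Set (σ → ℂ)}
    (φ : MvPolynomial (Fin n) ℂ →+* MvPolynomial σ ℂ)
    (hφ : ∀ g : MvPolynomial σ ℂ, ∃ p : Polynomial (MvPolynomial (Fin n) ℂ), p.Monic ∧
      p.eval₂ φ g ∈ idealOf Y) :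
    zariskiDim Y ≤ n := by
  let _ := TopologicalSpace.induced (Subtype.val : Y → (σ → ℂ)) (zariskiTopology σ)
  have hirr : ∀ Z : TopologicalSpace.IrreducibleCloseds Y,
      @IsIrreducible _ (zariskiTopology σ) (Subtype.val '' (Z : Set Y)) := by
    intro Z
    exact @IsIrreducible.image _ _ _ (zariskiTopology σ) _ Z.isIrreducible Subtype.val
      (@Continuous.continuousOn _ _ _ (zariskiTopology σ) _ _ continuous_induced_dom)
  have hdim : ringKrullDim (MvPolynomial (Fin n) ℂ) = n := by
    rw [MvPolynomial.ringKrullDim_of_isNoetherianRing, ringKrullDim_eq_zero_of_field]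
    simp
  rw [zariskiDim, topologicalKrullDim, ← hdim, ringKrullDim,
    ← Order.krullDim_orderDual (α := PrimeSpectrum (MvPolynomial (Fin n) ℂ))]
  -- Irreducible closed sets go to the contractions of their prime ideals, reversing inclusion.
  -- Integrality makes this strict: distinct nested primes cannot have the same contraction.
  let F : TopologicalSpace.IrreducibleCloseds Y → (PrimeSpectrum (MvPolynomial (Fin n) ℂ))ᵒᵈ :=
    fun Z => OrderDual.toDual
      ⟨(idealOf (Subtype.val '' (Z : Set Y))).comap φ,
        (idealOf_isPrime (hirr Z)).comap φ⟩
  refine Order.krullDim_le_of_strictMono F fun Z Z' hZ => ?_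
  have hprime := idealOf_isPrime (hirr Z')
  have hle : idealOf (Subtype.val '' (Z' : Set Y)) ≤ idealOf (Subtype.val '' (Z : Set Y)) := by
    rintro f hf _ ⟨y, hy, rfl⟩
    exact hf _ ⟨y, hZ.le hy, rfl⟩
  obtain ⟨y, hy', hy⟩ : ∃ y ∈ (Z' : Set Y), y ∉ (Z : Set Y) := by
    by_contra! hcon
    exact hZ.not_ge hcon
  obtain ⟨C, hC, hCZ⟩ := (@isClosed_induced_iff _ _ (zariskiTopology σ) _ _).1 Z.isClosed
  have hyC : y.1 ∉ C := fun h => hy (by rw [← hCZ]; exact h)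
  obtain ⟨f, hf, hfy⟩ := exists_eval_ne_zero hC hyC
  obtain ⟨p, hp, hpf⟩ := hφ f
  have hmem : f ∈ (idealOf (Subtype.val '' (Z : Set Y)) : Set (MvPolynomial σ ℂ)) \
      idealOf (Subtype.val '' (Z' : Set Y)) := by
    refine ⟨?_, fun h => hfy (h _ ⟨y, hy', rfl⟩)⟩
    rintro _ ⟨z, hz, rfl⟩
    refine hf _ ?_
    rw [← hCZ] at hz
    exact hz
  change Ideal.comap φ _ < Ideal.comap φ _
  refine Ideal.comap_lt_comap_of_root_mem_sdiff hle hmem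
    (p := p) (Polynomial.map_monic_ne_zero hp) ?_
  rintro _ ⟨z, hz, rfl⟩
  exact hpf _ z.2

/-- A chain of three irreducible closed sets bounds the dimension from below. -/
theorem two_le_zariskiDim {Y Z W : Set (σ → ℂ)} (hZ : @IsIrreducible _ (zariskiTopology σ) Z)
    (hW : @IsIrreducible _ (zariskiTopology σ) W) (hY : @IsIrreducible _ (zariskiTopology σ) Y)
    (hZ' : IsClosed[zariskiTopology σ] Z) (hW' : IsClosed[zariskiTopology σ] W)
    (hZW : Z ⊂ W) (hWY : W ⊂ Y) : 2 ≤ zariskiDim Y := by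
  let _ := TopologicalSpace.induced (Subtype.val : Y → (σ → ℂ)) (zariskiTopology σ)
  have hind : ∀ A ⊆ Y, @IsIrreducible _ (zariskiTopology σ) A →
      IsIrreducible (Subtype.val ⁻¹' A : Set Y) := by
    intro A hA ⟨⟨x, hx⟩, hA2⟩
    refine ⟨⟨⟨x, hA hx⟩, hx⟩, ?_⟩
    rintro U V hU hV ⟨u, hu, huU⟩ ⟨v, hv, hvV⟩
    obtain ⟨U', hU', rfl⟩ := (@isOpen_induced_iff _ _ (zariskiTopology σ) _ _).1 hU
    obtain ⟨V', hV', rfl⟩ := (@isOpen_induced_iff _ _ (zariskiTopology σ) _ _).1 hV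
    obtain ⟨z, hz, hz1, hz2⟩ := hA2 U' V' hU' hV' ⟨u, hu, huU⟩ ⟨v, hv, hvV⟩
    exact ⟨⟨z, hA hz⟩, hz, hz1, hz2⟩
  have hcl : ∀ A, IsClosed[zariskiTopology σ] A → IsClosed (Subtype.val ⁻¹' A : Set Y) :=
    fun A hA => (@isClosed_induced_iff _ _ (zariskiTopology σ) _ _).2 ⟨A, hA, rfl⟩
  let z : TopologicalSpace.IrreducibleCloseds Y :=
    ⟨_, hind Z (hZW.subset.trans hWY.subset) hZ, hcl _ hZ'⟩
  let w : TopologicalSpace.IrreducibleCloseds Y := ⟨_, hind W hWY.subset hW, hcl _ hW'⟩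
  let y : TopologicalSpace.IrreducibleCloseds Y :=
    ⟨Set.univ, by simpa using hind Y subset_rfl hY, isClosed_univ⟩
  have hzw : z < w := by
    refine lt_of_le_not_ge (fun x hx => hZW.subset hx) fun hle => hZW.not_subset fun x hx => ?_
    exact hle (show (⟨x, hWY.subset hx⟩ : Y) ∈ (Subtype.val ⁻¹' W : Set Y) from hx)
  have hwy : w < y := by
    refine lt_of_le_not_ge (fun x _ => Set.mem_univ x) fun hle => hWY.not_subset fun x hx => ?_
    exact hle (Set.mem_univ (⟨x, hx⟩ : Y))
  rw [zariskiDim, topologicalKrullDim]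
  refine Order.le_krullDim_iff (n := 2).2 ⟨⟨2, ![z, w, y], fun i => ?_⟩, rfl⟩
  fin_cases i
  · exact hzw
  · exact hwy

/-- Mutually inverse polynomial maps, the second one up to regularity, give an isomorphism. -/
theorem isIsomorphismOn_of_inverse {F : (σ → ℂ) → (τ → ℂ)} {G : (τ → ℂ) → (σ → ℂ)}
    {Y : Set (σ → ℂ)} {Z : Set (τ → ℂ)} (hF : IsRegularMap Y F) (hG : IsRegularMap Z G)
    (hFY : Set.MapsTo F Y Z) (hGZ : Set.MapsTo G Z Y) (hinv : Set.InvOn G F Y Z) :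
    IsIsomorphismOn F Y Z :=
  ⟨hinv.bijOn hFY hGZ, hF, G, hinv, hG⟩

end Zariski

/-! ### The group of the figure eight knot -/

theorem knot_relation : S * T⁻¹ * S⁻¹ * T * S = T * S * T⁻¹ * S⁻¹ * T :=
  PresentedGroup.mk_eq_mk_of_mul_inv_mem (rels := {knotRelator}) (Set.mem_singleton _)

/-- The homomorphism defined by the images of the two generators. -/
def knotLift {G : Type*} [Group G] (s t : G)
    (h : s * t⁻¹ * s⁻¹ * t * s = t * s * t⁻¹ * s⁻¹ * t) : KnotGroup →* G :=
  PresentedGroup.toGroup (f := ![s, t]) (by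
    rintro _ rfl
    simp only [knotRelator, map_mul, map_inv, FreeGroup.lift_apply_of, Matrix.cons_val_zero,
      Matrix.cons_val_one]
    exact mul_inv_eq_one.2 h)

@[simp] theorem knotLift_S {G : Type*} [Group G] (s t : G)
    (h : s * t⁻¹ * s⁻¹ * t * s = t * s * t⁻¹ * s⁻¹ * t) : knotLift s t h S = s :=
  PresentedGroup.toGroup.of _

@[simp] theorem knotLift_T {G : Type*} [Group G] (s t : G)
    (h : s * t⁻¹ * s⁻¹ * t * s = t * s * t⁻¹ * s⁻¹ * t) : knotLift s t h T = t :=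
  PresentedGroup.toGroup.of _

theorem knotGroup_induction {p : KnotGroup → Prop} (one : p 1)
    (mul_S : ∀ γ, p γ → p (γ * S)) (mul_T : ∀ γ, p γ → p (γ * T))
    (mul_S_inv : ∀ γ, p γ → p (γ * S⁻¹)) (mul_T_inv : ∀ γ, p γ → p (γ * T⁻¹)) (γ : KnotGroup) :
    p γ := by
  have hγ : γ ∈ Subgroup.closure (Set.range (PresentedGroup.of (rels := {knotRelator}))) := by
    simp
  refine Subgroup.closure_induction_right (p := fun γ _ => p γ) one ?_ ?_ hγ
  · rintro γ _ _ ⟨i, rfl⟩ h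
    fin_cases i
    · exact mul_S γ h
    · exact mul_T γ h
  · rintro γ _ _ ⟨i, rfl⟩ h
    fin_cases i
    · exact mul_S_inv γ h
    · exact mul_T_inv γ h

/-- The image of a group in a monoid consists of units, which reduces this to extensionality for
presented groups. -/
theorem knotGroup_hom_ext {G : Type*} [Monoid G] {φ ψ : KnotGroup →* G} (hS : φ S = ψ S)
    (hT : φ T = ψ T) : φ = ψ := by
  have h : φ.toHomUnits = ψ.toHomUnits := by
    refine PresentedGroup.ext fun i => Units.ext ?_
    fin_cases i
    · exact hS
    · exact hT
  ext γ
  exact congrArg Units.val (DFunLike.congr_fun h γ)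

/-- The exponent sum of an element of the group. -/
def expSum (γ : KnotGroup) : ℤ :=
  Multiplicative.toAdd (knotLift (Multiplicative.ofAdd (1 : ℤ)) (Multiplicative.ofAdd (1 : ℤ))
    (by group) γ)

@[simp] theorem expSum_S : expSum S = 1 := by simp [expSum]

@[simp] theorem expSum_T : expSum T = 1 := by simp [expSum]

@[simp] theorem expSum_mul (γ δ : KnotGroup) : expSum (γ * δ) = expSum γ + expSum δ := by
  simp [expSum]

@[simp] theorem expSum_inv (γ : KnotGroup) : expSum γ⁻¹ = - expSum γ := by
  simp [expSum]

@[simp] theorem expSum_one : expSum 1 = 0 := by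
  simp [expSum]

/-- The homomorphism with the given value at both generators. -/
def expHom {G : Type*} [Group G] (g : G) : KnotGroup →* G where
  toFun γ := g ^ expSum γ
  map_one' := by simp
  map_mul' γ δ := by rw [expSum_mul, zpow_add]

@[simp] theorem expHom_apply {G : Type*} [Group G] (g : G) (γ : KnotGroup) :
    expHom g γ = g ^ expSum γ := rfl

/-- In a commutative group one side of the knot relation collapses to S and the other to T. -/
theorem map_T_eq_map_S {G : Type*} [CommGroup G] (φ : KnotGroup →* G) : φ T = φ S := by
  have h := congrArg φ knot_relation
  simp only [map_mul, map_inv] at h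
  have h1 : φ S * (φ T)⁻¹ * (φ S)⁻¹ * φ T * φ S = φ S := by
    rw [mul_comm (φ S) (φ T)⁻¹]; group
  have h2 : φ T * φ S * (φ T)⁻¹ * (φ S)⁻¹ * φ T = φ T := by
    rw [mul_comm (φ T) (φ S)]; group
  rw [h1, h2] at h
  exact h.symm

theorem hom_eq_expHom {G : Type*} [CommGroup G] (φ : KnotGroup →* G) : φ = expHom (φ S) :=
  knotGroup_hom_ext (by simp) (by simp [map_T_eq_map_S])

/-- With g = S T⁻¹ S⁻¹ T the knot relation reads gS = Tg. -/
theorem conj_S_eq_T : (S * T⁻¹ * S⁻¹ * T) * S * (S * T⁻¹ * S⁻¹ * T)⁻¹ = T := by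
  have h := knot_relation
  rw [mul_inv_eq_iff_eq_mul, h]
  group

/-! ### Invariant subspaces -/

theorem trace_map_T {n : ℕ} (ρ : KnotGroup →* GL (Fin n) ℂ) :
    (ρ T).val.trace = (ρ S).val.trace := by
  rw [← conj_S_eq_T, map_mul, map_mul, map_inv, Units.val_mul, Units.val_mul]
  exact Matrix.trace_units_conj _ _

theorem det_map_T {n : ℕ} (ρ : KnotGroup →* GL (Fin n) ℂ) :
    (ρ T).val.det = (ρ S).val.det := by
  rw [← conj_S_eq_T, map_mul, map_mul, map_inv, Units.val_mul, Units.val_mul]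
  exact Matrix.det_units_conj _ _

/-- The two diagonal blocks of a block triangular representation. -/
theorem exists_blocks_of_triangular {p q : ℕ}
    (N : KnotGroup →* Matrix (Fin p ⊕ Fin q) (Fin p ⊕ Fin q) ℂ)
    (h : (∀ γ, (N γ).toBlocks₂₁ = 0) ∨ ∀ γ, (N γ).toBlocks₁₂ = 0) :
    ∃ (ρ₁ : KnotGroup →* GL (Fin p) ℂ) (ρ₂ : KnotGroup →* GL (Fin q) ℂ),
      (∀ γ, (ρ₁ γ).val = (N γ).toBlocks₁₁) ∧ (∀ γ, (ρ₂ γ).val = (N γ).toBlocks₂₂) := by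
  have hmul : ∀ γ δ, (N (γ * δ)).toBlocks₁₁ = (N γ).toBlocks₁₁ * (N δ).toBlocks₁₁ ∧
      (N (γ * δ)).toBlocks₂₂ = (N γ).toBlocks₂₂ * (N δ).toBlocks₂₂ := by
    intro γ δ
    have h1 : N (γ * δ) = Matrix.fromBlocks (N γ).toBlocks₁₁ (N γ).toBlocks₁₂
        (N γ).toBlocks₂₁ (N γ).toBlocks₂₂ * Matrix.fromBlocks (N δ).toBlocks₁₁ (N δ).toBlocks₁₂
        (N δ).toBlocks₂₁ (N δ).toBlocks₂₂ := by
      rw [Matrix.fromBlocks_toBlocks, Matrix.fromBlocks_toBlocks, map_mul]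
    rw [h1, Matrix.fromBlocks_multiply]
    rcases h with h | h
    · simp [h]
    · simp [h]
  have hone : (N 1).toBlocks₁₁ = 1 ∧ (N 1).toBlocks₂₂ = 1 := by
    have h1 : (1 : Matrix (Fin p ⊕ Fin q) (Fin p ⊕ Fin q) ℂ) = Matrix.fromBlocks 1 0 0 1 :=
      Matrix.fromBlocks_one.symm
    rw [map_one, h1]
    exact ⟨Matrix.toBlocks_fromBlocks₁₁ .., Matrix.toBlocks_fromBlocks₂₂ ..⟩
  let f : KnotGroup →* Matrix (Fin p) (Fin p) ℂ :=
    ⟨⟨fun γ => (N γ).toBlocks₁₁, hone.1⟩, fun γ δ => (hmul γ δ).1⟩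
  let g : KnotGroup →* Matrix (Fin q) (Fin q) ℂ :=
    ⟨⟨fun γ => (N γ).toBlocks₂₂, hone.2⟩, fun γ δ => (hmul γ δ).2⟩
  exact ⟨f.toHomUnits, g.toHomUnits, fun γ => rfl, fun γ => rfl⟩

/-- The character of a representation with an invariant subspace is the sum of the characters of
two smaller representations; if a complement is invariant, it affords the second one. -/
theorem exists_blocks {n p q : ℕ} (ρ : KnotGroup →* GL (Fin n) ℂ)
    {V W : Submodule ℂ (Fin n → ℂ)} (hVW : IsCompl V W) (hV : Module.finrank ℂ V = p)
    (hW : Module.finrank ℂ W = q) (h : IsInvariant ρ V ∨ IsInvariant ρ W) :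
    ∃ (ρ₁ : KnotGroup →* GL (Fin p) ℂ) (ρ₂ : KnotGroup →* GL (Fin q) ℂ),
      (∀ γ, (ρ γ).val.trace = (ρ₁ γ).val.trace + (ρ₂ γ).val.trace) ∧
      (∀ γ, (ρ γ).val.det = (ρ₁ γ).val.det * (ρ₂ γ).val.det) ∧
      (IsInvariant ρ W → ∃ f : (Fin q → ℂ) →ₗ[ℂ] (Fin n → ℂ), Function.Injective f ∧
        (∀ x, f x ∈ W) ∧ (∀ x ∈ W, ∃ y, f y = x) ∧
        ∀ γ x, f ((ρ₂ γ).val.mulVec x) = (ρ γ).val.mulVec (f x)) := by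
  -- In a basis adapted to V ⊕ W, invariance of V kills the lower left block and invariance of W the
  -- upper right one. Either vanishing makes the diagonal blocks multiplicative.
  let bV := Module.finBasisOfFinrankEq ℂ V hV
  let bW := Module.finBasisOfFinrankEq ℂ W hW
  let b : Module.Basis (Fin p ⊕ Fin q) ℂ (Fin n → ℂ) :=
    (bV.prod bW).map (Submodule.prodEquivOfIsCompl V W hVW)
  have bl : ∀ i, b (Sum.inl i) = bV i := by intro i; simp [b]
  have br : ∀ i, b (Sum.inr i) = bW i := by intro i; simp [b]
  have hl : ∀ x ∈ V, ∀ j, b.repr x (Sum.inr j) = 0 := by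
    intro x hx j
    have := (Submodule.projectionOnto_apply_eq_zero_iff hVW.symm).2 hx
    simp [b, this]
  have hr : ∀ x ∈ W, ∀ j, b.repr x (Sum.inl j) = 0 := by
    intro x hx j
    have := (Submodule.projectionOnto_apply_eq_zero_iff hVW).2 hx
    simp [b, this]
  let N : KnotGroup →* Matrix (Fin p ⊕ Fin q) (Fin p ⊕ Fin q) ℂ :=
    { toFun := fun γ => LinearMap.toMatrix b b (ρ γ).val.mulVecLin
      map_one' := by
        rw [map_one, Units.val_one, Matrix.mulVecLin_one, LinearMap.toMatrix_id]
      map_mul' := by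
        intro γ δ
        rw [map_mul, Units.val_mul, Matrix.mulVecLin_mul, LinearMap.toMatrix_comp b b b] }
  have hN : ∀ γ i j, N γ i j = b.repr ((ρ γ).val.mulVec (b j)) i := by
    intro γ i j
    simp [N, LinearMap.toMatrix_apply]
  have h21 : IsInvariant ρ V → ∀ γ, (N γ).toBlocks₂₁ = 0 := by
    intro hV γ
    ext i j
    rw [Matrix.toBlocks₂₁, Matrix.of_apply, hN, bl]
    exact hl _ (hV γ _ (bV j).2) i
  have h12 : IsInvariant ρ W → ∀ γ, (N γ).toBlocks₁₂ = 0 := by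
    intro hW γ
    ext i j
    rw [Matrix.toBlocks₁₂, Matrix.of_apply, hN, br]
    exact hr _ (hW γ _ (bW j).2) i
  obtain ⟨ρ₁, ρ₂, h₁, h₂⟩ := exists_blocks_of_triangular N (h.imp h21 h12)
  refine ⟨ρ₁, ρ₂, fun γ => ?_, fun γ => ?_, fun hWinv => ?_⟩
  · have : (ρ γ).val.trace = (N γ).trace := by
      rw [show N γ = LinearMap.toMatrix b b (ρ γ).val.mulVecLin from rfl,
        ← LinearMap.trace_eq_matrix_trace ℂ b]
      exact (Matrix.trace_toLin'_eq _).symm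
    rw [this, h₁, h₂, Matrix.trace, Fintype.sum_sum_type]
    rfl
  · have : (ρ γ).val.det = (N γ).det := by
      rw [show N γ = LinearMap.toMatrix b b (ρ γ).val.mulVecLin from rfl, LinearMap.det_toMatrix]
      exact (LinearMap.det_toLin' _).symm
    rw [this, h₁, h₂, ← Matrix.fromBlocks_toBlocks (N γ)]
    rcases h with h | h
    · rw [h21 h, Matrix.det_fromBlocks_zero₂₁]
      simp
    · rw [h12 h, Matrix.det_fromBlocks_zero₁₂]
      simp
  · refine ⟨W.subtype ∘ₗ (bW.equivFun.symm : (Fin q → ℂ) →ₗ[ℂ] W),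
      W.injective_subtype.comp bW.equivFun.symm.injective, fun x => Submodule.coe_mem _,
      fun x hx => ⟨bW.equivFun ⟨x, hx⟩, by simp⟩, fun γ => ?_⟩
    have : (W.subtype ∘ₗ (bW.equivFun.symm : (Fin q → ℂ) →ₗ[ℂ] W)) ∘ₗ (ρ₂ γ).val.mulVecLin =
        (ρ γ).val.mulVecLin ∘ₗ (W.subtype ∘ₗ (bW.equivFun.symm : (Fin q → ℂ) →ₗ[ℂ] W)) := by
      refine (Pi.basisFun ℂ (Fin q)).ext fun j => ?_
      have hsum := b.sum_repr ((ρ γ).val.mulVec (b (Sum.inr j)))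
      rw [Fintype.sum_sum_type] at hsum
      have hz : ∀ i, b.repr ((ρ γ).val.mulVec (b (Sum.inr j))) (Sum.inl i) = 0 := by
        intro i
        rw [br]
        exact hr _ (hWinv γ _ (bW j).2) i
      simp only [hz, zero_smul, Finset.sum_const_zero, zero_add] at hsum
      have hj : bW.equivFun.symm (Pi.single j 1) = bW j := by
        simp [Module.Basis.equivFun_symm_apply, Pi.single_apply]
      simp only [LinearMap.comp_apply, Pi.basisFun_apply, Matrix.mulVecLin_apply,
        Matrix.mulVec_single_one, LinearEquiv.coe_coe, hj, Submodule.subtype_apply, ← br]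
      rw [← hsum, Module.Basis.equivFun_symm_apply, AddSubmonoidClass.coe_finsetSum]
      refine Finset.sum_congr rfl fun i _ => ?_
      rw [Submodule.coe_smul, ← br, ← hN γ (Sum.inr i) (Sum.inr j), h₂]
      rfl
    exact fun x => DFunLike.congr_fun this x

/-- A one-dimensional representation is given by the exponent sum. -/
theorem exists_zpow_of_one_dim (ρ : KnotGroup →* GL (Fin 1) ℂ) :
    ∃ l : ℂˣ, ∀ γ, (ρ γ).val.trace = ((l ^ expSum γ : ℂˣ) : ℂ) ∧
      (ρ γ).val.det = ((l ^ expSum γ : ℂˣ) : ℂ) := by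
  refine ⟨Matrix.GeneralLinearGroup.det (ρ S), fun γ => ?_⟩
  have h := DFunLike.congr_fun (hom_eq_expHom (Matrix.GeneralLinearGroup.det.comp ρ)) γ
  simp only [MonoidHom.comp_apply, expHom_apply] at h
  rw [← h]
  simp [Matrix.GeneralLinearGroup.det, Matrix.trace_fin_one]

theorem exists_isCompl_finrank {n : ℕ} (V : Submodule ℂ (Fin n → ℂ)) :
    ∃ W, IsCompl V W ∧ Module.finrank ℂ V + Module.finrank ℂ W = n := by
  obtain ⟨W, hW⟩ := V.exists_isCompl
  exact ⟨W, hW, by simpa using Submodule.finrank_add_eq_of_isCompl hW⟩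

theorem finrank_pos_lt {n : ℕ} {V : Submodule ℂ (Fin n → ℂ)} (h1 : V ≠ ⊥) (h2 : V ≠ ⊤) :
    0 < Module.finrank ℂ V ∧ Module.finrank ℂ V < n := by
  refine ⟨Nat.pos_of_ne_zero fun h => h1 (Submodule.finrank_eq_zero.1 h), ?_⟩
  simpa using Submodule.finrank_lt h2

/-- The character of a reducible two-dimensional representation. -/
theorem exists_zpow_of_isReducible {ρ : KnotGroup →* GL (Fin 2) ℂ} (h : IsReducible ρ) :
    ∃ l m : ℂˣ, ∀ γ,
      (ρ γ).val.trace = ((l ^ expSum γ : ℂˣ) : ℂ) + ((m ^ expSum γ : ℂˣ) : ℂ) ∧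
      (ρ γ).val.det = ((l ^ expSum γ : ℂˣ) : ℂ) * ((m ^ expSum γ : ℂˣ) : ℂ) := by
  obtain ⟨V, h1, h2, hV⟩ := h
  obtain ⟨W, hVW, hdim⟩ := exists_isCompl_finrank V
  have := finrank_pos_lt h1 h2
  obtain ⟨ρ₁, ρ₂, htr, hdet, -⟩ := exists_blocks ρ hVW (p := 1) (q := 1) (by omega) (by omega)
    (Or.inl hV)
  obtain ⟨l, hl⟩ := exists_zpow_of_one_dim ρ₁
  obtain ⟨m, hm⟩ := exists_zpow_of_one_dim ρ₂
  exact ⟨l, m, fun γ => ⟨by rw [htr, (hl γ).1, (hm γ).1], by rw [hdet, (hl γ).2, (hm γ).2]⟩⟩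

/-- The character of a reducible three-dimensional representation. -/
theorem exists_of_isReducible {ρ : KnotGroup →* GL (Fin 3) ℂ} (h : IsReducible ρ) :
    ∃ (l : ℂˣ) (ρ₂ : KnotGroup →* GL (Fin 2) ℂ), ∀ γ,
      (ρ γ).val.trace = ((l ^ expSum γ : ℂˣ) : ℂ) + (ρ₂ γ).val.trace ∧
      (ρ γ).val.det = ((l ^ expSum γ : ℂˣ) : ℂ) * (ρ₂ γ).val.det := by
  obtain ⟨V, h1, h2, hV⟩ := h
  obtain ⟨W, hVW, hdim⟩ := exists_isCompl_finrank V
  have := finrank_pos_lt h1 h2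
  have key : ∃ (ρ₁ : KnotGroup →* GL (Fin 1) ℂ) (ρ₂ : KnotGroup →* GL (Fin 2) ℂ),
      (∀ γ, (ρ γ).val.trace = (ρ₁ γ).val.trace + (ρ₂ γ).val.trace) ∧
      (∀ γ, (ρ γ).val.det = (ρ₁ γ).val.det * (ρ₂ γ).val.det) := by
    rcases (show Module.finrank ℂ V = 1 ∨ Module.finrank ℂ V = 2 by omega) with h3 | h3
    · obtain ⟨ρ₁, ρ₂, htr, hdet, -⟩ := exists_blocks ρ hVW (p := 1) (q := 2) (by omega)
        (by omega) (Or.inl hV)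
      exact ⟨ρ₁, ρ₂, htr, hdet⟩
    -- Here V is the plane; the complement is put first so that the one-dimensional block is again
    -- the first one.
    · obtain ⟨ρ₁, ρ₂, htr, hdet, -⟩ := exists_blocks ρ hVW.symm (p := 1) (q := 2) (by omega)
        (by omega) (Or.inr hV)
      exact ⟨ρ₁, ρ₂, htr, hdet⟩
  obtain ⟨ρ₁, ρ₂, htr, hdet⟩ := key
  obtain ⟨l, hl⟩ := exists_zpow_of_one_dim ρ₁
  exact ⟨l, ρ₂, fun γ => ⟨by rw [htr, (hl γ).1], by rw [hdet, (hl γ).2]⟩⟩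

/-- The character of a partially reducible representation. -/
theorem exists_of_isPartiallyReducible {ρ : KnotGroup →* GL (Fin 3) ℂ}
    (h : IsPartiallyReducible ρ) :
    ∃ (l : ℂˣ) (ρ₂ : KnotGroup →* GL (Fin 2) ℂ), ¬ IsReducible ρ₂ ∧ ∀ γ,
      (ρ γ).val.trace = ((l ^ expSum γ : ℂˣ) : ℂ) + (ρ₂ γ).val.trace ∧
      (ρ γ).val.det = ((l ^ expSum γ : ℂˣ) : ℂ) * (ρ₂ γ).val.det := by
  obtain ⟨L, W, hLW, hL, hW, hLinv, hWinv, hirr⟩ := h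
  obtain ⟨ρ₁, ρ₂, htr, hdet, hf⟩ := exists_blocks ρ hLW hL hW (Or.inl hLinv)
  obtain ⟨f, hfinj, hfW, hfsurj, hf⟩ := hf hWinv
  obtain ⟨l, hl⟩ := exists_zpow_of_one_dim ρ₁
  refine ⟨l, ρ₂, ?_, fun γ => ⟨by rw [htr, (hl γ).1], by rw [hdet, (hl γ).2]⟩⟩
  rintro ⟨V, hV1, hV2, hV⟩
  have hle : V.map f ≤ W := by
    rintro _ ⟨x, -, rfl⟩
    exact hfW x
  have hinv : IsInvariant ρ (V.map f) := by
    rintro γ _ ⟨x, hx, rfl⟩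
    exact ⟨(ρ₂ γ).val.mulVec x, hV γ x hx, hf γ x⟩
  rcases hirr _ hle hinv with h | h
  · refine hV1 ((Submodule.eq_bot_iff _).2 fun x hx => hfinj ?_)
    have : f x ∈ V.map f := ⟨x, hx, rfl⟩
    rwa [h, Submodule.mem_bot, ← map_zero f] at this
  · refine hV2 (eq_top_iff.2 fun x _ => ?_)
    obtain ⟨y, hy, hxy⟩ : f x ∈ V.map f := h ▸ hfW x
    rwa [← hfinj hxy]

/-- The character of a totally reducible representation. -/
theorem exists_of_isTotallyReducible {ρ : KnotGroup →* GL (Fin 3) ℂ}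
    (h : IsTotallyReducible ρ) :
    ∃ l : Fin 3 → ℂˣ, ∀ γ,
      (ρ γ).val.trace = ∑ i, ((l i ^ expSum γ : ℂˣ) : ℂ) ∧
      (ρ γ).val.det = ∏ i, ((l i ^ expSum γ : ℂˣ) : ℂ) := by
  obtain ⟨e, he⟩ := h
  have h1 : ∀ i γ, ∃ c : ℂ, c • e i = (ρ γ).val.mulVec (e i) := fun i γ =>
    Submodule.mem_span_singleton.1 (he i γ _ (Submodule.mem_span_singleton_self _))
  choose c hc using h1
  have hinj : ∀ i (x y : ℂ), x • e i = y • e i → x = y := fun i x y hxy =>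
    smul_left_injective ℂ (e.ne_zero i) hxy
  let φ : Fin 3 → KnotGroup →* ℂ := fun i =>
    { toFun := c i
      map_one' := hinj i _ _ (by rw [hc, map_one, Units.val_one, Matrix.one_mulVec, one_smul])
      map_mul' := fun γ δ => hinj i _ _ (by
        rw [hc, map_mul, Units.val_mul, ← Matrix.mulVec_mulVec, ← hc, Matrix.mulVec_smul, ← hc,
          smul_smul, mul_comm]) }
  have hφ : ∀ i γ, c i γ = (((φ i).toHomUnits S ^ expSum γ : ℂˣ) : ℂ) := by
    intro i γ
    have := congrArg Units.val (DFunLike.congr_fun (hom_eq_expHom (φ i).toHomUnits) γ)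
    rw [expHom_apply] at this
    rw [← this]
    rfl
  have hmat : ∀ γ, LinearMap.toMatrix e e (ρ γ).val.mulVecLin =
      Matrix.diagonal fun i => c i γ := by
    intro γ
    ext i j
    rw [LinearMap.toMatrix_apply, Matrix.mulVecLin_apply, ← hc, map_smul, Matrix.diagonal_apply]
    by_cases hij : i = j
    · subst hij; simp
    · rw [if_neg hij]
      simp [Ne.symm hij]
  refine ⟨fun i => (φ i).toHomUnits S, fun γ => ⟨?_, ?_⟩⟩
  · simp only [← hφ]
    rw [← Matrix.trace_toLin'_eq, ← Matrix.trace_diagonal, ← hmat,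
      ← LinearMap.trace_eq_matrix_trace ℂ e]
    rfl
  · simp only [← hφ]
    rw [← LinearMap.det_toLin', ← Matrix.det_diagonal, ← hmat, LinearMap.det_toMatrix]
    rfl

/-! ### Construction of representations -/

/-- The diagonal representation in `SL(3,ℂ)` with given eigenvalues of the meridians. -/
theorem exists_diagonal (l : Fin 3 → ℂˣ) (hl : ∏ i, l i = 1) :
    ∃ ρ : KnotGroup →* Matrix.SpecialLinearGroup (Fin 3) ℂ, IsTotallyReducible (toGLRep ρ) ∧
      ∀ γ, character (toGLRep ρ) γ = ∑ i, ((l i ^ expSum γ : ℂˣ) : ℂ) := by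
  let D : ∀ _ : KnotGroup, Matrix (Fin 3) (Fin 3) ℂ := fun γ =>
    Matrix.diagonal fun i => ((l i ^ expSum γ : ℂˣ) : ℂ)
  have hD : ∀ γ, (D γ).det = 1 := by
    intro γ
    rw [Matrix.det_diagonal, ← Units.coe_prod, Finset.prod_zpow, hl, one_zpow, Units.val_one]
  let ρ : KnotGroup →* Matrix.SpecialLinearGroup (Fin 3) ℂ :=
    { toFun := fun γ => ⟨D γ, hD γ⟩
      map_one' := by
        ext i j
        simp [D]
      map_mul' := by
        intro γ δ
        refine Subtype.ext (show D (γ * δ) = D γ * D δ from ?_)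
        simp [D, zpow_add₀] }
  have hval : ∀ γ, (toGLRep ρ γ).val = D γ := fun γ => rfl
  refine ⟨ρ, ⟨Pi.basisFun ℂ (Fin 3), fun i γ x hx => ?_⟩, fun γ => ?_⟩
  · obtain ⟨c, rfl⟩ := Submodule.mem_span_singleton.1 hx
    refine Submodule.mem_span_singleton.2 ⟨c * ((l i ^ expSum γ : ℂˣ) : ℂ), ?_⟩
    rw [hval, Matrix.mulVec_smul, Pi.basisFun_apply, mul_smul]
    congr 1
    ext j
    by_cases hij : j = i
    · subst hij; simp [D]
    · simp [D, hij]
  · rw [character, hval, Matrix.trace_diagonal]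

/-- The block diagonal matrix with blocks `A` and `(det A)⁻¹`. -/
noncomputable def sumDetInv (A : Matrix (Fin 2) (Fin 2) ℂ) : Matrix (Fin 3) (Fin 3) ℂ :=
  !![A 0 0, A 0 1, 0; A 1 0, A 1 1, 0; 0, 0, A.det⁻¹]

theorem det_sumDetInv {A : Matrix (Fin 2) (Fin 2) ℂ} (h : A.det ≠ 0) : (sumDetInv A).det = 1 := by
  have h1 : (sumDetInv A).det = A.det * A.det⁻¹ := by
    rw [sumDetInv, Matrix.det_fin_three, Matrix.det_fin_two A]
    simp
    ring
  rw [h1, mul_inv_cancel₀ h]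

theorem sumDetInv_one : sumDetInv 1 = 1 := by
  ext i j
  fin_cases i <;> fin_cases j <;> simp [sumDetInv]

theorem sumDetInv_mul (A B : Matrix (Fin 2) (Fin 2) ℂ) :
    sumDetInv (A * B) = sumDetInv A * sumDetInv B := by
  have h : (A * B).det⁻¹ = A.det⁻¹ * B.det⁻¹ := by rw [Matrix.det_mul, mul_inv]
  rw [sumDetInv, sumDetInv, sumDetInv, h]
  generalize A.det⁻¹ = x
  generalize B.det⁻¹ = y
  ext i j
  fin_cases i <;> fin_cases j <;> simp [Matrix.mul_apply, Fin.sum_univ_three]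

theorem sumDetInv_mulVec (A : Matrix (Fin 2) (Fin 2) ℂ) (x : Fin 3 → ℂ) :
    (sumDetInv A).mulVec x =
      ![A 0 0 * x 0 + A 0 1 * x 1, A 1 0 * x 0 + A 1 1 * x 1, A.det⁻¹ * x 2] := by
  rw [sumDetInv]
  generalize A.det⁻¹ = c
  ext i
  fin_cases i <;> simp [Matrix.mulVec, dotProduct, Fin.sum_univ_three]

theorem trace_sumDetInv (A : Matrix (Fin 2) (Fin 2) ℂ) :
    (sumDetInv A).trace = A.trace + A.det⁻¹ := by
  rw [sumDetInv, Matrix.trace_fin_three, Matrix.trace_fin_two]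
  simp

/-- The inclusion of the plane spanned by the first two basis vectors. -/
def planeInclusion : (Fin 2 → ℂ) →ₗ[ℂ] (Fin 3 → ℂ) where
  toFun x := ![x 0, x 1, 0]
  map_add' x y := by ext i; fin_cases i <;> simp
  map_smul' c x := by ext i; fin_cases i <;> simp

theorem planeInclusion_apply (x : Fin 2 → ℂ) : planeInclusion x = ![x 0, x 1, 0] := rfl

theorem planeInclusion_of_third_eq_zero {x : Fin 3 → ℂ} (h : x 2 = 0) :
    planeInclusion ![x 0, x 1] = x := by
  rw [planeInclusion_apply]
  ext i
  fin_cases i <;> simp [h]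

theorem planeInclusion_mulVec (A : Matrix (Fin 2) (Fin 2) ℂ) (x : Fin 2 → ℂ) :
    planeInclusion (A.mulVec x) = (sumDetInv A).mulVec (planeInclusion x) := by
  rw [sumDetInv_mulVec, planeInclusion_apply, planeInclusion_apply]
  ext i
  fin_cases i <;> simp [Matrix.mulVec, dotProduct, Fin.sum_univ_two]

theorem exists_isCompl_line_plane :
    ∃ L W : Submodule ℂ (Fin 3 → ℂ), IsCompl L W ∧ Module.finrank ℂ L = 1 ∧
      Module.finrank ℂ W = 2 ∧ (∀ x, x ∈ L ↔ x 0 = 0 ∧ x 1 = 0) ∧ ∀ x, x ∈ W ↔ x 2 = 0 := by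
  have hL : ∀ x : Fin 3 → ℂ, x ∈ Submodule.span ℂ {(Pi.single 2 1 : Fin 3 → ℂ)} ↔
      x 0 = 0 ∧ x 1 = 0 := by
    intro x
    rw [Submodule.mem_span_singleton]
    constructor
    · rintro ⟨c, rfl⟩; simp
    · rintro ⟨h1, h2⟩
      refine ⟨x 2, ?_⟩
      ext i
      fin_cases i <;> simp [h1, h2]
  have hW : ∀ x : Fin 3 → ℂ, x ∈ LinearMap.range planeInclusion ↔ x 2 = 0 := by
    intro x
    constructor
    · rintro ⟨y, rfl⟩; simp [planeInclusion_apply]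
    · exact fun h => ⟨_, planeInclusion_of_third_eq_zero h⟩
  have hLrank : Module.finrank ℂ (Submodule.span ℂ {(Pi.single 2 1 : Fin 3 → ℂ)}) = 1 :=
    finrank_span_singleton (by simp)
  have hLW : IsCompl (Submodule.span ℂ {(Pi.single 2 1 : Fin 3 → ℂ)})
      (LinearMap.range planeInclusion) := by
    refine ⟨Submodule.disjoint_def.2 fun x hx hx' => ?_, codisjoint_iff.2 ?_⟩
    · have h1 := (hL x).1 hx
      have h2 := (hW x).1 hx'
      ext i
      fin_cases i
      · exact h1.1
      · exact h1.2
      · exact h2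
    · refine eq_top_iff.2 fun x _ => Submodule.mem_sup.2
        ⟨![0, 0, x 2], (hL _).2 (by simp), ![x 0, x 1, 0], (hW _).2 (by simp), ?_⟩
      ext i
      fin_cases i <;> simp
  refine ⟨_, _, hLW, hLrank, ?_, hL, hW⟩
  have := Submodule.finrank_add_eq_of_isCompl hLW
  rw [hLrank, Module.finrank_fin_fun] at this
  omega

/-- The sum of a two-dimensional representation and of the inverse of its determinant. -/
noncomputable def sumDetInvRep (ρ₂ : KnotGroup →* GL (Fin 2) ℂ) :
    KnotGroup →* Matrix.SpecialLinearGroup (Fin 3) ℂ where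
  toFun γ := ⟨sumDetInv (ρ₂ γ).val,
    det_sumDetInv (Matrix.GeneralLinearGroup.det (ρ₂ γ)).ne_zero⟩
  map_one' := Subtype.ext (by
    change sumDetInv (ρ₂ 1).val = 1
    rw [map_one, Units.val_one, sumDetInv_one])
  map_mul' γ δ := Subtype.ext (by
    change sumDetInv (ρ₂ (γ * δ)).val = sumDetInv (ρ₂ γ).val * sumDetInv (ρ₂ δ).val
    rw [map_mul, Units.val_mul, sumDetInv_mul])

theorem toGLRep_sumDetInvRep (ρ₂ : KnotGroup →* GL (Fin 2) ℂ) (γ : KnotGroup) :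
    (toGLRep (sumDetInvRep ρ₂) γ).val = sumDetInv (ρ₂ γ).val := rfl

theorem character_sumDetInvRep (ρ₂ : KnotGroup →* GL (Fin 2) ℂ) (γ : KnotGroup) :
    character (toGLRep (sumDetInvRep ρ₂)) γ = (ρ₂ γ).val.trace + ((ρ₂ γ).val.det)⁻¹ := by
  rw [character, toGLRep_sumDetInvRep, trace_sumDetInv]

theorem sumDetInvRep_decomposition (ρ₂ : KnotGroup →* GL (Fin 2) ℂ) :
    ∃ L W : Submodule ℂ (Fin 3 → ℂ), IsCompl L W ∧ Module.finrank ℂ L = 1 ∧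
      Module.finrank ℂ W = 2 ∧ IsInvariant (toGLRep (sumDetInvRep ρ₂)) L ∧
      IsInvariant (toGLRep (sumDetInvRep ρ₂)) W ∧ ∀ x, x ∈ W ↔ x 2 = 0 := by
  obtain ⟨L, W, hLW, hL1, hW2, hL, hW⟩ := exists_isCompl_line_plane
  refine ⟨L, W, hLW, hL1, hW2, fun γ x hx => ?_, fun γ x hx => ?_, hW⟩
  · rw [toGLRep_sumDetInvRep, sumDetInv_mulVec, hL]
    simp [((hL x).1 hx).1, ((hL x).1 hx).2]
  · rw [toGLRep_sumDetInvRep, sumDetInv_mulVec, hW]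
    simp [(hW x).1 hx]

theorem isReducible_sumDetInvRep (ρ₂ : KnotGroup →* GL (Fin 2) ℂ) :
    IsReducible (toGLRep (sumDetInvRep ρ₂)) := by
  obtain ⟨L, W, -, hL1, -, hL, -, -⟩ := sumDetInvRep_decomposition ρ₂
  refine ⟨L, ?_, ?_, hL⟩
  · rintro rfl
    rw [finrank_bot] at hL1
    omega
  · rintro rfl
    rw [finrank_top, Module.finrank_fin_fun] at hL1
    omega

/-- An invariant subspace of the plane pulls back along the equivariant inclusion to an invariant
subspace of ρ₂. -/
theorem isPartiallyReducible_sumDetInvRep {ρ₂ : KnotGroup →* GL (Fin 2) ℂ}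
    (h : ¬ IsReducible ρ₂) : IsPartiallyReducible (toGLRep (sumDetInvRep ρ₂)) := by
  obtain ⟨L, W, hLW, hL1, hW2, hL, hWinv, hW⟩ := sumDetInvRep_decomposition ρ₂
  refine ⟨L, W, hLW, hL1, hW2, hL, hWinv, fun U hU hUinv => ?_⟩
  by_contra! hcon
  refine h ⟨U.comap planeInclusion, fun h => hcon.1 ?_, fun h => hcon.2 ?_, fun γ x hx => ?_⟩
  · refine (Submodule.eq_bot_iff _).2 fun x hx => ?_
    have hx' := planeInclusion_of_third_eq_zero ((hW x).1 (hU hx))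
    have : ![x 0, x 1] ∈ U.comap planeInclusion := by
      rw [Submodule.mem_comap, hx']
      exact hx
    rw [h, Submodule.mem_bot] at this
    rw [← hx', this, map_zero]
  · refine le_antisymm hU fun x hx => ?_
    have hx' := planeInclusion_of_third_eq_zero ((hW x).1 hx)
    have : ![x 0, x 1] ∈ U.comap planeInclusion := h ▸ Submodule.mem_top
    rwa [Submodule.mem_comap, hx'] at this
  · rw [Submodule.mem_comap] at hx ⊢
    rw [planeInclusion_mulVec]
    exact hUinv γ _ hx

/-! ### Traces of two-dimensional representations -/

section TwoByTwo

variable (A B M : Matrix (Fin 2) (Fin 2) ℂ)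

/-- Cayley–Hamilton for A, multiplied by M. -/
theorem trace_mul_sq : (M * A * A).trace = A.trace * (M * A).trace - A.det * M.trace := by
  simp only [Matrix.trace_fin_two, Matrix.det_fin_two, Matrix.mul_apply, Fin.sum_univ_two]
  ring

/-- The polarized Cayley–Hamilton identity AB + BA = tr(B)A + tr(A)B + (tr(AB) − tr(A)tr(B))·1,
multiplied by M. -/
theorem trace_mul_swap : (M * B * A).trace = -(M * A * B).trace + B.trace * (M * A).trace +
    A.trace * (M * B).trace + ((A * B).trace - A.trace * B.trace) * M.trace := by
  simp only [Matrix.trace_fin_two, Matrix.mul_apply, Fin.sum_univ_two]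
  ring

/-- For invertible B, Cayley–Hamilton for AB gives ABA = tr(AB)A − det(A)·adj(B), where adj(B) =
tr(B) − B. -/
theorem trace_mul_sandwich : (M * A * B * A).trace =
    (A * B).trace * (M * A).trace - A.det * (B.trace * M.trace - (M * B).trace) := by
  simp only [Matrix.trace_fin_two, Matrix.det_fin_two, Matrix.mul_apply, Fin.sum_univ_two]
  ring

theorem trace_mul_sq_mul :
    (M * A * A * B).trace = A.trace * (M * A * B).trace - A.det * (M * B).trace := by
  simp only [Matrix.trace_fin_two, Matrix.det_fin_two, Matrix.mul_apply, Fin.sum_univ_two]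
  ring

theorem trace_mul_inv (s : GL (Fin 2) ℂ) :
    (M * (s⁻¹).val).trace = (s.val.det)⁻¹ * (s.val.trace * M.trace - (M * s.val).trace) := by
  have h0 : s.val.det ≠ 0 := (Matrix.GeneralLinearGroup.det s).ne_zero
  have h1 := trace_mul_sq s.val (M * (s⁻¹).val)
  have h2 : M * (s⁻¹).val * s.val = M := by rw [Matrix.mul_assoc, Units.inv_mul, Matrix.mul_one]
  rw [h2] at h1
  rw [eq_inv_mul_iff_mul_eq₀ h0]
  linear_combination h1

theorem trace_mul_inv_mul (s : GL (Fin 2) ℂ) : (M * (s⁻¹).val * B).trace =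
    (s.val.det)⁻¹ * (s.val.trace * (M * B).trace - (M * s.val * B).trace) := by
  rw [Matrix.trace_mul_comm, ← Matrix.mul_assoc, trace_mul_inv, Matrix.trace_mul_comm M B,
    Matrix.trace_mul_comm (M * s.val) B, Matrix.mul_assoc]

end TwoByTwo

/-- The parameters `tr ρ(S)`, `det ρ(S)`, `(det ρ(S))⁻¹`, `tr ρ(ST)` of a representation. -/
noncomputable def traceParams (ρ : KnotGroup →* GL (Fin 2) ℂ) : Fin 4 → ℂ :=
  ![(ρ S).val.trace, (ρ S).val.det, ((ρ S).val.det)⁻¹, (ρ (S * T)).val.trace]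

/-- The four words γ, γS, γT, γST are treated together because 1, S, T, ST are stable, up to linear
combination, under multiplication by the generators and their inverses. The polynomials are chosen
before ρ, so they are uniform in the representation. -/
theorem exists_trace_polynomials (γ : KnotGroup) :
    ∃ Q₀ Q₁ Q₂ Q₃ : MvPolynomial (Fin 4) ℂ, ∀ ρ : KnotGroup →* GL (Fin 2) ℂ,
      (ρ γ).val.trace = eval (traceParams ρ) Q₀ ∧
      (ρ (γ * S)).val.trace = eval (traceParams ρ) Q₁ ∧
      (ρ (γ * T)).val.trace = eval (traceParams ρ) Q₂ ∧
      (ρ (γ * S * T)).val.trace = eval (traceParams ρ) Q₃ := by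
  have e0 : ∀ ρ : KnotGroup →* GL (Fin 2) ℂ, (ρ S).val.trace = traceParams ρ 0 := fun _ => rfl
  have e1 : ∀ ρ : KnotGroup →* GL (Fin 2) ℂ, (ρ S).val.det = traceParams ρ 1 := fun _ => rfl
  have e2 : ∀ ρ : KnotGroup →* GL (Fin 2) ℂ, ((ρ S).val.det)⁻¹ = traceParams ρ 2 := fun _ => rfl
  have e3 : ∀ ρ : KnotGroup →* GL (Fin 2) ℂ, ((ρ S).val * (ρ T).val).trace = traceParams ρ 3 :=
    fun ρ => by rw [← Units.val_mul, ← map_mul]; rfl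
  have e3' : ∀ ρ : KnotGroup →* GL (Fin 2) ℂ, ((ρ T).val * (ρ S).val).trace = traceParams ρ 3 :=
    fun ρ => by rw [Matrix.trace_mul_comm, e3]
  induction γ using knotGroup_induction with
  | one =>
    refine ⟨C 2, X 0, X 0, X 3, fun ρ => ⟨?_, ?_, ?_, ?_⟩⟩
    · simp
    · simp [e0]
    · simp [trace_map_T, e0]
    · simp [e3]
  | mul_S γ h =>
    obtain ⟨Q₀, Q₁, Q₂, Q₃, h⟩ := h
    refine ⟨Q₁, X 0 * Q₁ - X 1 * Q₀, Q₃, X 0 * Q₃ - X 1 * Q₂, fun ρ => ?_⟩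
    obtain ⟨h0, h1, h2, h3⟩ := h ρ
    refine ⟨h1, ?_, h3, ?_⟩
    · simp only [map_mul, Units.val_mul] at h1 ⊢
      rw [trace_mul_sq, h0, h1, e0, e1]
      simp
    · simp only [map_mul, Units.val_mul] at h2 h3 ⊢
      rw [trace_mul_sq_mul, h2, h3, e0, e1]
      simp
  | mul_T γ h =>
    obtain ⟨Q₀, Q₁, Q₂, Q₃, h⟩ := h
    refine ⟨Q₂, -Q₃ + X 0 * Q₁ + X 0 * Q₂ + (X 3 - X 0 * X 0) * Q₀, X 0 * Q₂ - X 1 * Q₀,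
      X 3 * Q₂ - X 1 * (X 0 * Q₀ - Q₁), fun ρ => ?_⟩
    obtain ⟨h0, h1, h2, h3⟩ := h ρ
    refine ⟨h2, ?_, ?_, ?_⟩ <;> simp only [map_mul, Units.val_mul] at h1 h2 h3 ⊢
    · rw [trace_mul_swap, h0, h1, h2, h3, trace_map_T, e3, e0]
      simp
    · rw [trace_mul_sq, h0, h2, trace_map_T, det_map_T, e0, e1]
      simp
    · rw [trace_mul_sandwich, h0, h1, h2, det_map_T, e0, e1, e3']
      simp
  | mul_S_inv γ h =>
    obtain ⟨Q₀, Q₁, Q₂, Q₃, h⟩ := h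
    refine ⟨X 2 * (X 0 * Q₀ - Q₁), Q₀, X 2 * (X 0 * Q₂ - Q₃), Q₂, fun ρ => ?_⟩
    obtain ⟨h0, h1, h2, h3⟩ := h ρ
    refine ⟨?_, ?_, ?_, ?_⟩
    · simp only [map_mul, Units.val_mul] at h1 ⊢
      rw [map_inv, trace_mul_inv, h0, h1, e0, e2]
      simp
    · rw [inv_mul_cancel_right, h0]
    · simp only [map_mul, Units.val_mul] at h2 h3 ⊢
      rw [map_inv, trace_mul_inv_mul, h2, h3, e0, e2]
      simp
    · rw [inv_mul_cancel_right, h2]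
  | mul_T_inv γ h =>
    obtain ⟨Q₀, Q₁, Q₂, Q₃, h⟩ := h
    refine ⟨X 2 * (X 0 * Q₀ - Q₂),
      X 2 * (X 0 * Q₁ - (-Q₃ + X 0 * Q₁ + X 0 * Q₂ + (X 3 - X 0 * X 0) * Q₀)), Q₀,
      X 2 * (X 0 * Q₃ - (X 3 * Q₂ - X 1 * (X 0 * Q₀ - Q₁))), fun ρ => ?_⟩
    obtain ⟨h0, h1, h2, h3⟩ := h ρ
    refine ⟨?_, ?_, ?_, ?_⟩
    · simp only [map_mul, Units.val_mul] at h2 ⊢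
      rw [map_inv, trace_mul_inv, h0, h2, trace_map_T, det_map_T, e0, e2]
      simp
    · simp only [map_mul, Units.val_mul] at h1 h2 h3 ⊢
      rw [map_inv, trace_mul_inv_mul, trace_mul_swap, h0, h1, h2, h3, trace_map_T, det_map_T, e3,
        e0, e2]
      simp
    · rw [inv_mul_cancel_right, h0]
    · simp only [map_mul, Units.val_mul] at h1 h2 h3 ⊢
      rw [map_inv, Matrix.mul_assoc _ (ρ S).val, trace_mul_inv_mul, ← Matrix.mul_assoc,
        ← Matrix.mul_assoc, trace_mul_sandwich, h0, h1, h2, h3, trace_map_T, det_map_T, e3', e0,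
        e2, e1]
      simp

/-- The trace of `γ` as a polynomial in the parameters of a two-dimensional representation. -/
noncomputable def tracePoly (γ : KnotGroup) : MvPolynomial (Fin 4) ℂ :=
  (exists_trace_polynomials γ).choose

theorem eval_tracePoly (ρ : KnotGroup →* GL (Fin 2) ℂ) (γ : KnotGroup) :
    (ρ γ).val.trace = eval (traceParams ρ) (tracePoly γ) := by
  obtain ⟨Q₁, Q₂, Q₃, h⟩ := (exists_trace_polynomials γ).choose_spec
  exact (h ρ).1

/-! ### The knot relation as a trace equation -/

theorem val_inv_eq (s : GL (Fin 2) ℂ) : (s⁻¹).val = (s.val.det)⁻¹ • s.val.adjugate := by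
  rw [Matrix.coe_units_inv, Matrix.inv_def, Ring.inverse_eq_inv']

/-- The heart of the two-dimensional case. With adjugates in place of inverses the knot relation
becomes polynomial, and its defect is a scalar multiple of A − B. The scalar depends only on tr(A),
det(A) and tr(AB), so the four matrix entries of the relation amount to one trace equation when A ≠
B. -/
theorem mul_adjugate_identity {A B : Matrix (Fin 2) (Fin 2) ℂ} (htr : B.trace = A.trace)
    (hdet : B.det = A.det) :
    A * B.adjugate * A.adjugate * B * A - B * A * B.adjugate * A.adjugate * B =
      (2 * A.trace ^ 2 * A.det + (A * B).trace ^ 2 - A.trace ^ 2 * (A * B).trace -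
        (A * B).trace * A.det - A.det ^ 2) • (A - B) := by
  obtain ⟨a, b, c, d, rfl⟩ : ∃ a b c d, A = !![a, b; c, d] :=
    ⟨_, _, _, _, Matrix.eta_fin_two A⟩
  obtain ⟨e, f, g, h, rfl⟩ : ∃ a b c d, B = !![a, b; c, d] :=
    ⟨_, _, _, _, Matrix.eta_fin_two B⟩
  simp only [Matrix.trace_fin_two_of, Matrix.det_fin_two_of] at htr hdet
  obtain rfl : h = a + d - e := by linear_combination htr
  generalize hφ : (2 * (!![a, b; c, d] : Matrix (Fin 2) (Fin 2) ℂ).trace ^ 2 * _ + _ - _ - _ - _)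
    = φ
  simp only [Matrix.trace_fin_two_of, Matrix.det_fin_two_of, Matrix.mul_fin_two] at hφ
  ext i j
  fin_cases i <;> fin_cases j <;> simp [Matrix.adjugate_fin_two_of] <;> grind

/-- The defining relation of the group in terms of traces. -/
theorem relation_iff {s t : GL (Fin 2) ℂ} (htr : t.val.trace = s.val.trace)
    (hdet : t.val.det = s.val.det) :
    s * t⁻¹ * s⁻¹ * t * s = t * s * t⁻¹ * s⁻¹ * t ↔
      2 * s.val.trace ^ 2 * s.val.det + (s.val * t.val).trace ^ 2 -
        s.val.trace ^ 2 * (s.val * t.val).trace - (s.val * t.val).trace * s.val.det -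
        s.val.det ^ 2 = 0 ∨ s = t := by
  have h0 : s.val.det ≠ 0 := (Matrix.GeneralLinearGroup.det s).ne_zero
  have h := mul_adjugate_identity htr hdet
  rw [Units.ext_iff]
  simp only [Units.val_mul, val_inv_eq, hdet, Matrix.smul_mul, Matrix.mul_smul, smul_smul]
  -- Each side of the relation contains two inverses, so passing to adjugates costs the factor det⁻²
  -- on both sides.
  have h1 : s.val.det⁻¹ * s.val.det⁻¹ ≠ 0 := mul_ne_zero (inv_ne_zero h0) (inv_ne_zero h0)
  rw [← sub_eq_zero, ← smul_sub, h, smul_eq_zero_iff_right h1, smul_eq_zero,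
    sub_eq_zero (a := s.val), ← Units.ext_iff]

/-- The image is generated by one matrix, so an eigenvector of that matrix spans an invariant line.
-/
theorem isReducible_of_eq {ρ : KnotGroup →* GL (Fin 2) ℂ} (h : ρ S = ρ T) : IsReducible ρ := by
  obtain ⟨l, hl⟩ := Module.End.exists_eigenvalue (ρ S).val.mulVecLin
  obtain ⟨x, hx⟩ := hl.exists_hasEigenvector
  have hx1 : (ρ S).val.mulVec x = l • x := hx.apply_eq_smul
  have hx0 : x ≠ 0 := hx.2
  have hl0 : l ≠ 0 := by
    rintro rfl
    rw [zero_smul] at hx1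
    apply hx0
    have := congrArg (Matrix.mulVec (ρ S)⁻¹.val) hx1
    rwa [Matrix.mulVec_mulVec, Units.inv_mul, Matrix.one_mulVec, Matrix.mulVec_zero] at this
  have hx2 : ((ρ S)⁻¹).val.mulVec x = l⁻¹ • x := by
    have := congrArg (Matrix.mulVec (ρ S)⁻¹.val) hx1
    rw [Matrix.mulVec_mulVec, Units.inv_mul, Matrix.one_mulVec, Matrix.mulVec_smul] at this
    rw [eq_inv_smul_iff₀ hl0, ← this]
  have key : ∀ γ, ∃ c : ℂ, (ρ γ).val.mulVec x = c • x := by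
    intro γ
    have step : ∀ (γ δ : KnotGroup) (m : ℂ), (ρ δ).val.mulVec x = m • x →
        (∃ c : ℂ, (ρ γ).val.mulVec x = c • x) → ∃ c : ℂ, (ρ (γ * δ)).val.mulVec x = c • x := by
      rintro γ δ m hm ⟨c, hc⟩
      refine ⟨m * c, ?_⟩
      rw [map_mul, Units.val_mul, ← Matrix.mulVec_mulVec, hm, Matrix.mulVec_smul, hc, smul_smul]
    induction γ using knotGroup_induction with
    | one => exact ⟨1, by simp⟩
    | mul_S γ hγ => exact step γ S l hx1 hγ
    | mul_T γ hγ => exact step γ T l (h ▸ hx1) hγ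
    | mul_S_inv γ hγ => exact step γ S⁻¹ l⁻¹ (by rw [map_inv]; exact hx2) hγ
    | mul_T_inv γ hγ => exact step γ T⁻¹ l⁻¹ (by rw [map_inv, ← h]; exact hx2) hγ
  refine ⟨Submodule.span ℂ {x}, by simpa using hx0, fun htop => ?_, fun γ y hy => ?_⟩
  · have := finrank_span_singleton (K := ℂ) hx0
    rw [htop, finrank_top, Module.finrank_fin_fun] at this
    omega
  · obtain ⟨c, rfl⟩ := Submodule.mem_span_singleton.1 hy
    obtain ⟨d, hd⟩ := key γ
    rw [Matrix.mulVec_smul, hd]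
    exact Submodule.mem_span_singleton.2 ⟨c * d, (smul_smul _ _ _).symm⟩

/-- Fricke's formula for the trace of a commutator, cleared of denominators by det². The words are
those of a, [T, S] and [S, T]. -/
theorem trace_commutator {A B : Matrix (Fin 2) (Fin 2) ℂ} (htr : B.trace = A.trace)
    (hdet : B.det = A.det) :
    (B.adjugate * A * B * A.adjugate).trace =
        2 * A.trace ^ 2 * A.det + (A * B).trace ^ 2 - A.trace ^ 2 * (A * B).trace -
          2 * A.det ^ 2 ∧
      (B * A * B.adjugate * A.adjugate).trace =
        2 * A.trace ^ 2 * A.det + (A * B).trace ^ 2 - A.trace ^ 2 * (A * B).trace -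
          2 * A.det ^ 2 ∧
      (A * B * A.adjugate * B.adjugate).trace =
        2 * A.trace ^ 2 * A.det + (A * B).trace ^ 2 - A.trace ^ 2 * (A * B).trace -
          2 * A.det ^ 2 := by
  obtain ⟨a, b, c, d, rfl⟩ : ∃ a b c d, A = !![a, b; c, d] :=
    ⟨_, _, _, _, Matrix.eta_fin_two A⟩
  obtain ⟨e, f, g, h, rfl⟩ : ∃ a b c d, B = !![a, b; c, d] :=
    ⟨_, _, _, _, Matrix.eta_fin_two B⟩
  simp only [Matrix.trace_fin_two_of, Matrix.det_fin_two_of] at htr hdet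
  obtain rfl : h = a + d - e := by linear_combination htr
  simp only [Matrix.adjugate_fin_two_of, Matrix.mul_fin_two, Matrix.trace_fin_two_of,
    Matrix.det_fin_two_of]
  refine ⟨?_, ?_, ?_⟩ <;> grind

/-- The representation `ρ` has the parameters `p = (v, w, x₁)`. -/
def HasParams (ρ : KnotGroup →* GL (Fin 2) ℂ) (p : Fin 3 → ℂ) : Prop :=
  (ρ S).val.trace = p 0 ∧ (ρ S).val.det = p 1 ∧ (ρ (S * T)).val.trace = p 1 * (p 2 + 1)

theorem mem_surfaceP_iff {p : Fin 3 → ℂ} :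
    p ∈ surfaceP ↔ p 1 ≠ 0 ∧ p 2 ≠ 1 ∧
      (p 2 ^ 2 + p 2 - 1) * p 1 = p 0 ^ 2 * (p 2 - 1) := by
  have : p 2 ≠ 1 → ((p 2 ^ 2 + p 2 - 1) / (p 2 - 1) * p 1 = p 0 ^ 2 ↔
      (p 2 ^ 2 + p 2 - 1) * p 1 = p 0 ^ 2 * (p 2 - 1)) := by
    intro h
    rw [div_mul_eq_mul_div, div_eq_iff (sub_ne_zero.2 h)]
  exact ⟨fun h => ⟨h.1, h.2.1, (this h.2.1).1 h.2.2⟩, fun h => ⟨h.1, h.2.1, (this h.2.1).2 h.2.2⟩⟩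

theorem exists_hasParams_of_irreducible {ρ : KnotGroup →* GL (Fin 2) ℂ} (h : ¬ IsReducible ρ) :
    ∃ p ∈ surfaceP, HasParams ρ p := by
  have h0 : (ρ S).val.det ≠ 0 := (Matrix.GeneralLinearGroup.det (ρ S)).ne_zero
  have hrel := congrArg ρ knot_relation
  simp only [map_mul, map_inv] at hrel
  rw [relation_iff (trace_map_T ρ) (det_map_T ρ)] at hrel
  have hφ := hrel.resolve_right fun h1 => h (isReducible_of_eq h1)
  rw [← Units.val_mul, ← map_mul] at hφ
  set v := (ρ S).val.trace with hv
  set w := (ρ S).val.det with hw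
  obtain ⟨x, hx⟩ : ∃ x, (ρ (S * T)).val.trace = w * (x + 1) :=
    ⟨(ρ (S * T)).val.trace / w - 1, by field_simp; ring⟩
  rw [hx] at hφ
  have hP : (x ^ 2 + x - 1) * w = v ^ 2 * (x - 1) := by
    -- After the substitution tr(ST) = w(x + 1), the trace equation is w times the equation of the
    -- surface.
    refine mul_left_cancel₀ h0 ?_
    linear_combination hφ
  refine ⟨![v, w, x], mem_surfaceP_iff.2 ⟨h0, ?_, hP⟩, rfl, rfl, hx⟩
  -- At x = 1 the surface equation would read w = 0.
  intro h1
  simp only [Matrix.cons_val] at h1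
  rw [h1] at hP
  apply h0
  linear_combination hP

/-- An upper and a lower triangular matrix with the same diagonal realize any v, w and tr(ST). The
representation may be reducible, so every point of the surface is covered. -/
theorem exists_hasParams {p : Fin 3 → ℂ} (hp : p ∈ surfaceP) :
    ∃ ρ : KnotGroup →* GL (Fin 2) ℂ, HasParams ρ p := by
  obtain ⟨h0, h1, hP⟩ := mem_surfaceP_iff.1 hp
  obtain ⟨m, n, hv, hw⟩ : ∃ m n : ℂ, m + n = p 0 ∧ m * n = p 1 := by
    obtain ⟨d, hd⟩ := IsAlgClosed.exists_pow_nat_eq (p 0 ^ 2 - 4 * p 1) (n := 2) (by norm_num)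
    refine ⟨(p 0 + d) / 2, (p 0 - d) / 2, by ring, ?_⟩
    linear_combination (-1 / 4) * hd
  -- The product of the two matrices has trace m² + n² + t = v² − 2w + t, which must equal w(x₁ +
  -- 1).
  let t : ℂ := p 1 * (p 2 + 1) - p 0 ^ 2 + 2 * p 1
  have hA : (!![m, 1; 0, n] : Matrix (Fin 2) (Fin 2) ℂ).det ≠ 0 := by simpa [hw] using h0
  have hB : (!![m, 0; t, n] : Matrix (Fin 2) (Fin 2) ℂ).det ≠ 0 := by simpa [hw] using h0
  let s₀ := Matrix.GeneralLinearGroup.mkOfDetNeZero _ hA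
  let t₀ := Matrix.GeneralLinearGroup.mkOfDetNeZero _ hB
  have hs₀ : s₀.val = !![m, 1; 0, n] := rfl
  have ht₀ : t₀.val = !![m, 0; t, n] := rfl
  have htr : (s₀.val * t₀.val).trace = p 1 * (p 2 + 1) := by
    rw [hs₀, ht₀, Matrix.mul_fin_two, Matrix.trace_fin_two_of]
    simp only [t, ← hv, ← hw]
    ring
  have hs1 : s₀.val.trace = p 0 := by rw [hs₀, Matrix.trace_fin_two_of, hv]
  have hs2 : s₀.val.det = p 1 := by rw [hs₀, Matrix.det_fin_two_of, ← hw]; ring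
  have hrel : s₀ * t₀⁻¹ * s₀⁻¹ * t₀ * s₀ = t₀ * s₀ * t₀⁻¹ * s₀⁻¹ * t₀ := by
    refine (relation_iff ?_ ?_).2 (Or.inl ?_)
    · rw [hs₀, ht₀, Matrix.trace_fin_two_of, Matrix.trace_fin_two_of]
    · rw [hs₀, ht₀, Matrix.det_fin_two_of, Matrix.det_fin_two_of]
      ring
    · rw [htr, hs1, hs2]
      linear_combination p 1 * hP
  refine ⟨knotLift s₀ t₀ hrel, ?_, ?_, ?_⟩
  · rw [knotLift_S, hs1]
  · rw [knotLift_S, hs2]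
  · rw [map_mul, knotLift_S, knotLift_T, Units.val_mul, htr]

/-- The character of the two-dimensional representations with parameters `p`. -/
noncomputable def chi (p : Fin 3 → ℂ) : KnotGroup → ℂ :=
  fun γ => eval ![p 0, p 1, (p 1)⁻¹, p 1 * (p 2 + 1)] (tracePoly γ)

theorem HasParams.trace_eq {ρ : KnotGroup →* GL (Fin 2) ℂ} {p : Fin 3 → ℂ} (h : HasParams ρ p)
    (γ : KnotGroup) : (ρ γ).val.trace = chi p γ := by
  rw [eval_tracePoly, chi, traceParams, h.1, h.2.1, h.2.2]

theorem HasParams.character_eq {ρ : KnotGroup →* GL (Fin 2) ℂ} {p : Fin 3 → ℂ}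
    (h : HasParams ρ p) : character ρ = chi p :=
  funext h.trace_eq

theorem det_eq_zpow (ρ : KnotGroup →* GL (Fin 2) ℂ) (γ : KnotGroup) :
    (ρ γ).val.det = (ρ S).val.det ^ expSum γ := by
  have h := congrArg Units.val
    (DFunLike.congr_fun (hom_eq_expHom (Matrix.GeneralLinearGroup.det.comp ρ)) γ)
  simpa using h

/-! ### Values of the characters on the words behind the coordinates -/

section Values

variable {p : Fin 3 → ℂ}

theorem chi_S (hp : p ∈ surfaceP) : chi p S = p 0 := by
  obtain ⟨ρ, hρ⟩ := exists_hasParams hp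
  rw [← hρ.trace_eq, hρ.1]

theorem chi_S_mul_T (hp : p ∈ surfaceP) : chi p (S * T) = p 1 * (p 2 + 1) := by
  obtain ⟨ρ, hρ⟩ := exists_hasParams hp
  rw [← hρ.trace_eq, hρ.2.2]

theorem chi_S_inv (hp : p ∈ surfaceP) : chi p S⁻¹ = p 0 / p 1 := by
  obtain ⟨ρ, hρ⟩ := exists_hasParams hp
  have := trace_mul_inv 1 (ρ S)
  rw [Matrix.one_mul, Matrix.one_mul, Matrix.trace_one] at this
  rw [← hρ.trace_eq, map_inv, this, hρ.1, hρ.2.1, Fintype.card_fin, div_eq_inv_mul]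
  push_cast
  ring

theorem trace_adjugate_mul_adjugate (A B : Matrix (Fin 2) (Fin 2) ℂ) :
    (A.adjugate * B.adjugate).trace = (A * B).trace := by
  simp only [Matrix.adjugate_fin_two, Matrix.trace_fin_two, Matrix.mul_apply, Fin.sum_univ_two,
    Matrix.of_apply, Matrix.cons_val]
  ring

theorem chi_S_inv_mul_T_inv (hp : p ∈ surfaceP) : chi p (S⁻¹ * T⁻¹) = (p 2 + 1) / p 1 := by
  have h0 := (mem_surfaceP_iff.1 hp).1
  obtain ⟨ρ, hρ⟩ := exists_hasParams hp
  have h := hρ.2.2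
  rw [map_mul, Units.val_mul] at h
  rw [← hρ.trace_eq, map_mul, map_inv, map_inv, Units.val_mul, val_inv_eq, val_inv_eq,
    Matrix.smul_mul, Matrix.mul_smul, smul_smul, Matrix.trace_smul, trace_adjugate_mul_adjugate, h,
    det_map_T, hρ.2.1, smul_eq_mul]
  field_simp

/-- The left side is (tr(S)² − tr(ST))/det(S), which is the trace of S⁻¹T and of ST⁻¹; the surface
equation turns it into β − 1. -/
theorem sq_sub_div (hp : p ∈ surfaceP) :
    (p 1)⁻¹ * (p 0 * p 0 - p 1 * (p 2 + 1)) = p 2 / (p 2 - 1) := by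
  obtain ⟨h0, h1, hP⟩ := mem_surfaceP_iff.1 hp
  have h2 := sub_ne_zero.2 h1
  field_simp
  linear_combination -hP

theorem chi_S_inv_mul_T (hp : p ∈ surfaceP) : chi p (S⁻¹ * T) = p 2 / (p 2 - 1) := by
  obtain ⟨ρ, hρ⟩ := exists_hasParams hp
  have h := trace_mul_inv_mul (ρ T).val 1 (ρ S)
  have h3 := hρ.2.2
  rw [map_mul, Units.val_mul] at h3
  rw [Matrix.one_mul, Matrix.one_mul, Matrix.one_mul, trace_map_T, h3, hρ.1, hρ.2.1,
    sq_sub_div hp] at h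
  rw [← hρ.trace_eq, map_mul, map_inv, Units.val_mul, h]

theorem chi_S_mul_T_inv (hp : p ∈ surfaceP) : chi p (S * T⁻¹) = p 2 / (p 2 - 1) := by
  obtain ⟨ρ, hρ⟩ := exists_hasParams hp
  have h := trace_mul_inv (ρ S).val (ρ T)
  have h3 := hρ.2.2
  rw [map_mul, Units.val_mul] at h3
  rw [trace_map_T, det_map_T, h3, hρ.1, hρ.2.1, sq_sub_div hp] at h
  rw [← hρ.trace_eq, map_mul, map_inv, Units.val_mul, h]

/-- On the surface Fricke's formula reduces to w²x₁. This justifies defining the third parameter by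
tr(ST) = w(x₁ + 1) and reading it as tr(a). -/
theorem chi_commutators (hp : p ∈ surfaceP) :
    chi p a = p 2 ∧ chi p (T * S * T⁻¹ * S⁻¹) = p 2 ∧ chi p (S * T * S⁻¹ * T⁻¹) = p 2 := by
  obtain ⟨h0, -, hP⟩ := mem_surfaceP_iff.1 hp
  obtain ⟨ρ, hρ⟩ := exists_hasParams hp
  obtain ⟨h1, h2, h3⟩ := trace_commutator (trace_map_T ρ) (det_map_T ρ)
  have h := hρ.2.2
  rw [map_mul, Units.val_mul] at h
  rw [h, hρ.1, hρ.2.1] at h1 h2 h3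
  have hval : (p 1)⁻¹ * (p 1)⁻¹ * (2 * p 0 ^ 2 * p 1 + (p 1 * (p 2 + 1)) ^ 2 -
      p 0 ^ 2 * (p 1 * (p 2 + 1)) - 2 * p 1 ^ 2) = p 2 := by
    field_simp
    linear_combination hP
  simp only [← hρ.trace_eq, a, map_mul, map_inv, Units.val_mul, val_inv_eq, det_map_T, hρ.2.1,
    Matrix.smul_mul, Matrix.mul_smul, smul_smul, Matrix.trace_smul, h1, h2, h3, smul_eq_mul, hval,
    and_self]

theorem coordsGL2_chi (hp : p ∈ surfaceP) : coordsGL2 (chi p) = p := by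
  obtain ⟨ρ, hρ⟩ := exists_hasParams hp
  rw [← hρ.character_eq, coordsGL2_character, hρ.1, hρ.2.1, hρ.trace_eq, (chi_commutators hp).1]
  ext i
  fin_cases i <;> rfl

/-- The character of the sum of a two-dimensional representation with parameters `p` and of the
inverse of its determinant. -/
noncomputable def psi (p : Fin 3 → ℂ) : KnotGroup → ℂ :=
  fun γ => chi p γ + (p 1 ^ expSum γ)⁻¹

theorem coords_psi (hp : p ∈ surfaceP) : coords (psi p) = Phi p := by
  have h0 := (mem_surfaceP_iff.1 hp).1
  obtain ⟨-, h1, h2⟩ := chi_commutators hp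
  have e1 : psi p S = p 0 + 1 / p 1 := by simp [psi, chi_S hp]
  have e2 : psi p S⁻¹ = p 1 + p 0 / p 1 := by
    simp [psi, chi_S_inv hp, add_comm]
  have e3 : psi p (S * T) = p 1 * (p 2 + 1) + 1 / p 1 ^ 2 := by
    rw [psi, chi_S_mul_T hp, expSum_mul, expSum_S, expSum_T, one_div]
    norm_cast
  have e4 : psi p (S⁻¹ * T⁻¹) = (p 2 + 1) / p 1 + p 1 ^ 2 := by
    rw [psi, chi_S_inv_mul_T_inv hp, expSum_mul, expSum_inv, expSum_inv, expSum_S, expSum_T,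
      ← zpow_neg]
    norm_cast
  have e5 : psi p (T * S * T⁻¹ * S⁻¹) = p 2 + 1 := by simp [psi, h1]
  have e6 : psi p (S * T * S⁻¹ * T⁻¹) = p 2 + 1 := by simp [psi, h2]
  have e7 : psi p (S⁻¹ * T) = p 2 / (p 2 - 1) + 1 := by simp [psi, chi_S_inv_mul_T hp]
  have e8 : psi p (S * T⁻¹) = p 2 / (p 2 - 1) + 1 := by simp [psi, chi_S_mul_T_inv hp]
  rw [coords, e1, e2, e3, e4, e5, e6, e7, e8, Phi]

theorem HasParams.psi_eq {ρ : KnotGroup →* GL (Fin 2) ℂ} (h : HasParams ρ p) (γ : KnotGroup) :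
    (ρ γ).val.trace + ((ρ γ).val.det)⁻¹ = psi p γ := by
  rw [psi, h.trace_eq, det_eq_zpow, h.2.1]

/-- A reducible character depends only on the exponent sum; that of a is zero, so tr(a) would be 2.
-/
theorem not_isReducible_of_ne {ρ : KnotGroup →* GL (Fin 2) ℂ} (hp : p ∈ surfaceP)
    (h : HasParams ρ p) (h2 : p 2 ≠ 2) : ¬ IsReducible ρ := by
  intro hred
  obtain ⟨l, m, hlm⟩ := exists_zpow_of_isReducible hred
  apply h2
  rw [← (chi_commutators hp).1, ← h.trace_eq, (hlm a).1]
  simp [a]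
  norm_num

end Values

/-! ### Power sums and totally reducible characters -/

/-- Newton's recursion s₍ₖ₊₃₎ = e₁s₍ₖ₊₂₎ − e₂s₍ₖ₊₁₎ + sₖ, with e₃ = 1. -/
theorem exists_powerSum_nat (k : ℕ) : ∃ N : MvPolynomial (Fin 2) ℂ, ∀ b c d : ℂ, b * c * d = 1 →
    b ^ k + c ^ k + d ^ k = eval ![b + c + d, b * c + c * d + d * b] N := by
  induction k using Nat.strong_induction_on with
  | _ k ih =>
    match k, ih with
    | 0, _ => exact ⟨C 3, fun b c d _ => by simp; norm_num⟩
    | 1, _ => exact ⟨X 0, fun b c d _ => by simp⟩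
    | 2, _ => exact ⟨X 0 * X 0 - C 2 * X 1, fun b c d _ => by simp; ring⟩
    | k + 3, ih =>
      obtain ⟨N₀, h₀⟩ := ih k (by omega)
      obtain ⟨N₁, h₁⟩ := ih (k + 1) (by omega)
      obtain ⟨N₂, h₂⟩ := ih (k + 2) (by omega)
      refine ⟨X 0 * N₂ - X 1 * N₁ + N₀, fun b c d h => ?_⟩
      simp only [map_add, map_sub, map_mul, eval_X, ← h₀ b c d h, ← h₁ b c d h, ← h₂ b c d h,
        Matrix.cons_val]
      linear_combination (b ^ k + c ^ k + d ^ k) * h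

theorem exists_powerSum (k : ℤ) : ∃ N : MvPolynomial (Fin 2) ℂ, ∀ b c d : ℂ, b * c * d = 1 →
    b ^ k + c ^ k + d ^ k = eval ![b + c + d, b * c + c * d + d * b] N := by
  rcases Int.eq_nat_or_neg k with ⟨n, rfl | rfl⟩
  · obtain ⟨N, hN⟩ := exists_powerSum_nat n
    exact ⟨N, fun b c d h => by simpa using hN b c d h⟩
  · obtain ⟨N, hN⟩ := exists_powerSum_nat n
    -- When the product is one, inverting the three numbers exchanges e₁ and e₂.
    refine ⟨rename ![1, 0] N, fun b c d h => ?_⟩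
    have hb : b⁻¹ = c * d := inv_eq_of_mul_eq_one_right (by linear_combination h)
    have hc : c⁻¹ = d * b := inv_eq_of_mul_eq_one_right (by linear_combination h)
    have hd : d⁻¹ = b * c := inv_eq_of_mul_eq_one_right (by linear_combination h)
    have h1 := hN (c * d) (d * b) (b * c) (by linear_combination (b * c * d + 1) * h)
    rw [zpow_neg, zpow_neg, zpow_neg, zpow_natCast, zpow_natCast, zpow_natCast, ← inv_pow,
      ← inv_pow, ← inv_pow, hb, hc, hd, h1, eval_rename]
    congr 2
    ext i
    fin_cases i
    · simp; ring
    · simp; linear_combination (b + c + d) * h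

/-- The polynomial that expresses the power sum of exponent `k` of three numbers with product
one by their first two elementary symmetric functions. -/
noncomputable def powerSumPoly (k : ℤ) : MvPolynomial (Fin 2) ℂ := (exists_powerSum k).choose

theorem powerSum_eq (k : ℤ) {b c d : ℂ} (h : b * c * d = 1) :
    b ^ k + c ^ k + d ^ k = eval ![b + c + d, b * c + c * d + d * b] (powerSumPoly k) :=
  (exists_powerSum k).choose_spec b c d h

/-- The totally reducible character with coordinates `q = (y, ȳ)`. -/
noncomputable def charTR (q : Fin 2 → ℂ) : KnotGroup → ℂ :=
  fun γ => eval q (powerSumPoly (expSum γ))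

theorem exists_add_mul (s p : ℂ) : ∃ m n : ℂ, m + n = s ∧ m * n = p := by
  obtain ⟨d, hd⟩ := IsAlgClosed.exists_pow_nat_eq (s ^ 2 - 4 * p) (n := 2) (by norm_num)
  refine ⟨(s + d) / 2, (s - d) / 2, by ring, ?_⟩
  linear_combination (-1 / 4) * hd

theorem exists_eigenvalues (q : Fin 2 → ℂ) : ∃ b c d : ℂ, b * c * d = 1 ∧ b + c + d = q 0 ∧
    b * c + c * d + d * b = q 1 := by
  obtain ⟨b, hb⟩ : ∃ b : ℂ, b ^ 3 - q 0 * b ^ 2 + q 1 * b - 1 = 0 := by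
    have hdeg : (Polynomial.X ^ 3 - Polynomial.C (q 0) * Polynomial.X ^ 2 +
        Polynomial.C (q 1) * Polynomial.X - 1 : Polynomial ℂ).degree = 3 := by
      compute_degree!
    obtain ⟨b, hb⟩ := IsAlgClosed.exists_root _ (by rw [hdeg]; norm_num)
    exact ⟨b, by simpa using hb⟩
  have hb0 : b ≠ 0 := by
    rintro rfl
    simp at hb
  obtain ⟨c, d, h1, h2⟩ := exists_add_mul (q 0 - b) b⁻¹
  refine ⟨b, c, d, by rw [mul_assoc, h2, mul_inv_cancel₀ hb0], by linear_combination h1, ?_⟩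
  have h3 : b * c + c * d + d * b = b * (q 0 - b) + b⁻¹ := by linear_combination b * h1 + h2
  rw [h3]
  field_simp
  linear_combination -hb

theorem charTR_eq {q : Fin 2 → ℂ} {b c d : ℂ} (h : b * c * d = 1) (h0 : b + c + d = q 0)
    (h1 : b * c + c * d + d * b = q 1) (γ : KnotGroup) :
    charTR q γ = b ^ expSum γ + c ^ expSum γ + d ^ expSum γ := by
  rw [powerSum_eq _ h, charTR, h0, h1]
  congr 2
  ext i
  fin_cases i <;> rfl

theorem coords_charTR (q : Fin 2 → ℂ) :
    coords (charTR q) = ![q 0, q 1, q 0 ^ 2 - 2 * q 1, q 1 ^ 2 - 2 * q 0, 3, 3, 3, 3] := by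
  obtain ⟨b, c, d, h, h0, h1⟩ := exists_eigenvalues q
  have hb : b⁻¹ = c * d := inv_eq_of_mul_eq_one_right (by linear_combination h)
  have hc : c⁻¹ = d * b := inv_eq_of_mul_eq_one_right (by linear_combination h)
  have hd : d⁻¹ = b * c := inv_eq_of_mul_eq_one_right (by linear_combination h)
  have hk : ∀ γ (k : ℤ), expSum γ = k → charTR q γ = b ^ k + c ^ k + d ^ k :=
    fun γ k hγ => by rw [charTR_eq h h0 h1, hγ]
  have e1 : charTR q S = q 0 := by rw [hk _ 1 (by simp)]; simp [h0]
  have e2 : charTR q S⁻¹ = q 1 := by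
    rw [hk _ (-1) (by simp), ← h1]
    simp only [zpow_neg, zpow_one, hb, hc, hd]
    ring
  have e3 : charTR q (S * T) = q 0 ^ 2 - 2 * q 1 := by
    rw [hk _ 2 (by simp), ← h1, ← h0]
    simp only [zpow_ofNat]
    ring
  have e4 : charTR q (S⁻¹ * T⁻¹) = q 1 ^ 2 - 2 * q 0 := by
    rw [hk _ (-2) (by simp), ← h1, ← h0]
    simp only [zpow_neg, zpow_ofNat, ← inv_pow, hb, hc, hd]
    linear_combination (-2 * (b + c + d)) * h
  have e : ∀ γ, expSum γ = 0 → charTR q γ = 3 := fun γ hγ => by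
    rw [hk _ 0 hγ]
    norm_num
  rw [coords, e1, e2, e3, e4, e _ (by simp), e _ (by simp), e _ (by simp), e _ (by simp)]

theorem XTR_eq : XTR = Set.range charTR := by
  ext χ
  constructor
  · rintro ⟨ρ, hρ, rfl⟩
    obtain ⟨l, hl⟩ := exists_of_isTotallyReducible hρ
    have hdet := (hl S).2
    have h1 : (toGLRep ρ S).val.det = 1 := (ρ S).2
    rw [h1, expSum_S, Fin.prod_univ_three] at hdet
    simp only [zpow_one] at hdet
    refine ⟨![l 0 + l 1 + l 2, l 0 * l 1 + l 1 * l 2 + l 2 * l 0], funext fun γ => ?_⟩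
    rw [charTR_eq hdet.symm (by rfl) (by rfl), character, (hl γ).1, Fin.sum_univ_three]
    simp only [Units.val_zpow_eq_zpow_val]
  · rintro ⟨q, rfl⟩
    obtain ⟨b, c, d, h, h0, h1⟩ := exists_eigenvalues q
    have hb : b ≠ 0 := by rintro rfl; simp at h
    have hc : c ≠ 0 := by rintro rfl; simp at h
    have hd : d ≠ 0 := by rintro rfl; simp at h
    obtain ⟨ρ, hρ, hχ⟩ := exists_diagonal ![Units.mk0 b hb, Units.mk0 c hc, Units.mk0 d hd] (by
      rw [Fin.prod_univ_three]
      exact Units.ext (by simpa using h))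
    refine ⟨ρ, hρ, funext fun γ => ?_⟩
    rw [hχ, charTR_eq h h0 h1, Fin.sum_univ_three]
    simp [Units.val_zpow_eq_zpow_val]

/-! ### Recovering a reducible character from its coordinates -/

/-- The divided difference in the last variable. It compares a trace with that of a diagonal
representation having the same v and w but another tr(ST). -/
theorem exists_sub_eq_mul (f : MvPolynomial (Fin 4) ℂ) : ∃ H : MvPolynomial (Fin 5) ℂ,
    ∀ v w u c c' : ℂ, eval ![v, w, u, c] f - eval ![v, w, u, c'] f =
      (c - c') * eval ![v, w, u, c, c'] H := by
  induction f using MvPolynomial.induction_on with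
  | C r => exact ⟨0, fun v w u c c' => by simp⟩
  | add f g hf hg =>
    obtain ⟨H, hH⟩ := hf
    obtain ⟨K, hK⟩ := hg
    refine ⟨H + K, fun v w u c c' => ?_⟩
    simp only [map_add]
    linear_combination hH v w u c c' + hK v w u c c'
  | mul_X f i hf =>
    obtain ⟨H, hH⟩ := hf
    have hr : ∀ v w u c c' : ℂ, eval ![v, w, u, c, c'] (rename ![0, 1, 2, 4] f) =
        eval ![v, w, u, c'] f := by
      intro v w u c c'
      rw [eval_rename]
      congr 2
      ext j
      fin_cases j <;> rfl
    fin_cases i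
    · exact ⟨H * X 0, fun v w u c c' => by simp; linear_combination v * hH v w u c c'⟩
    · exact ⟨H * X 1, fun v w u c c' => by simp; linear_combination w * hH v w u c c'⟩
    · exact ⟨H * X 2, fun v w u c c' => by simp; linear_combination u * hH v w u c c'⟩
    · refine ⟨H * X 3 + rename ![0, 1, 2, 4] f, fun v w u c c' => ?_⟩
      simp [hr]
      linear_combination c * hH v w u c c'

theorem Phi_apply (p : Fin 3 → ℂ) : Phi p 0 = p 0 + 1 / p 1 ∧ Phi p 1 = p 1 + p 0 / p 1 ∧
    Phi p 2 = p 1 * (p 2 + 1) + 1 / p 1 ^ 2 ∧ Phi p 3 = (p 2 + 1) / p 1 + p 1 ^ 2 ∧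
    Phi p 4 = p 2 + 1 ∧ Phi p 5 = p 2 + 1 ∧ Phi p 6 = p 2 / (p 2 - 1) + 1 ∧
    Phi p 7 = p 2 / (p 2 - 1) + 1 :=
  ⟨rfl, rfl, rfl, rfl, rfl, rfl, rfl, rfl⟩

/-! ### Polynomial relations between the coordinates on the surface -/

section Identities

variable {p : Fin 3 → ℂ}

theorem Phi_alpha_beta (hp : p ∈ surfaceP) : (Phi p 4 - 2) * (Phi p 6 - 2) = 1 := by
  obtain ⟨h0, h1, hP⟩ := mem_surfaceP_iff.1 hp
  have h2 := sub_ne_zero.2 h1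
  obtain ⟨-, -, -, -, e4, -, e6, -⟩ := Phi_apply p
  rw [e4, e6]
  field_simp
  ring

/-- The surface equation in coordinates: K = α + β − 1 is v²/w, that is (m + n)²/(mn) for the
eigenvalues of S on the plane. -/
theorem sq_eq (hp : p ∈ surfaceP) : p 0 ^ 2 = (Phi p 4 + Phi p 6 - 1) * p 1 := by
  obtain ⟨h0, h1, hP⟩ := mem_surfaceP_iff.1 hp
  have h2 := sub_ne_zero.2 h1
  obtain ⟨-, -, -, -, e4, -, e6, -⟩ := Phi_apply p
  rw [e4, e6]
  field_simp
  linear_combination -hP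

/-- The right side is one of the equations of X_TR, so β = 3 is where the image may touch X_TR, and
w can be solved for where β ≠ 3. -/
theorem beta_sub_mul_w (hp : p ∈ surfaceP) :
    (Phi p 6 - 3) * p 1 = Phi p 0 ^ 2 - 2 * Phi p 1 - Phi p 2 := by
  have h0 := (mem_surfaceP_iff.1 hp).1
  have h := sq_eq hp
  obtain ⟨e0, e1, e2, -, e4, -, -, -⟩ := Phi_apply p
  rw [e4] at h
  rw [e0, e1, e2]
  generalize Phi p 6 = β at *
  field_simp
  linear_combination (-p 1 ^ 2) * h

theorem beta_sub_mul_u (hp : p ∈ surfaceP) :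
    (Phi p 6 - 3) * (p 1)⁻¹ = Phi p 1 ^ 2 - 2 * Phi p 0 - Phi p 3 := by
  have h0 := (mem_surfaceP_iff.1 hp).1
  have h := sq_eq hp
  obtain ⟨e0, e1, -, e3, e4, -, -, -⟩ := Phi_apply p
  rw [e4] at h
  rw [e0, e1, e3]
  generalize Phi p 6 = β at *
  field_simp
  linear_combination -h

end Identities

/-- The functions on the surface form a module over the polynomials in the coordinates that is
generated by `1`, `w` and `w⁻¹`. -/
theorem exists_module_expression (F : MvPolynomial (Fin 4) ℂ) :
    ∃ a₀ a₁ a₂ : MvPolynomial (Fin 8) ℂ, ∀ p ∈ surfaceP,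
      eval ![p 0, p 1, (p 1)⁻¹, p 2] F =
        eval (Phi p) a₀ + eval (Phi p) a₁ * p 1 + eval (Phi p) a₂ * (p 1)⁻¹ := by
  have hw : ∀ a₀ a₁ a₂ : MvPolynomial (Fin 8) ℂ, ∃ b₀ b₁ b₂ : MvPolynomial (Fin 8) ℂ,
      ∀ p ∈ surfaceP, (eval (Phi p) a₀ + eval (Phi p) a₁ * p 1 + eval (Phi p) a₂ * (p 1)⁻¹) *
        p 1 = eval (Phi p) b₀ + eval (Phi p) b₁ * p 1 + eval (Phi p) b₂ * (p 1)⁻¹ := by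
    intro a₀ a₁ a₂
    -- The eigenvalue w⁻¹ of S satisfies the characteristic equation, which gives w² = ȳw − y + w⁻¹.
    refine ⟨a₂ - a₁ * X 0, a₀ + a₁ * X 1, a₁, fun p hp => ?_⟩
    have h0 := (mem_surfaceP_iff.1 hp).1
    obtain ⟨e0, e1, -⟩ := Phi_apply p
    simp only [map_add, map_sub, map_mul, eval_X]
    rw [e0, e1]
    field_simp
    ring
  have hu : ∀ a₀ a₁ a₂ : MvPolynomial (Fin 8) ℂ, ∃ b₀ b₁ b₂ : MvPolynomial (Fin 8) ℂ,
      ∀ p ∈ surfaceP, (eval (Phi p) a₀ + eval (Phi p) a₁ * p 1 + eval (Phi p) a₂ * (p 1)⁻¹) *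
        (p 1)⁻¹ = eval (Phi p) b₀ + eval (Phi p) b₁ * p 1 + eval (Phi p) b₂ * (p 1)⁻¹ := by
    intro a₀ a₁ a₂
    -- The same equation in the form w⁻² = yw⁻¹ − ȳ + w.
    refine ⟨a₁ - a₂ * X 1, a₂, a₀ + a₂ * X 0, fun p hp => ?_⟩
    have h0 := (mem_surfaceP_iff.1 hp).1
    obtain ⟨e0, e1, -⟩ := Phi_apply p
    simp only [map_add, map_sub, map_mul, eval_X]
    rw [e0, e1]
    field_simp
    ring
  induction F using MvPolynomial.induction_on with
  | C r => exact ⟨C r, 0, 0, fun p _ => by simp⟩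
  | add f g hf hg =>
    obtain ⟨a₀, a₁, a₂, ha⟩ := hf
    obtain ⟨b₀, b₁, b₂, hb⟩ := hg
    refine ⟨a₀ + b₀, a₁ + b₁, a₂ + b₂, fun p hp => ?_⟩
    simp only [map_add]
    linear_combination ha p hp + hb p hp
  | mul_X f i hf =>
    obtain ⟨a₀, a₁, a₂, ha⟩ := hf
    fin_cases i
    · obtain ⟨b₀, b₁, b₂, hb⟩ := hu a₀ a₁ a₂
      -- Multiplication by v = y − w⁻¹.
      refine ⟨a₀ * X 0 - b₀, a₁ * X 0 - b₁, a₂ * X 0 - b₂, fun p hp => ?_⟩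
      obtain ⟨e0, -⟩ := Phi_apply p
      have h1 := ha p hp
      have h2 := hb p hp
      rw [← h1] at h2
      simp [e0]
      linear_combination (p 0 + (p 1)⁻¹) * h1 - h2
    · obtain ⟨b₀, b₁, b₂, hb⟩ := hw a₀ a₁ a₂
      refine ⟨b₀, b₁, b₂, fun p hp => ?_⟩
      rw [← hb p hp, map_mul, ha p hp]
      simp
    · obtain ⟨b₀, b₁, b₂, hb⟩ := hu a₀ a₁ a₂
      refine ⟨b₀, b₁, b₂, fun p hp => ?_⟩
      rw [← hb p hp, map_mul, ha p hp]
      simp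
    · refine ⟨a₀ * (X 4 - 1), a₁ * (X 4 - 1), a₂ * (X 4 - 1), fun p hp => ?_⟩
      obtain ⟨-, -, -, -, e4, -⟩ := Phi_apply p
      simp [e4]
      linear_combination p 2 * ha p hp

/-- The parameters are those of a diagonal representation with eigenvalues m, n, where m + n = v and
mn = w; then tr(ST) = m² + n². Adding the inverse determinant gives three eigenvalues with product
one. -/
theorem eval_tracePoly_abelian {v w : ℂ} (hw : w ≠ 0) (γ : KnotGroup) :
    eval ![v, w, w⁻¹, v ^ 2 - 2 * w] (tracePoly γ) + (w ^ expSum γ)⁻¹ =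
      charTR ![v + 1 / w, w + v / w] γ := by
  obtain ⟨m, n, hv, hmn⟩ := exists_add_mul v w
  have hm : m ≠ 0 := by rintro rfl; exact hw (by simpa using hmn.symm)
  have hn : n ≠ 0 := by rintro rfl; exact hw (by simpa using hmn.symm)
  let ρ : KnotGroup →* Matrix (Fin 2) (Fin 2) ℂ :=
    { toFun := fun γ => Matrix.diagonal ![m ^ expSum γ, n ^ expSum γ]
      map_one' := by
        ext i j
        fin_cases i <;> fin_cases j <;> simp
      map_mul' := fun γ δ => by
        ext i j
        fin_cases i <;> fin_cases j <;> simp [zpow_add₀, hm, hn] }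
  have hval : ∀ γ, (ρ.toHomUnits γ).val = Matrix.diagonal ![m ^ expSum γ, n ^ expSum γ] :=
    fun γ => rfl
  have htr : ∀ γ, (ρ.toHomUnits γ).val.trace = m ^ expSum γ + n ^ expSum γ := fun γ => by
    rw [hval, Matrix.trace_diagonal, Fin.sum_univ_two]
    rfl
  have hpar : traceParams ρ.toHomUnits = ![v, w, w⁻¹, v ^ 2 - 2 * w] := by
    have h1 : (ρ.toHomUnits S).val.det = w := by
      rw [hval, Matrix.det_diagonal, Fin.prod_univ_two]
      simpa using hmn
    rw [traceParams, htr, htr, h1]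
    simp only [expSum_mul, expSum_S, expSum_T, zpow_one, hv]
    norm_num
    rw [← hv, ← hmn]
    ring
  rw [← hpar, ← eval_tracePoly, htr, charTR_eq (b := m) (c := n) (d := w⁻¹)
    (by rw [hmn, mul_inv_cancel₀ hw]) (by rw [hv]; simp)]
  · simp
  · simp only [Matrix.cons_val]
    field_simp
    linear_combination w * hmn + hv

/-- Each reducible character is a polynomial in its coordinates. -/
theorem exists_coordinate_polynomial (γ : KnotGroup) : ∃ R : MvPolynomial (Fin 8) ℂ,
    (∀ p ∈ surfaceP, psi p γ = eval (Phi p) R) ∧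
      ∀ q, charTR q γ = eval (coords (charTR q)) R := by
  obtain ⟨H, hH⟩ := exists_sub_eq_mul (tracePoly γ)
  obtain ⟨a₀, a₁, a₂, ha⟩ := exists_module_expression
    (X 1 * bind₁ ![X 0, X 1, X 2, X 1 * (X 3 + 1), X 0 ^ 2 - 2 * X 1] H)
  -- The values tr(ST) of ρ and of the diagonal comparison differ by −(β − 3)w. So the correction is
  -- (β − 3)·wH with wH = a₀ + a₁w + a₂w⁻¹, and the two products with β − 3 are replaced by
  -- polynomials in the coordinates. On X_TR all three terms vanish.
  refine ⟨rename ![0, 1] (powerSumPoly (expSum γ)) - ((X 6 - 3) * a₀ +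
    (X 0 ^ 2 - 2 * X 1 - X 2) * a₁ + (X 1 ^ 2 - 2 * X 0 - X 3) * a₂), fun p hp => ?_,
    fun q => ?_⟩
  · have h0 := (mem_surfaceP_iff.1 hp).1
    have h1 := hH (p 0) (p 1) (p 1)⁻¹ (p 1 * (p 2 + 1)) (p 0 ^ 2 - 2 * p 1)
    have h2 := eval_tracePoly_abelian (v := p 0) h0 γ
    have h3 := ha p hp
    have h4 : eval (Phi p) (rename ![0, 1] (powerSumPoly (expSum γ))) =
        charTR ![p 0 + 1 / p 1, p 1 + p 0 / p 1] γ := by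
      rw [eval_rename, charTR]
      congr 2
      ext j
      fin_cases j <;> rfl
    have h5 : eval ![p 0, p 1, (p 1)⁻¹, p 2]
        (bind₁ ![X 0, X 1, X 2, X 1 * (X 3 + 1), X 0 ^ 2 - 2 * X 1] H) =
        eval ![p 0, p 1, (p 1)⁻¹, p 1 * (p 2 + 1), p 0 ^ 2 - 2 * p 1] H := by
      rw [← MvPolynomial.coe_aeval_eq_eval, RingHom.coe_coe, aeval_bind₁,
        ← MvPolynomial.coe_aeval_eq_eval, RingHom.coe_coe]
      congr 2
      ext j
      fin_cases j <;> simp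
    rw [map_mul, h5, eval_X] at h3
    simp only [Matrix.cons_val] at h3
    have h6 := beta_sub_mul_w hp
    have h7 := beta_sub_mul_u hp
    have h8 := sq_eq hp
    have e4 : Phi p 4 = p 2 + 1 := rfl
    rw [e4] at h8
    simp only [map_sub, map_add, map_mul, map_pow, eval_X, map_ofNat, h4]
    rw [psi, chi, ← h2, ← h6, ← h7]
    linear_combination h1 - (Phi p 6 - 3) * h3 -
      eval ![p 0, p 1, (p 1)⁻¹, p 1 * (p 2 + 1), p 0 ^ 2 - 2 * p 1] H * h8
  · have h4 : eval (coords (charTR q)) (rename ![0, 1] (powerSumPoly (expSum γ))) =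
        charTR q γ := by
      rw [eval_rename, charTR, coords_charTR]
      congr 2
      ext j
      fin_cases j <;> rfl
    simp [h4]
    rw [coords_charTR]
    simp

/-- A polynomial that recovers the value at `γ` of a reducible character from its coordinates. -/
noncomputable def coordPoly (γ : KnotGroup) : MvPolynomial (Fin 8) ℂ :=
  (exists_coordinate_polynomial γ).choose

theorem psi_eq_eval {p : Fin 3 → ℂ} (hp : p ∈ surfaceP) (γ : KnotGroup) :
    psi p γ = eval (Phi p) (coordPoly γ) :=
  (exists_coordinate_polynomial γ).choose_spec.1 p hp

theorem charTR_eq_eval (q : Fin 2 → ℂ) (γ : KnotGroup) :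
    charTR q γ = eval (coords (charTR q)) (coordPoly γ) :=
  (exists_coordinate_polynomial γ).choose_spec.2 q

/-! ### Families parametrized by the surface -/

/-- The regular functions `v`, `w`, `w⁻¹`, `x₁`, `(x₁ - 1)⁻¹` on the surface. -/
noncomputable def surfaceFunctions (p : Fin 3 → ℂ) : Fin 5 → ℂ :=
  ![p 0, p 1, (p 1)⁻¹, p 2, (p 2 - 1)⁻¹]

/-- A family of points that depends polynomially on the functions `surfaceFunctions`. -/
def IsSurfaceFamily {σ : Type} (G : (Fin 3 → ℂ) → (σ → ℂ)) : Prop :=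
  ∀ j, ∃ Q : MvPolynomial (Fin 5) ℂ, ∀ p ∈ surfaceP, G p j = eval (surfaceFunctions p) Q

theorem eventually_ne_punctured (a : ℂ) : ∀ᶠ t in 𝓝[≠] (0 : ℂ), t ≠ a := by
  by_cases h : a = 0
  · subst h
    exact self_mem_nhdsWithin
  · exact nhdsWithin_le_nhds (isOpen_ne.mem_nhds (Ne.symm h))

/-- A curve in the surface along which `x₁` varies. -/
noncomputable def curveX (p : Fin 3 → ℂ) (t : ℂ) : Fin 3 → ℂ :=
  ![p 0, p 0 ^ 2 * (p 2 + t - 1) / ((p 2 + t) ^ 2 + (p 2 + t) - 1), p 2 + t]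

/-- A curve in the surface through a point with `v = 0`. -/
noncomputable def curveV (k : ℂ) (p : Fin 3 → ℂ) (t : ℂ) : Fin 3 → ℂ :=
  ![k * t, k ^ 2 * (p 2 + t ^ 2 - 1) / (t ^ 2 + 2 * p 2 + 1), p 2 + t ^ 2]

/-! ### Curves through the points of the surface -/

section Curves

variable {p : Fin 3 → ℂ}

theorem quadratic_ne_zero (hp : p ∈ surfaceP) (hv : p 0 ≠ 0) : p 2 ^ 2 + p 2 - 1 ≠ 0 := by
  obtain ⟨h0, h1, hP⟩ := mem_surfaceP_iff.1 hp
  intro h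
  rw [h, zero_mul] at hP
  exact mul_ne_zero (pow_ne_zero 2 hv) (sub_ne_zero.2 h1) hP.symm

theorem quadratic_eq_zero (hp : p ∈ surfaceP) (hv : p 0 = 0) :
    p 2 ^ 2 + p 2 - 1 = 0 ∧ 2 * p 2 + 1 ≠ 0 := by
  obtain ⟨h0, h1, hP⟩ := mem_surfaceP_iff.1 hp
  have h : p 2 ^ 2 + p 2 - 1 = 0 := by
    rw [hv] at hP
    exact (mul_eq_zero.1 (hP.trans (by ring))).resolve_right h0
  refine ⟨h, fun h2 => ?_⟩
  -- The discriminant of x² + x − 1 is 5, so its roots are simple.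
  have : (5 : ℂ) = 0 := by linear_combination (2 * p 2 + 1) * h2 - 4 * h
  norm_num at this

theorem curveX_zero (hp : p ∈ surfaceP) (hv : p 0 ≠ 0) : curveX p 0 = p := by
  obtain ⟨h0, h1, hP⟩ := mem_surfaceP_iff.1 hp
  have h2 := quadratic_ne_zero hp hv
  ext i
  fin_cases i
  · rfl
  · simp only [curveX, add_zero]
    refine (div_eq_iff h2).2 ?_
    simp only [Fin.mk_one]
    linear_combination -hP
  · simp [curveX]

theorem curveX_mem (hp : p ∈ surfaceP) (hv : p 0 ≠ 0) : ∀ᶠ t in 𝓝 (0 : ℂ), curveX p t ∈ surfaceP := by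
  obtain ⟨h0, h1, hP⟩ := mem_surfaceP_iff.1 hp
  have h2 := quadratic_ne_zero hp hv
  have c1 : ContinuousAt (fun t : ℂ => (p 2 + t) ^ 2 + (p 2 + t) - 1) 0 := by fun_prop
  have c2 : ContinuousAt (fun t : ℂ => p 2 + t) 0 := by fun_prop
  filter_upwards [c1.eventually_ne (by simpa using h2), c2.eventually_ne (y := 1) (by simpa using h1)]
    with t ht1 ht2
  have ht3 := sub_ne_zero.2 ht2
  refine mem_surfaceP_iff.2 ⟨?_, ht2, ?_⟩
  · exact div_ne_zero (mul_ne_zero (pow_ne_zero 2 hv) ht3) ht1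
  · simp only [curveX, Matrix.cons_val]
    rw [mul_div_cancel₀ _ ht1]

theorem differentiableAt_curveX (hp : p ∈ surfaceP) (hv : p 0 ≠ 0) (i : Fin 3) :
    DifferentiableAt ℂ (fun t => curveX p t i) 0 := by
  have h2 := quadratic_ne_zero hp hv
  fin_cases i
  · exact differentiableAt_const _
  · refine DifferentiableAt.fun_div (by fun_prop) (by fun_prop) (by simpa using h2)
  · exact (differentiableAt_id.const_add _)

/-- At v = 0 the quadratic in x₁ has a simple zero, so v² vanishes to first order in x₁. Hence the
substitution x₁ + t², v = kt, and this k makes the curve pass through p at t = 0. -/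
theorem exists_curveV_constant (hp : p ∈ surfaceP) (hv : p 0 = 0) :
    ∃ k : ℂ, k ≠ 0 ∧ k ^ 2 * (p 2 - 1) = p 1 * (2 * p 2 + 1) := by
  obtain ⟨h0, h1, hP⟩ := mem_surfaceP_iff.1 hp
  obtain ⟨h2, h3⟩ := quadratic_eq_zero hp hv
  have h4 := sub_ne_zero.2 h1
  obtain ⟨k, hk⟩ := IsAlgClosed.exists_pow_nat_eq (p 1 * (2 * p 2 + 1) / (p 2 - 1)) (n := 2)
    (by norm_num)
  refine ⟨k, ?_, by rw [hk, div_mul_cancel₀ _ h4]⟩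
  rintro rfl
  exact div_ne_zero (mul_ne_zero h0 h3) h4 (by simpa using hk.symm)

theorem curveV_zero (hp : p ∈ surfaceP) (hv : p 0 = 0) {k : ℂ}
    (hk : k ^ 2 * (p 2 - 1) = p 1 * (2 * p 2 + 1)) : curveV k p 0 = p := by
  have h3 := (quadratic_eq_zero hp hv).2
  ext i
  fin_cases i
  · simp [curveV, hv]
  · simp only [curveV]
    refine (div_eq_iff (by simpa using h3)).2 ?_
    simp only [Fin.mk_one]
    linear_combination hk
  · simp [curveV]

theorem curveV_mem (hp : p ∈ surfaceP) (hv : p 0 = 0) {k : ℂ} (hk0 : k ≠ 0) :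
    ∀ᶠ t in 𝓝 (0 : ℂ), curveV k p t ∈ surfaceP := by
  obtain ⟨h0, h1, hP⟩ := mem_surfaceP_iff.1 hp
  obtain ⟨h2, h3⟩ := quadratic_eq_zero hp hv
  have c1 : ContinuousAt (fun t : ℂ => t ^ 2 + 2 * p 2 + 1) 0 := by fun_prop
  have c2 : ContinuousAt (fun t : ℂ => p 2 + t ^ 2) 0 := by fun_prop
  filter_upwards [c1.eventually_ne (by simpa using h3), c2.eventually_ne (y := 1) (by simpa using h1)]
    with t ht1 ht2
  have ht3 := sub_ne_zero.2 ht2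
  refine mem_surfaceP_iff.2 ⟨?_, ht2, ?_⟩
  · exact div_ne_zero (mul_ne_zero (pow_ne_zero 2 hk0) ht3) ht1
  · simp only [curveV, Matrix.cons_val]
    have : (p 2 + t ^ 2) ^ 2 + (p 2 + t ^ 2) - 1 = t ^ 2 * (t ^ 2 + 2 * p 2 + 1) := by
      linear_combination h2
    rw [this, mul_assoc, mul_div_cancel₀ _ ht1]
    ring

theorem differentiableAt_curveV (hp : p ∈ surfaceP) (hv : p 0 = 0) (k : ℂ) (i : Fin 3) :
    DifferentiableAt ℂ (fun t => curveV k p t i) 0 := by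
  have h3 := (quadratic_eq_zero hp hv).2
  fin_cases i
  · exact differentiableAt_id.const_mul _
  · exact DifferentiableAt.fun_div (by fun_prop) (by fun_prop) (by simpa using h3)
  · change DifferentiableAt ℂ (fun t => p 2 + t ^ 2) 0
    fun_prop

/-- Each point of the surface is a limit of points with `v ≠ 0` and `x₁ ≠ 2`. -/
theorem exists_approximation (hp : p ∈ surfaceP) : ∃ c : ℂ → Fin 3 → ℂ,
    (∀ i, Filter.Tendsto (fun t => c t i) (𝓝[≠] 0) (𝓝 (p i))) ∧
      ∀ᶠ t in 𝓝[≠] (0 : ℂ), c t ∈ surfaceP ∧ c t 0 ≠ 0 ∧ c t 2 ≠ 2 := by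
  by_cases hv : p 0 = 0
  · obtain ⟨k, hk0, hk⟩ := exists_curveV_constant hp hv
    obtain ⟨h2, h3⟩ := quadratic_eq_zero hp hv
    have h5 : p 2 ≠ 2 := by
      intro h
      rw [h] at h2
      norm_num at h2
    refine ⟨curveV k p, fun i => ?_, ?_⟩
    · have := (differentiableAt_curveV hp hv k i).continuousAt.tendsto
      rw [curveV_zero hp hv hk] at this
      exact this.mono_left nhdsWithin_le_nhds
    · have c2 : ContinuousAt (fun t : ℂ => p 2 + t ^ 2) 0 := by fun_prop
      filter_upwards [(curveV_mem hp hv hk0).filter_mono nhdsWithin_le_nhds, self_mem_nhdsWithin,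
        (c2.eventually_ne (y := 2) (by simpa using h5)).filter_mono nhdsWithin_le_nhds]
        with t h6 h7 h8
      exact ⟨h6, mul_ne_zero hk0 h7, h8⟩
  · refine ⟨curveX p, fun i => ?_, ?_⟩
    · have := (differentiableAt_curveX hp hv i).continuousAt.tendsto
      rw [curveX_zero hp hv] at this
      exact this.mono_left nhdsWithin_le_nhds
    · filter_upwards [(curveX_mem hp hv).filter_mono nhdsWithin_le_nhds,
        eventually_ne_punctured (2 - p 2)] with t h6 h7
      exact ⟨h6, hv, fun h => h7 (eq_sub_of_add_eq' h)⟩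

end Curves

/-! ### Density and irreducibility for families over the surface -/

section Families

variable {σ : Type} {G : (Fin 3 → ℂ) → (σ → ℂ)}

/-- Points with v = 0 lie outside the chart, and points with x₁ = 2 may give reducible
representations. Both are analytic limits of the remaining points, and polynomials are continuous.
-/
theorem IsSurfaceFamily.image_subset_zariskiClosure (hG : IsSurfaceFamily G) :
    G '' surfaceP ⊆ zariskiClosure (G '' {p | p ∈ surfaceP ∧ p 0 ≠ 0 ∧ p 2 ≠ 2}) := by
  rintro _ ⟨p, hp, rfl⟩
  obtain ⟨c, hc, hcP⟩ := exists_approximation hp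
  obtain ⟨h0, h1, -⟩ := mem_surfaceP_iff.1 hp
  refine mem_zariskiClosure_of_tendsto (l := 𝓝[≠] (0 : ℂ)) (c := fun t => G (c t)) (fun j => ?_) ?_
  · obtain ⟨Q, hQ⟩ := hG j
    have h2 : Filter.Tendsto (fun t => surfaceFunctions (c t)) (𝓝[≠] 0)
        (𝓝 (surfaceFunctions p)) := by
      refine tendsto_pi_nhds.2 fun i => ?_
      fin_cases i
      · exact hc 0
      · exact hc 1
      · exact (hc 1).inv₀ h0
      · exact hc 2
      · exact ((hc 2).sub_const 1).inv₀ (sub_ne_zero.2 h1)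
    rw [hQ p hp]
    refine (((continuous_eval_coord Q).tendsto _).comp h2).congr' ?_
    filter_upwards [hcP] with t ht using (hQ _ ht.1).symm
  · filter_upwards [hcP] with t ht using ⟨_, ht, rfl⟩

/-- The parameter of a point of the surface with `v ≠ 0` and `x₁² + x₁ - 1 ≠ 0`. -/
noncomputable def surfaceChart (q : Fin 2 → ℂ) : Fin 3 → ℂ :=
  ![q 0, q 0 * q 0 * (q 1 - 1) * (q 1 ^ 2 + q 1 - 1)⁻¹, q 1]

/-- The domain of `surfaceChart` is the nonvanishing set of this polynomial. -/
noncomputable def chartDenominator : MvPolynomial (Fin 2) ℂ :=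
  X 0 * (X 1 - C 1) * (X 1 ^ 2 + X 1 - C 1)

theorem eval_chartDenominator (q : Fin 2 → ℂ) :
    eval q chartDenominator = q 0 * (q 1 - 1) * (q 1 ^ 2 + q 1 - 1) := by
  simp [chartDenominator]

theorem chartDenominator_ne_zero : chartDenominator ≠ 0 := by
  intro h0
  have h1 := eval_chartDenominator ![1, 0]
  rw [h0] at h1
  norm_num at h1

theorem surfaceChart_mem {q : Fin 2 → ℂ} (hq : eval q chartDenominator ≠ 0) :
    surfaceChart q ∈ surfaceP := by
  rw [eval_chartDenominator] at hq
  have h1 := right_ne_zero_of_mul hq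
  have h2 := right_ne_zero_of_mul (left_ne_zero_of_mul hq)
  have h3 := left_ne_zero_of_mul (left_ne_zero_of_mul hq)
  refine mem_surfaceP_iff.2 ⟨mul_ne_zero (mul_ne_zero (mul_ne_zero h3 h3) h2) (inv_ne_zero h1),
    sub_ne_zero.1 h2, ?_⟩
  simp only [surfaceChart, Matrix.cons_val]
  linear_combination (q 0 * q 0 * (q 1 - 1)) * mul_inv_cancel₀ h1

theorem isFraction_surfaceChart (i : Fin 5) :
    IsFraction chartDenominator fun q => surfaceFunctions (surfaceChart q) i := by
  have d0 : (X 0 : MvPolynomial (Fin 2) ℂ) ∣ chartDenominator :=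
    (dvd_mul_right _ _).mul_right _
  have d1 : (X 1 - C 1 : MvPolynomial (Fin 2) ℂ) ∣ chartDenominator :=
    (dvd_mul_left _ _).mul_right _
  have d2 : (X 1 ^ 2 + X 1 - C 1 : MvPolynomial (Fin 2) ℂ) ∣ chartDenominator := dvd_mul_left _ _
  have e1 : ∀ q : Fin 2 → ℂ, eval q (X 1 - C 1 : MvPolynomial (Fin 2) ℂ) = q 1 - 1 :=
    fun q => by simp
  have e2 : ∀ q : Fin 2 → ℂ, eval q (X 1 ^ 2 + X 1 - C 1 : MvPolynomial (Fin 2) ℂ) =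
      q 1 ^ 2 + q 1 - 1 := fun q => by simp
  have f0 := isFraction_eval chartDenominator (X 0)
  have f1 := isFraction_eval chartDenominator (X 1)
  have f2 := isFraction_eval chartDenominator (X 1 - C 1)
  have f3 := isFraction_eval chartDenominator (X 1 ^ 2 + X 1 - C 1)
  have f4 := isFraction_inv d0
  have f5 := isFraction_inv d1
  have f6 := isFraction_inv d2
  simp only [e1, e2, eval_X] at f0 f1 f2 f3 f4 f5 f6
  fin_cases i
  · exact f0
  · exact ((f0.mul f0).mul f2).mul f6
  · have h := ((f4.mul f4).mul f5).mul f3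
    simp only [surfaceFunctions, surfaceChart, Fin.reduceFinMk, Matrix.cons_val, mul_inv, inv_inv]
    exact h
  · exact f1
  · exact f5

theorem surfaceChart_eq {p : Fin 3 → ℂ} (hp : p ∈ surfaceP) (hv : p 0 ≠ 0) :
    eval ![p 0, p 2] chartDenominator ≠ 0 ∧ surfaceChart ![p 0, p 2] = p := by
  obtain ⟨h1, h2, hP⟩ := mem_surfaceP_iff.1 hp
  have h3 := quadratic_ne_zero hp hv
  constructor
  · rw [eval_chartDenominator]
    exact mul_ne_zero (mul_ne_zero hv (sub_ne_zero.2 h2)) h3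
  · ext i
    fin_cases i
    · rfl
    · simp only [surfaceChart, Fin.mk_one, Matrix.cons_val]
      rw [← div_eq_mul_inv, div_eq_iff h3]
      linear_combination -hP
    · rfl

/-- The surface is rational: v and x₁ determine w where v ≠ 0. So the image lies between the image
of an open subset of the plane and its closure. -/
theorem IsSurfaceFamily.isIrreducible (hG : IsSurfaceFamily G) :
    @IsIrreducible _ (zariskiTopology σ) (G '' surfaceP) := by
  choose Q hQ using hG
  have hirr := isIrreducible_image_nonvanishing chartDenominator chartDenominator_ne_zero
    (fun q j => eval (surfaceFunctions (surfaceChart q)) (Q j))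
    fun j => isFraction_comp isFraction_surfaceChart _
  have heq : ∀ q, eval q chartDenominator ≠ 0 →
      (fun j => eval (surfaceFunctions (surfaceChart q)) (Q j)) = G (surfaceChart q) :=
    fun q hq => funext fun j => (hQ j _ (surfaceChart_mem hq)).symm
  refine isIrreducible_of_subset_zariskiClosure hirr ?_
    ((IsSurfaceFamily.image_subset_zariskiClosure fun j => ⟨Q j, hQ j⟩).trans ?_)
  · rintro _ ⟨q, hq, rfl⟩
    exact ⟨_, surfaceChart_mem hq, (heq q hq).symm⟩
  · refine @closure_mono _ (zariskiTopology σ) _ _ ?_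
    rintro _ ⟨p, ⟨hp, hv, -⟩, rfl⟩
    obtain ⟨hq, hqp⟩ := surfaceChart_eq hp hv
    refine ⟨![p 0, p 2], hq, ?_⟩
    dsimp only
    rw [heq _ hq, hqp]

end Families

theorem isSurfaceFamily_chi : IsSurfaceFamily chi := by
  intro γ
  refine ⟨bind₁ ![X 0, X 1, X 2, X 1 * (X 3 + 1)] (tracePoly γ), fun p _ => ?_⟩
  rw [chi, ← MvPolynomial.coe_aeval_eq_eval, RingHom.coe_coe,
    ← MvPolynomial.coe_aeval_eq_eval, RingHom.coe_coe, aeval_bind₁]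
  congr 2
  ext j
  fin_cases j <;> simp [surfaceFunctions]

theorem isSurfaceFamily_psi : IsSurfaceFamily psi := by
  intro γ
  obtain ⟨Q, hQ⟩ := isSurfaceFamily_chi γ
  rcases Int.eq_nat_or_neg (expSum γ) with ⟨n, h | h⟩
  · refine ⟨Q + X 2 ^ n, fun p hp => ?_⟩
    simp [psi, hQ p hp, h, surfaceFunctions]
  · refine ⟨Q + X 1 ^ n, fun p hp => ?_⟩
    simp [psi, hQ p hp, h, surfaceFunctions]

/-! ### The equations of the image of the parametrization -/

/-- The cubic polynomial in `K` that vanishes if `K = (l + m)² / (l m)` for two of the three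
eigenvalues of a matrix of determinant one with trace `y` and inverse of trace `b`. -/
def eigenvaluePairPoly (y b K : ℂ) : ℂ :=
  K ^ 3 - (y * b + 3) * K ^ 2 + (y ^ 3 + b ^ 3 - y * b + 3) * K - (y * b - 1) ^ 2

theorem eigenvaluePairPoly_eq {l m n : ℂ} (h : l * m * n = 1) (K : ℂ) :
    eigenvaluePairPoly (l + m + n) (l * m + m * n + n * l) K =
      -(((l + m) ^ 2 - K * (l * m)) * ((m + n) ^ 2 - K * (m * n)) *
        ((n + l) ^ 2 - K * (n * l))) := by
  unfold eigenvaluePairPoly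
  set y := l + m + n with hy
  set b := l * m + m * n + n * l with hb
  -- The identity is made homogeneous by powers of lmn, so that it holds without the hypothesis on
  -- the product.
  have h1 : -(((l + m) ^ 2 - K * (l * m)) * ((m + n) ^ 2 - K * (m * n)) *
        ((n + l) ^ 2 - K * (n * l))) = K ^ 3 * (l * m * n) ^ 2 -
        (y * b * (l * m * n) + 3 * (l * m * n) ^ 2) * K ^ 2 +
        (y ^ 3 * (l * m * n) + b ^ 3 - y * b * (l * m * n) + 3 * (l * m * n) ^ 2) * K -
        (y * b - l * m * n) ^ 2 := by
    rw [hy, hb]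
    ring
  rw [h1, h]
  ring

/-- Equations for the image of the parametrization, in the coordinates
`(y, ȳ, z, z̄, α, ᾱ, β, β̄)`. -/
noncomputable def phiEquations : Fin 9 → MvPolynomial (Fin 8) ℂ :=
  ![X 4 - X 5, X 6 - X 7, (X 4 - 2) * (X 6 - 2) - 1,
    (X 0 ^ 2 - 2 * X 1 - X 2) * (X 1 ^ 2 - 2 * X 0 - X 3) - (X 6 - 3) ^ 2,
    ((X 6 - 3) * X 0 - (X 1 ^ 2 - 2 * X 0 - X 3)) ^ 2 -
      (X 4 + X 6 - 1) * (X 0 ^ 2 - 2 * X 1 - X 2) * (X 6 - 3),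
    (X 6 - 3) ^ 2 * X 1 - (X 0 ^ 2 - 2 * X 1 - X 2) * (X 6 - 3) -
      ((X 6 - 3) * X 0 - (X 1 ^ 2 - 2 * X 0 - X 3)) * (X 1 ^ 2 - 2 * X 0 - X 3),
    (X 6 - 3) ^ 2 * X 2 - X 4 * (X 0 ^ 2 - 2 * X 1 - X 2) * (X 6 - 3) -
      (X 1 ^ 2 - 2 * X 0 - X 3) ^ 2,
    (X 6 - 3) ^ 2 * X 3 - X 4 * (X 1 ^ 2 - 2 * X 0 - X 3) * (X 6 - 3) -
      (X 0 ^ 2 - 2 * X 1 - X 2) ^ 2,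
    (X 4 + X 6 - 1) ^ 3 - (X 0 * X 1 + 3) * (X 4 + X 6 - 1) ^ 2 +
      (X 0 ^ 3 + X 1 ^ 3 - X 0 * X 1 + 3) * (X 4 + X 6 - 1) - (X 0 * X 1 - 1) ^ 2]

/-- Put e = y² − 2ȳ − z and f = ȳ² − 2y − z̄. Equations four to eight say, cleared of (β − 3)², that
w = e/(β − 3), w⁻¹ = f/(β − 3) and v = y − w⁻¹ are valid parameters. They degenerate at β = 3, where
the last equation takes over. -/
theorem phiEquations_iff (x : Fin 8 → ℂ) : (∀ i, eval x (phiEquations i) = 0) ↔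
    x 4 = x 5 ∧ x 6 = x 7 ∧ (x 4 - 2) * (x 6 - 2) = 1 ∧
    (x 0 ^ 2 - 2 * x 1 - x 2) * (x 1 ^ 2 - 2 * x 0 - x 3) = (x 6 - 3) ^ 2 ∧
    ((x 6 - 3) * x 0 - (x 1 ^ 2 - 2 * x 0 - x 3)) ^ 2 =
      (x 4 + x 6 - 1) * (x 0 ^ 2 - 2 * x 1 - x 2) * (x 6 - 3) ∧
    (x 6 - 3) ^ 2 * x 1 = (x 0 ^ 2 - 2 * x 1 - x 2) * (x 6 - 3) +
      ((x 6 - 3) * x 0 - (x 1 ^ 2 - 2 * x 0 - x 3)) * (x 1 ^ 2 - 2 * x 0 - x 3) ∧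
    (x 6 - 3) ^ 2 * x 2 = x 4 * (x 0 ^ 2 - 2 * x 1 - x 2) * (x 6 - 3) +
      (x 1 ^ 2 - 2 * x 0 - x 3) ^ 2 ∧
    (x 6 - 3) ^ 2 * x 3 = x 4 * (x 1 ^ 2 - 2 * x 0 - x 3) * (x 6 - 3) +
      (x 0 ^ 2 - 2 * x 1 - x 2) ^ 2 ∧
    eigenvaluePairPoly (x 0) (x 1) (x 4 + x 6 - 1) = 0 := by
  simp only [Fin.forall_fin_succ, phiEquations, eigenvaluePairPoly]
  simp [sub_eq_zero, sub_sub]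

/-- The eigenvalues are m, n on the plane and w⁻¹ on the line; the factor of the pair m, n vanishes
by `sq_eq`. -/
theorem eigenvaluePairPoly_Phi {p : Fin 3 → ℂ} (hp : p ∈ surfaceP) :
    eigenvaluePairPoly (Phi p 0) (Phi p 1) (Phi p 4 + Phi p 6 - 1) = 0 := by
  obtain ⟨h0, -, -⟩ := mem_surfaceP_iff.1 hp
  obtain ⟨m, n, h1, h2⟩ := exists_add_mul (p 0) (p 1)
  have h3 : m * n * (p 1)⁻¹ = 1 := by rw [h2, mul_inv_cancel₀ h0]
  have h4 := eigenvaluePairPoly_eq h3 (Phi p 4 + Phi p 6 - 1)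
  obtain ⟨e0, e1, -⟩ := Phi_apply p
  have h5 : m * n + n * (p 1)⁻¹ + (p 1)⁻¹ * m = Phi p 1 := by
    rw [e1, div_eq_mul_inv]
    linear_combination h2 + (p 1)⁻¹ * h1
  rw [h5, h1, h2, sq_eq hp, sub_self, zero_mul, zero_mul, neg_zero] at h4
  rw [e0, one_div]
  exact h4

theorem eval_phiEquations {p : Fin 3 → ℂ} (hp : p ∈ surfaceP) (i : Fin 9) :
    eval (Phi p) (phiEquations i) = 0 := by
  revert i
  rw [phiEquations_iff]
  obtain ⟨h0, -, -⟩ := mem_surfaceP_iff.1 hp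
  have hu := mul_inv_cancel₀ h0
  have hw := beta_sub_mul_w hp
  have hu' := beta_sub_mul_u hp
  have hsq := sq_eq hp
  obtain ⟨e0, e1, e2, e3, e4, e5, e6, e7⟩ := Phi_apply p
  rw [div_eq_mul_inv] at e0 e1 e2 e3
  rw [← inv_pow] at e2
  have hv : p 0 = Phi p 0 - (p 1)⁻¹ := by rw [e0]; ring
  have h1 : (Phi p 6 - 3) * Phi p 0 - (Phi p 1 ^ 2 - 2 * Phi p 0 - Phi p 3) =
      (Phi p 6 - 3) * p 0 := by
    rw [← hu', hv]; ring
  refine ⟨e4.trans e5.symm, e6.trans e7.symm, Phi_alpha_beta hp, ?_, ?_, ?_, ?_, ?_,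
    eigenvaluePairPoly_Phi hp⟩
  · rw [← hw, ← hu']
    linear_combination (Phi p 6 - 3) ^ 2 * hu
  · rw [h1, ← hw]
    linear_combination (Phi p 6 - 3) ^ 2 * hsq
  · rw [h1, ← hw, ← hu']
    linear_combination (Phi p 6 - 3) ^ 2 * e1
  · rw [← hw, ← hu']
    linear_combination (Phi p 6 - 3) ^ 2 * (e2 - p 1 * e4)
  · rw [← hw, ← hu']
    linear_combination (Phi p 6 - 3) ^ 2 * (e3 - (p 1)⁻¹ * e4)

theorem eq_Phi_of {p : Fin 3 → ℂ} {x : Fin 8 → ℂ} (h0 : x 0 = p 0 + (p 1)⁻¹)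
    (h1 : x 1 = p 1 + p 0 * (p 1)⁻¹) (h2 : x 2 = p 1 * (p 2 + 1) + (p 1)⁻¹ ^ 2)
    (h3 : x 3 = (p 2 + 1) * (p 1)⁻¹ + p 1 ^ 2) (h4 : x 4 = p 2 + 1) (h45 : x 4 = x 5)
    (h67 : x 6 = x 7) (h2' : p 2 ≠ 1) (h46 : (x 4 - 2) * (x 6 - 2) = 1) : Phi p = x := by
  have h6 : p 2 / (p 2 - 1) + 1 = x 6 := by
    have h5 := sub_ne_zero.2 h2'
    rw [div_add_one h5, div_eq_iff h5]
    rw [h4] at h46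
    linear_combination -h46
  obtain ⟨e0, e1, e2, e3, e4, e5, e6, e7⟩ := Phi_apply p
  rw [one_div] at e0
  rw [div_eq_mul_inv] at e1 e3
  rw [one_div, ← inv_pow] at e2
  ext i
  fin_cases i
  · exact e0.trans h0.symm
  · exact e1.trans h1.symm
  · exact e2.trans h2.symm
  · exact e3.trans h3.symm
  · exact e4.trans h4.symm
  · exact e5.trans (h4.symm.trans h45)
  · exact e6.trans h6
  · exact e7.trans (h6.trans h67)

/-- A matrix of determinant one with trace `q 0` and inverse of trace `q 1`, for a point `q` of the
plane curve, has two eigenvalues `m`, `n` with `(m + n)² = 5 m n`. -/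
theorem exists_of_mem_planeCurve {q : Fin 2 → ℂ} (hq : q ∈ planeCurve) :
    ∃ p ∈ surfaceP, p 2 = 2 ∧
      Phi p = ![q 0, q 1, q 0 ^ 2 - 2 * q 1, q 1 ^ 2 - 2 * q 0, 3, 3, 3, 3] := by
  obtain ⟨b, c, d, h, h0, h1⟩ := exists_eigenvalues q
  have h2 := eigenvaluePairPoly_eq h 5
  rw [h0, h1] at h2
  have h3 : eigenvaluePairPoly (q 0) (q 1) 5 = 0 := by
    change _ = _ at hq
    rw [eigenvaluePairPoly]
    linear_combination hq
  rw [h3, eq_comm, neg_eq_zero, mul_eq_zero, mul_eq_zero] at h2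
  -- One of the three cyclically permuted factors vanishes at K = 5. Its pair becomes the spectrum
  -- on the plane, with x₁ = 2.
  have key : ∀ l m n : ℂ, l * m * n = 1 → l + m + n = q 0 → l * m + m * n + n * l = q 1 →
      (l + m) ^ 2 - 5 * (l * m) = 0 → ∃ p ∈ surfaceP, p 2 = 2 ∧
        Phi p = ![q 0, q 1, q 0 ^ 2 - 2 * q 1, q 1 ^ 2 - 2 * q 0, 3, 3, 3, 3] := by
    intro l m n hl hs he h5
    have hlm : l * m ≠ 0 := left_ne_zero_of_mul (hl.trans_ne one_ne_zero)
    have hn : (l * m)⁻¹ = n := inv_eq_of_mul_eq_one_right hl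
    refine ⟨![l + m, l * m, 2], mem_surfaceP_iff.2 ⟨hlm, ?_, ?_⟩, rfl, eq_Phi_of ?_ ?_ ?_ ?_ ?_
      rfl rfl ?_ ?_⟩
    all_goals simp only [Matrix.cons_val, hn]
    · norm_num
    · linear_combination -h5
    · exact hs.symm
    · linear_combination -he
    · rw [← hs, ← he]
      linear_combination h5
    · rw [← hs, ← he]
      linear_combination n ^ 2 * h5 + (2 * (l + m) + 5 * n) * hl
    · norm_num
    · norm_num
    · norm_num
  rcases h2 with (h2 | h2) | h2
  · exact key b c d h h0 h1 h2
  · exact key c d b (by linear_combination h) (by linear_combination h0) (by linear_combination h1)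
      h2
  · exact key d b c (by linear_combination h) (by linear_combination h0) (by linear_combination h1)
      h2

/-- For β ≠ 3 the parameters are solved for as fractions. For β = 3 the equations force e² = f² = 0
and α = 3, so the point is in the plane of X_TR, and the cubic at K = 5 puts it on the curve. -/
theorem exists_Phi_eq {x : Fin 8 → ℂ} (hx : ∀ i, eval x (phiEquations i) = 0) :
    ∃ p ∈ surfaceP, Phi p = x := by
  obtain ⟨h45, h67, h46, h1, h2, h3, h4, h5, h6⟩ := (phiEquations_iff x).1 hx
  by_cases h : x 6 - 3 = 0
  · rw [h] at h1 h2 h3 h4 h5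
    have hf : x 1 ^ 2 - 2 * x 0 - x 3 = 0 := by
      refine pow_eq_zero_iff (two_ne_zero) |>.1 ?_
      linear_combination -h4
    have he : x 0 ^ 2 - 2 * x 1 - x 2 = 0 := by
      refine pow_eq_zero_iff (two_ne_zero) |>.1 ?_
      linear_combination -h5
    have h8 : x 6 = 3 := sub_eq_zero.1 h
    have h9 : x 4 = 3 := by
      rw [h8] at h46
      linear_combination h46
    have h10 : (![x 0, x 1] : Fin 2 → ℂ) ∈ planeCurve := by
      rw [h8, h9, eigenvaluePairPoly] at h6
      change _ = _
      simp only [Matrix.cons_val]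
      linear_combination h6
    obtain ⟨p, hp, -, hpx⟩ := exists_of_mem_planeCurve h10
    refine ⟨p, hp, hpx.trans ?_⟩
    ext i
    fin_cases i
    · rfl
    · rfl
    · exact sub_eq_zero.1 he
    · exact sub_eq_zero.1 hf
    · exact h9.symm
    · exact h9.symm.trans h45
    · exact h8.symm
    · exact h8.symm.trans h67
  · set w := (x 0 ^ 2 - 2 * x 1 - x 2) / (x 6 - 3) with hw
    set u := (x 1 ^ 2 - 2 * x 0 - x 3) / (x 6 - 3) with hu
    have hw' : (x 6 - 3) * w = x 0 ^ 2 - 2 * x 1 - x 2 := mul_div_cancel₀ _ h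
    have hu' : (x 6 - 3) * u = x 1 ^ 2 - 2 * x 0 - x 3 := mul_div_cancel₀ _ h
    rw [← hw', ← hu'] at h1 h2 h3 h4 h5
    have h7 := pow_ne_zero 2 h
    have hwu : w * u = 1 := mul_left_cancel₀ h7 (by linear_combination h1)
    have hw0 : w ≠ 0 := left_ne_zero_of_mul (hwu.trans_ne one_ne_zero)
    have hinv : w⁻¹ = u := inv_eq_of_mul_eq_one_right hwu
    have h40 : x 4 - 2 ≠ 0 := left_ne_zero_of_mul (h46.trans_ne one_ne_zero)
    have hsq : (x 0 - u) ^ 2 = (x 4 + x 6 - 1) * w :=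
      mul_left_cancel₀ h7 (by linear_combination h2)
    refine ⟨![x 0 - u, w, x 4 - 1], mem_surfaceP_iff.2 ⟨hw0, ?_, ?_⟩, eq_Phi_of ?_ ?_ ?_ ?_ ?_
      h45 h67 ?_ h46⟩
    all_goals simp only [Matrix.cons_val, hinv]
    · exact fun h8 => h40 (by linear_combination h8)
    · linear_combination -(x 4 - 2) * hsq - w * h46
    · ring
    · exact mul_left_cancel₀ h7 (by linear_combination h3)
    · exact mul_left_cancel₀ h7 (by linear_combination h4)
    · exact mul_left_cancel₀ h7 (by linear_combination h5)
    · ring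
    · exact fun h8 => h40 (by linear_combination h8)

/-! ### The locus of reducible characters -/

/-- The group elements at which the eight coordinates are evaluated. -/
def coordElement : Fin 8 → KnotGroup :=
  ![S, S⁻¹, S * T, S⁻¹ * T⁻¹, T * S * T⁻¹ * S⁻¹, S * T * S⁻¹ * T⁻¹, S⁻¹ * T, S * T⁻¹]

theorem coords_eq (χ : KnotGroup → ℂ) : coords χ = χ ∘ coordElement := by
  ext i
  fin_cases i <;> rfl

theorem eval_rename_coordElement (χ : KnotGroup → ℂ) (f : MvPolynomial (Fin 8) ℂ) :
    eval χ (rename coordElement f) = eval (coords χ) f := by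
  rw [eval_rename, coords_eq]

theorem eval_coords_of_mem_zariskiClosure {Y : Set (KnotGroup → ℂ)} {χ : KnotGroup → ℂ}
    (hχ : χ ∈ zariskiClosure Y) {f : MvPolynomial (Fin 8) ℂ}
    (h : ∀ χ' ∈ Y, eval (coords χ') f = 0) : eval (coords χ) f = 0 := by
  rw [← eval_rename_coordElement]
  exact mem_zariskiClosure_iff.1 hχ _ fun χ' hχ' => by
    rw [eval_rename_coordElement]
    exact h χ' hχ'

theorem eq_eval_coords_of_mem_zariskiClosure {Y : Set (KnotGroup → ℂ)} {χ : KnotGroup → ℂ}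
    (hχ : χ ∈ zariskiClosure Y) {R : MvPolynomial (Fin 8) ℂ} {γ : KnotGroup}
    (h : ∀ χ' ∈ Y, χ' γ = eval (coords χ') R) : χ γ = eval (coords χ) R := by
  have := mem_zariskiClosure_iff.1 hχ (X γ - rename coordElement R) fun χ' hχ' => by
    rw [map_sub, eval_X, eval_rename_coordElement, h χ' hχ', sub_self]
  rwa [map_sub, eval_X, eval_rename_coordElement, sub_eq_zero] at this

theorem eq_psi_of_coords {χ : KnotGroup → ℂ} (h : ∀ γ, χ γ = eval (coords χ) (coordPoly γ))
    {p : Fin 3 → ℂ} (hp : p ∈ surfaceP) (hχ : Phi p = coords χ) : χ = psi p :=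
  funext fun γ => by rw [h, psi_eq_eval hp, hχ]

theorem psi_apply_eq_eval {p : Fin 3 → ℂ} (hp : p ∈ surfaceP) (γ : KnotGroup) :
    psi p γ = eval (coords (psi p)) (coordPoly γ) := by
  rw [coords_psi hp, psi_eq_eval hp]

/-- A point of the closure satisfies the nine equations, so its coordinates come from some p. The
polynomials `coordPoly` also persist on the closure and recover every other value. -/
theorem isClosed_image_psi : IsClosed[zariskiTopology KnotGroup] (psi '' surfaceP) := by
  refine isClosed_of_forall fun χ hχ => ?_
  rw [← mem_zariskiClosure_iff] at hχ
  obtain ⟨p, hp, hpχ⟩ := exists_Phi_eq (x := coords χ) fun i =>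
    eval_coords_of_mem_zariskiClosure hχ (by
      rintro _ ⟨p, hp, rfl⟩
      rw [coords_psi hp]
      exact eval_phiEquations hp i)
  refine ⟨p, hp, (eq_psi_of_coords (fun γ => ?_) hp hpχ).symm⟩
  refine eq_eval_coords_of_mem_zariskiClosure hχ ?_
  rintro _ ⟨p, hp, rfl⟩
  exact psi_apply_eq_eval hp γ

/-- Determinant one forces the one-dimensional constituent to be the inverse determinant of the
other. -/
theorem eq_psi_of_irreducible {ρ : KnotGroup →* Matrix.SpecialLinearGroup (Fin 3) ℂ} {l : ℂˣ}
    {ρ₂ : KnotGroup →* GL (Fin 2) ℂ} (h2 : ¬ IsReducible ρ₂) (h : ∀ γ,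
      (toGLRep ρ γ).val.trace = ((l ^ expSum γ : ℂˣ) : ℂ) + (ρ₂ γ).val.trace ∧
      (toGLRep ρ γ).val.det = ((l ^ expSum γ : ℂˣ) : ℂ) * (ρ₂ γ).val.det) :
    ∃ p ∈ surfaceP, character (toGLRep ρ) = psi p := by
  obtain ⟨p, hp, hρ⟩ := exists_hasParams_of_irreducible h2
  refine ⟨p, hp, funext fun γ => ?_⟩
  have h1 : (toGLRep ρ γ).val.det = 1 := (ρ γ).2
  rw [(h γ).2] at h1
  rw [← hρ.psi_eq γ, character, (h γ).1, ← eq_inv_of_mul_eq_one_left h1, add_comm]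

theorem psi_mem_of_ne {p : Fin 3 → ℂ} (hp : p ∈ surfaceP) (h2 : p 2 ≠ 2) :
    ∃ ρ : KnotGroup →* Matrix.SpecialLinearGroup (Fin 3) ℂ,
      IsPartiallyReducible (toGLRep ρ) ∧ psi p = character (toGLRep ρ) := by
  obtain ⟨ρ, hρ⟩ := exists_hasParams hp
  refine ⟨sumDetInvRep ρ, isPartiallyReducible_sumDetInvRep (not_isReducible_of_ne hp hρ h2),
    funext fun γ => ?_⟩
  rw [character_sumDetInvRep, hρ.psi_eq]

theorem XPR_eq : XPR = psi '' surfaceP := by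
  refine Set.Subset.antisymm ?_ ?_
  · refine (@IsClosed.closure_subset_iff _ (zariskiTopology KnotGroup) _ _
      isClosed_image_psi).2 ?_
    rintro _ ⟨ρ, hρ, rfl⟩
    obtain ⟨l, ρ₂, h2, h⟩ := exists_of_isPartiallyReducible hρ
    obtain ⟨p, hp, h3⟩ := eq_psi_of_irreducible h2 h
    exact ⟨p, hp, h3.symm⟩
  · refine isSurfaceFamily_psi.image_subset_zariskiClosure.trans
      (@closure_mono _ (zariskiTopology KnotGroup) _ _ ?_)
    rintro _ ⟨p, ⟨hp, -, h2⟩, rfl⟩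
    exact psi_mem_of_ne hp h2

theorem XTR_subset_reducibleLocus : XTR ⊆ reducibleLocus := by
  rintro _ ⟨ρ, ⟨e, he⟩, rfl⟩
  refine ⟨⟨ρ, rfl⟩, ρ, ⟨_, ?_, ?_, he 0⟩, rfl⟩
  · exact fun h => e.ne_zero 0 (Submodule.span_singleton_eq_bot.1 h)
  · intro h
    have h1 := finrank_span_singleton (K := ℂ) (e.ne_zero 0)
    rw [h, finrank_top, Module.finrank_fin_fun] at h1
    norm_num at h1

theorem psi_mem_reducibleLocus {p : Fin 3 → ℂ} (hp : p ∈ surfaceP) : psi p ∈ reducibleLocus := by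
  obtain ⟨ρ, hρ⟩ := exists_hasParams hp
  have h : psi p = character (toGLRep (sumDetInvRep ρ)) :=
    funext fun γ => by rw [character_sumDetInvRep, hρ.psi_eq]
  exact ⟨⟨_, h⟩, _, isReducible_sumDetInvRep ρ, h⟩

theorem XPR_subset_reducibleLocus : XPR ⊆ reducibleLocus := by
  rw [XPR_eq]
  rintro _ ⟨p, hp, rfl⟩
  exact psi_mem_reducibleLocus hp

/-- The character sees only the diagonal blocks, a line and a plane; the plane is either irreducible
or contributes two more one-dimensional characters. -/
theorem reducibleLocus_eq : reducibleLocus = XTR ∪ XPR := by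
  refine Set.Subset.antisymm ?_
    (Set.union_subset XTR_subset_reducibleLocus XPR_subset_reducibleLocus)
  rintro _ ⟨-, ρ, hρ, rfl⟩
  obtain ⟨l, ρ₂, h⟩ := exists_of_isReducible hρ
  by_cases h2 : IsReducible ρ₂
  · obtain ⟨m, n, h3⟩ := exists_zpow_of_isReducible h2
    have hdet : (toGLRep ρ S).val.det = 1 := (ρ S).2
    rw [(h S).2, (h3 S).2, expSum_S] at hdet
    simp only [zpow_one] at hdet
    rw [XTR_eq]
    refine Or.inl ⟨![(l : ℂ) + m + n, l * m + m * n + n * l], funext fun γ => ?_⟩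
    rw [charTR_eq (b := l) (c := m) (d := n) (by linear_combination hdet) (by rfl) (by rfl),
      character, (h γ).1, (h3 γ).1]
    simp only [Units.val_zpow_eq_zpow_val]
    ring
  · rw [XPR_eq]
    obtain ⟨p, hp, h3⟩ := eq_psi_of_irreducible h2 h
    exact Or.inr ⟨p, hp, h3.symm⟩

theorem isClosed_XPR : IsClosed[zariskiTopology KnotGroup] XPR := isClosed_zariskiClosure _

theorem isIrreducible_XPR : @IsIrreducible _ (zariskiTopology KnotGroup) XPR := by
  rw [XPR_eq]
  exact isSurfaceFamily_psi.isIrreducible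

theorem isClosed_XTR : IsClosed[zariskiTopology KnotGroup] XTR := by
  rw [XTR_eq]
  refine isClosed_of_forall fun χ hχ => ?_
  rw [← mem_zariskiClosure_iff] at hχ
  refine ⟨![χ S, χ S⁻¹], funext fun γ => ?_⟩
  have h := eq_eval_coords_of_mem_zariskiClosure hχ
    (R := rename ![0, 1] (powerSumPoly (expSum γ))) (γ := γ) (by
      rintro _ ⟨q, rfl⟩
      rw [eval_rename, charTR, coords_charTR]
      congr 2
      ext j
      fin_cases j <;> rfl)
  rw [h, eval_rename, charTR]
  congr 2
  ext j
  fin_cases j <;> rfl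

theorem isIrreducible_XTR : @IsIrreducible _ (zariskiTopology KnotGroup) XTR := by
  have h := isIrreducible_image_nonvanishing (1 : MvPolynomial (Fin 2) ℂ) one_ne_zero charTR
    fun γ => isFraction_eval 1 (powerSumPoly (expSum γ))
  rw [XTR_eq]
  convert h
  rw [← Set.image_univ]
  congr 1
  ext x
  simp

/-! ### The component of the characters in dimension two -/

theorem character_sq_sub (ρ : KnotGroup →* GL (Fin 2) ℂ) (γ : KnotGroup) :
    (character ρ γ ^ 2 - character ρ (γ ^ 2)) / 2 = (ρ γ).val.det := by
  rw [character, character, map_pow, Units.val_pow_eq_pow_val, pow_two (ρ γ).val,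
    Matrix.trace_fin_two, Matrix.trace_fin_two, Matrix.det_fin_two]
  simp only [Matrix.mul_apply, Fin.sum_univ_two]
  ring

theorem chi_sq_sub {p : Fin 3 → ℂ} (hp : p ∈ surfaceP) (γ : KnotGroup) :
    (chi p γ ^ 2 - chi p (γ ^ 2)) / 2 = p 1 ^ expSum γ := by
  obtain ⟨ρ, hρ⟩ := exists_hasParams hp
  rw [← hρ.character_eq, character_sq_sub, det_eq_zpow, hρ.2.1]

/-- The determinant of the value at `γ`, as a polynomial in characters. -/
noncomputable def detPoly (γ : KnotGroup) : MvPolynomial KnotGroup ℂ :=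
  C (1 / 2) * (X γ ^ 2 - X (γ ^ 2))

theorem eval_detPoly (χ : KnotGroup → ℂ) (γ : KnotGroup) :
    eval χ (detPoly γ) = (χ γ ^ 2 - χ (γ ^ 2)) / 2 := by
  simp only [detPoly, map_mul, map_sub, map_pow, eval_X, eval_C]
  ring

/-- The conditions w ≠ 0 and x₁ ≠ 1 survive in the closure because both inverses are polynomials in
the character: w⁻¹ is the determinant at S⁻¹, and (x₁ − 1)⁻¹ is χ(S⁻¹T) − 1. -/
theorem isClosed_image_chi : IsClosed[zariskiTopology KnotGroup] (chi '' surfaceP) := by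
  refine isClosed_of_forall fun χ hχ => ?_
  have hw : ∀ p ∈ surfaceP, eval (chi p) (detPoly S) = p 1 := fun p hp => by
    rw [eval_detPoly, chi_sq_sub hp, expSum_S, zpow_one]
  have hu : ∀ p ∈ surfaceP, eval (chi p) (detPoly S⁻¹) = (p 1)⁻¹ := fun p hp => by
    rw [eval_detPoly, chi_sq_sub hp, expSum_inv, expSum_S, zpow_neg_one]
  have h1 : eval χ (detPoly S) * eval χ (detPoly S⁻¹) = 1 := by
    have := hχ (detPoly S * detPoly S⁻¹ - 1) (by
      rintro _ ⟨p, hp, rfl⟩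
      rw [map_sub, map_mul, map_one, hw p hp, hu p hp,
        mul_inv_cancel₀ (mem_surfaceP_iff.1 hp).1, sub_self])
    rwa [map_sub, map_mul, map_one, sub_eq_zero] at this
  have h2 : (χ a - 1) * (χ (S⁻¹ * T) - 1) = 1 := by
    have := hχ ((X a - 1) * (X (S⁻¹ * T) - 1) - 1) (by
      rintro _ ⟨p, hp, rfl⟩
      have h3 := sub_ne_zero.2 (mem_surfaceP_iff.1 hp).2.1
      simp only [map_sub, map_mul, map_one, eval_X]
      rw [(chi_commutators hp).1, chi_S_inv_mul_T hp]
      field_simp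
      ring)
    simpa only [map_sub, map_mul, map_one, eval_X, sub_eq_zero] using this
  have h3 : (χ a ^ 2 + χ a - 1) * eval χ (detPoly S) = χ S ^ 2 * (χ a - 1) := by
    have := hχ ((X a ^ 2 + X a - 1) * detPoly S - X S ^ 2 * (X a - 1)) (by
      rintro _ ⟨p, hp, rfl⟩
      simp only [map_sub, map_mul, map_one, map_pow, map_add, eval_X]
      rw [hw p hp, (chi_commutators hp).1, chi_S hp, (mem_surfaceP_iff.1 hp).2.2, sub_self])
    simpa only [map_sub, map_mul, map_one, map_pow, map_add, eval_X, sub_eq_zero] using this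
  have hw0 := left_ne_zero_of_mul (h1.trans_ne one_ne_zero)
  have hx1 := left_ne_zero_of_mul (h2.trans_ne one_ne_zero)
  refine ⟨![χ S, eval χ (detPoly S), χ a],
    mem_surfaceP_iff.2 ⟨hw0, sub_ne_zero.1 hx1, h3⟩, funext fun γ => ?_⟩
  have hinv : (eval χ (detPoly S))⁻¹ = eval χ (detPoly S⁻¹) :=
    inv_eq_of_mul_eq_one_right h1
  let F : Fin 4 → MvPolynomial KnotGroup ℂ :=
    ![X S, detPoly S, detPoly S⁻¹, detPoly S * (X a + 1)]
  have hF : ∀ χ' : KnotGroup → ℂ, eval χ' (bind₁ F (tracePoly γ)) =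
      eval ![χ' S, eval χ' (detPoly S), eval χ' (detPoly S⁻¹),
        eval χ' (detPoly S) * (χ' a + 1)] (tracePoly γ) := by
    intro χ'
    rw [← MvPolynomial.coe_aeval_eq_eval, RingHom.coe_coe,
      ← MvPolynomial.coe_aeval_eq_eval, RingHom.coe_coe, aeval_bind₁]
    congr 2
    ext j
    fin_cases j <;> simp [F, MvPolynomial.aeval_eq_eval]
  have h4 := hχ (bind₁ F (tracePoly γ) - X γ) (by
    rintro _ ⟨p, hp, rfl⟩
    rw [map_sub, hF, eval_X, hw p hp, hu p hp, chi_S hp, (chi_commutators hp).1, chi, sub_self])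
  rw [map_sub, hF, eval_X, sub_eq_zero] at h4
  rw [← h4, chi, ← hinv]
  rfl

theorem X2_eq : X2 = chi '' surfaceP := by
  refine Set.Subset.antisymm ?_ ?_
  · refine (@IsClosed.closure_subset_iff _ (zariskiTopology KnotGroup) _ _
      isClosed_image_chi).2 ?_
    rintro _ ⟨ρ, hρ, rfl⟩
    obtain ⟨p, hp, h⟩ := exists_hasParams_of_irreducible hρ
    exact ⟨p, hp, h.character_eq.symm⟩
  · refine isSurfaceFamily_chi.image_subset_zariskiClosure.trans
      (@closure_mono _ (zariskiTopology KnotGroup) _ _ ?_)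
    rintro _ ⟨p, ⟨hp, -, h2⟩, rfl⟩
    obtain ⟨ρ, hρ⟩ := exists_hasParams hp
    exact ⟨ρ, not_isReducible_of_ne hp hρ h2, hρ.character_eq.symm⟩

/-! ### Components, isomorphisms and intersections -/

theorem charTR_mem_XTR (q : Fin 2 → ℂ) : charTR q ∈ XTR := XTR_eq ▸ ⟨q, rfl⟩

theorem psi_mem_XPR {p : Fin 3 → ℂ} (hp : p ∈ surfaceP) : psi p ∈ XPR := XPR_eq ▸ ⟨p, hp, rfl⟩

theorem not_XTR_subset_XPR : ¬ XTR ⊆ XPR := by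
  intro h
  -- The origin is not on the plane curve, whose constant term is 64.
  have h1 := h (charTR_mem_XTR ![0, 0])
  rw [XPR_eq] at h1
  obtain ⟨p, hp, h2⟩ := h1
  have h3 := eigenvaluePairPoly_Phi hp
  rw [← coords_psi hp, h2, coords_charTR, eigenvaluePairPoly] at h3
  simp only [Matrix.cons_val] at h3
  norm_num at h3

theorem surface_point_mem : (![1, 1, 0] : Fin 3 → ℂ) ∈ surfaceP := by
  refine mem_surfaceP_iff.2 ⟨?_, ?_, ?_⟩ <;> simp only [Matrix.cons_val] <;> norm_num

theorem not_XPR_subset_XTR : ¬ XPR ⊆ XTR := by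
  intro h
  have h1 := h (psi_mem_XPR surface_point_mem)
  rw [XTR_eq] at h1
  obtain ⟨q, h2⟩ := h1
  have h3 := congrFun (congrArg coords h2) 4
  rw [coords_psi surface_point_mem, coords_charTR, (Phi_apply _).2.2.2.2.1] at h3
  simp only [Matrix.cons_val] at h3
  norm_num at h3

theorem irreducibleComponents_reducibleLocus :
    {Y | IsIrreducibleComponent reducibleLocus Y} = {XTR, XPR} ∧ XTR ≠ XPR := by
  rw [reducibleLocus_eq]
  exact ⟨irreducibleComponents_union isClosed_XTR isClosed_XPR isIrreducible_XTR
    isIrreducible_XPR not_XTR_subset_XPR not_XPR_subset_XTR,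
    fun h => not_XTR_subset_XPR h.subset⟩

theorem apply_eq_eval_of_mem_reducibleLocus {χ : KnotGroup → ℂ} (h : χ ∈ reducibleLocus)
    (γ : KnotGroup) : χ γ = eval (coords χ) (coordPoly γ) := by
  rw [reducibleLocus_eq, XTR_eq, XPR_eq] at h
  rcases h with ⟨q, rfl⟩ | ⟨p, hp, rfl⟩
  · exact charTR_eq_eval q γ
  · exact psi_apply_eq_eval hp γ

theorem isRegularMap_coords (Y : Set (KnotGroup → ℂ)) : IsRegularMap Y coords := fun j =>
  isRegularFunction_of_eq_eval (X (coordElement j)) fun χ _ => by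
    rw [coords_eq, eval_X]
    rfl

theorem isRegularMap_coordsY (Y : Set (KnotGroup → ℂ)) : IsRegularMap Y coordsY := by
  intro j
  refine isRegularFunction_of_eq_eval (X (![S, S⁻¹] j)) fun χ _ => ?_
  rw [eval_X]
  fin_cases j <;> rfl

theorem isRegularMap_charTR (Y : Set (Fin 2 → ℂ)) : IsRegularMap Y charTR := fun _ =>
  isRegularFunction_of_eq_eval _ fun _ _ => rfl

/-- The reducible character with given coordinates. -/
noncomputable def ofCoords (x : Fin 8 → ℂ) : KnotGroup → ℂ := fun γ => eval x (coordPoly γ)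

theorem ofCoords_coords {χ : KnotGroup → ℂ} (h : χ ∈ reducibleLocus) : ofCoords (coords χ) = χ := by
  funext γ
  rw [apply_eq_eval_of_mem_reducibleLocus h γ, ofCoords]

theorem isRegularMap_ofCoords (Y : Set (Fin 8 → ℂ)) : IsRegularMap Y ofCoords := fun γ =>
  isRegularFunction_of_eq_eval (coordPoly γ) fun _ _ => rfl

theorem isIsomorphismOn_coords :
    IsIsomorphismOn coords reducibleLocus (coords '' reducibleLocus) := by
  have hinv : Set.LeftInvOn ofCoords coords reducibleLocus := fun χ hχ => ofCoords_coords hχ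
  refine isIsomorphismOn_of_inverse (isRegularMap_coords _) (isRegularMap_ofCoords _)
    (Set.mapsTo_image _ _) ?_ ⟨hinv, hinv.rightInvOn_image⟩
  rintro _ ⟨χ, hχ, rfl⟩
  rw [hinv hχ]
  exact hχ

theorem coordsY_charTR (q : Fin 2 → ℂ) : coordsY (charTR q) = q := by
  have h := coords_charTR q
  ext j
  fin_cases j
  · exact congrFun h 0
  · exact congrFun h 1

theorem isIsomorphismOn_coordsY_image (Z : Set (Fin 2 → ℂ)) :
    IsIsomorphismOn coordsY (charTR '' Z) Z := by
  refine isIsomorphismOn_of_inverse (isRegularMap_coordsY _) (isRegularMap_charTR _) ?_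
    (Set.mapsTo_image _ _) ⟨?_, fun q _ => coordsY_charTR q⟩
  · rintro _ ⟨q, hq, rfl⟩
    rwa [coordsY_charTR]
  · rintro _ ⟨q, hq, rfl⟩
    rw [coordsY_charTR]

theorem mem_planeTR_iff {x : Fin 8 → ℂ} : x ∈ planeTR ↔ x = coords (charTR ![x 0, x 1]) := by
  rw [coords_charTR]
  constructor
  · rintro ⟨h4, h5, h6, h7, h2, h3⟩
    ext i
    fin_cases i
    exacts [rfl, rfl, h2, h3, h4, h5, h6, h7]
  · intro h
    exact ⟨congrFun h 4, congrFun h 5, congrFun h 6, congrFun h 7, congrFun h 2, congrFun h 3⟩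

theorem coords_charTR_mem (q : Fin 2 → ℂ) : coords (charTR q) ∈ planeTR ∧
    (![coords (charTR q) 0, coords (charTR q) 1] : Fin 2 → ℂ) = q := by
  have h : (![coords (charTR q) 0, coords (charTR q) 1] : Fin 2 → ℂ) = q := by
    rw [coords_charTR]
    ext j
    fin_cases j <;> rfl
  exact ⟨mem_planeTR_iff.2 (by rw [h]), h⟩

theorem coords_image_XTR : coords '' XTR = planeTR := by
  rw [XTR_eq]
  ext x
  constructor
  · rintro ⟨_, ⟨q, rfl⟩, rfl⟩
    exact (coords_charTR_mem q).1
  · intro hx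
    exact ⟨_, ⟨_, rfl⟩, (mem_planeTR_iff.1 hx).symm⟩

theorem inter_eq : XTR ∩ XPR = charTR '' planeCurve := by
  rw [XTR_eq, XPR_eq]
  ext χ
  constructor
  · rintro ⟨⟨q, rfl⟩, p, hp, hpq⟩
    refine ⟨q, ?_, rfl⟩
    have h3 := eigenvaluePairPoly_Phi hp
    rw [← coords_psi hp, hpq, coords_charTR, eigenvaluePairPoly] at h3
    simp only [Matrix.cons_val] at h3
    change _ = _
    linear_combination h3
  · rintro ⟨q, hq, rfl⟩
    obtain ⟨p, hp, -, hpq⟩ := exists_of_mem_planeCurve hq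
    rw [← coords_charTR] at hpq
    exact ⟨⟨q, rfl⟩, p, hp, (eq_psi_of_coords (charTR_eq_eval q) hp hpq).symm⟩

theorem coords_image_inter : coords '' (XTR ∩ XPR) =
    {x | x ∈ planeTR ∧ (![x 0, x 1] : Fin 2 → ℂ) ∈ planeCurve} := by
  rw [inter_eq]
  ext x
  constructor
  · rintro ⟨_, ⟨q, hq, rfl⟩, rfl⟩
    refine ⟨(coords_charTR_mem q).1, ?_⟩
    rwa [(coords_charTR_mem q).2]
  · rintro ⟨h1, h2⟩
    exact ⟨_, ⟨_, h2, rfl⟩, (mem_planeTR_iff.1 h1).symm⟩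

theorem nodes_subset_image_inter : nodes ⊆ coords '' (XTR ∩ XPR) := by
  rw [coords_image_inter]
  rintro _ ⟨ζ, hζ, rfl⟩
  have h1 : (mu3Act ζ ![4, 4, 8, 8, 3, 3, 3, 3]) =
      ![ζ * 4, ζ ^ 2 * 4, ζ ^ 2 * 8, ζ * 8, 3, 3, 3, 3] := rfl
  rw [h1]
  refine ⟨⟨rfl, rfl, rfl, rfl, ?_, ?_⟩, ?_⟩
  · simp only [Matrix.cons_val]
    ring
  · simp only [Matrix.cons_val]
    linear_combination -16 * ζ * hζ
  · change _ = _
    simp only [Matrix.cons_val]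
    linear_combination (64 * ζ ^ 3 - 64) * hζ

/-! ### The component in dimension two -/

/-- Reducible characters take the value 2 at a. So an irreducible set containing X₂ lies in X₂ or in
the closed set χ(a) = 2, and the latter misses the point of X₂ with x₁ = 0. -/
theorem isIrreducibleComponent_X2 : IsIrreducibleComponent charVarietyGL2 X2 := by
  have hirr : @IsIrreducible _ (zariskiTopology KnotGroup) X2 := by
    rw [X2_eq]
    exact isSurfaceFamily_chi.isIrreducible
  refine ⟨⟨?_, hirr⟩, fun Z ⟨hZ, hZ'⟩ hXZ => ?_⟩
  · rw [X2_eq]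
    rintro _ ⟨p, hp, rfl⟩
    obtain ⟨ρ, hρ⟩ := exists_hasParams hp
    exact ⟨ρ, hρ.character_eq.symm⟩
  · have hcl : IsClosed[zariskiTopology KnotGroup] X2 := isClosed_zariskiClosure _
    have hsub : Z ⊆ X2 ∪ {χ | eval χ (X a - C 2) = 0} := by
      intro χ hχ
      obtain ⟨ρ, rfl⟩ := hZ hχ
      by_cases hρ : IsReducible ρ
      · obtain ⟨l, m, h⟩ := exists_zpow_of_isReducible hρ
        have ha : expSum a = 0 := by simp [a]
        right
        change eval (character ρ) (X a - C 2) = 0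
        rw [map_sub, eval_X, eval_C, character, (h a).1, ha]
        norm_num
      · exact Or.inl (subset_zariskiClosure _ ⟨ρ, hρ, rfl⟩)
    refine (isIrreducible_subset_union hZ' hcl (isClosed_vanishing _) hsub).resolve_right ?_
    intro h
    have h1 : chi ![1, 1, 0] ∈ X2 := X2_eq ▸ ⟨_, surface_point_mem, rfl⟩
    have h2 := h (hXZ h1)
    change eval _ (X a - C 2) = 0 at h2
    rw [map_sub, eval_X, eval_C, (chi_commutators surface_point_mem).1] at h2
    simp only [Matrix.cons_val] at h2
    norm_num at h2

theorem isRegularMap_coordsGL2 (Y : Set (KnotGroup → ℂ)) : IsRegularMap Y coordsGL2 := by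
  intro j
  refine isRegularFunction_of_eq_eval (![X S, detPoly S, X a] j) fun χ _ => ?_
  fin_cases j
  · exact (eval_X S).symm
  · exact (eval_detPoly χ S).symm
  · exact (eval_X a).symm

theorem isRegularMap_chi : IsRegularMap surfaceP chi := by
  have h : IsRegularMap surfaceP
      (fun p => (![p 0, p 1, (p 1)⁻¹, p 1 * (p 2 + 1)] : Fin 4 → ℂ)) := by
    have h0 : ∀ i, IsRegularFunction surfaceP fun p => p i := fun i =>
      isRegularFunction_of_eq_eval (X i) fun p _ => (eval_X i).symm
    intro j
    fin_cases j
    · exact h0 0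
    · exact h0 1
    · exact (h0 1).inv fun p hp => hp.1
    · exact (h0 1).mul ((h0 2).add
        (isRegularFunction_of_eq_eval 1 fun p _ => (map_one (eval p)).symm))
  exact fun γ => h.eval (tracePoly γ)

theorem isIsomorphismOn_coordsGL2 : IsIsomorphismOn coordsGL2 X2 surfaceP := by
  rw [X2_eq]
  refine isIsomorphismOn_of_inverse (isRegularMap_coordsGL2 _) isRegularMap_chi ?_
    (Set.mapsTo_image _ _) ⟨?_, fun p hp => coordsGL2_chi hp⟩
  · rintro _ ⟨p, hp, rfl⟩
    rwa [coordsGL2_chi hp]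
  · rintro _ ⟨p, hp, rfl⟩
    rw [coordsGL2_chi hp]

theorem image_Phi_eq : (fun χ => Phi (coordsGL2 χ)) '' X2 = coords '' XPR := by
  rw [X2_eq, XPR_eq, Set.image_image, Set.image_image]
  exact Set.image_congr fun p hp => by rw [coordsGL2_chi hp, coords_psi hp]

/-! ### Injectivity of the parametrization outside the nodes -/

/-- Cramer's rule for the system z + ȳ = (α + 1)w + yw⁻¹, z̄ + y = ȳw + (α + 1)w⁻¹. This is a second
denominator for w, useful where β = 3. -/
theorem commutator_sub_mul {p : Fin 3 → ℂ} (hp : p ∈ surfaceP) :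
    ((Phi p 4 + 1) ^ 2 - Phi p 0 * Phi p 1) * p 1 =
        (Phi p 4 + 1) * (Phi p 2 + Phi p 1) - Phi p 0 * (Phi p 3 + Phi p 0) ∧
      ((Phi p 4 + 1) ^ 2 - Phi p 0 * Phi p 1) * (p 1)⁻¹ =
        (Phi p 4 + 1) * (Phi p 3 + Phi p 0) - Phi p 1 * (Phi p 2 + Phi p 1) := by
  have hu := mul_inv_cancel₀ (mem_surfaceP_iff.1 hp).1
  obtain ⟨e0, e1, e2, e3, e4, -⟩ := Phi_apply p
  rw [one_div] at e0
  rw [div_eq_mul_inv] at e1 e3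
  rw [one_div, ← inv_pow] at e2
  have h1 : Phi p 2 + Phi p 1 = (Phi p 4 + 1) * p 1 + Phi p 0 * (p 1)⁻¹ := by
    rw [e0, e1, e2, e4]; ring
  have h2 : Phi p 3 + Phi p 0 = Phi p 1 * p 1 + (Phi p 4 + 1) * (p 1)⁻¹ := by
    rw [e0, e1, e3, e4]
    linear_combination -p 0 * hu
  rw [h1, h2]
  constructor <;> ring

/-- Both denominators vanish only here: β = 3 gives α = 3, hence yȳ = 16, and the curve gives y³ +
ȳ³ = 128. So y³ is the double root 64 and ȳ = y²/4. -/
theorem mem_nodes_of {x : Fin 8 → ℂ} (hx : ∀ i, eval x (phiEquations i) = 0) (h6 : x 6 = 3)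
    (h01 : (x 4 + 1) ^ 2 - x 0 * x 1 = 0) : x ∈ nodes := by
  obtain ⟨h45, h67, h46, h1, h2, h3, h4, h5, hD⟩ := (phiEquations_iff x).1 hx
  have h8 : x 4 = 3 := by
    rw [h6] at h46
    linear_combination h46
  rw [h6, sub_self] at h4 h5
  have hf : x 1 ^ 2 - 2 * x 0 - x 3 = 0 :=
    (pow_eq_zero_iff two_ne_zero).1 (by linear_combination -h4)
  have he : x 0 ^ 2 - 2 * x 1 - x 2 = 0 :=
    (pow_eq_zero_iff two_ne_zero).1 (by linear_combination -h5)
  have h16 : x 0 * x 1 = 16 := by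
    rw [h8] at h01
    linear_combination -h01
  rw [eigenvaluePairPoly, h6, h8, h16] at hD
  have hsum : x 0 ^ 3 + x 1 ^ 3 = 128 := by linear_combination hD / 5
  have h64 : x 0 ^ 3 = 64 := by
    refine sub_eq_zero.1 ((pow_eq_zero_iff two_ne_zero).1 ?_)
    linear_combination x 0 ^ 3 * hsum - ((x 0 * x 1) ^ 2 + 16 * (x 0 * x 1) + 256) * h16
  have h1' : x 1 = x 0 ^ 2 / 4 := by
    linear_combination x 0 ^ 2 / 64 * h16 - x 1 / 64 * h64
  refine ⟨x 0 / 4, by linear_combination h64 / 64, ?_⟩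
  ext i
  fin_cases i <;> simp only [mu3Act, Fin.mk_one, Fin.zero_eta, Fin.reduceFinMk, Matrix.cons_val]
  · ring
  · linear_combination h1'
  · linear_combination -he - 2 * h1'
  · rw [h1'] at hf
    linear_combination -hf + x 0 / 16 * h64
  · exact h8
  · exact h45.symm.trans h8
  · exact h6
  · exact h67.symm.trans h6

/-- Outside the nodes, `w` and `w⁻¹` are locally fractions in the coordinates. -/
theorem exists_fraction {x : Fin 8 → ℂ} (hx : ∀ i, eval x (phiEquations i) = 0)
    (hnode : x ∉ nodes) :
    ∃ h g g' : MvPolynomial (Fin 8) ℂ, eval x h ≠ 0 ∧ ∀ p ∈ surfaceP,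
      eval (Phi p) h * p 1 = eval (Phi p) g ∧ eval (Phi p) h * (p 1)⁻¹ = eval (Phi p) g' := by
  by_cases h6 : x 6 = 3
  · refine ⟨(X 4 + 1) ^ 2 - X 0 * X 1, (X 4 + 1) * (X 2 + X 1) - X 0 * (X 3 + X 0),
      (X 4 + 1) * (X 3 + X 0) - X 1 * (X 2 + X 1), ?_, fun p hp => ?_⟩
    · simp only [map_sub, map_mul, map_pow, map_add, map_one, eval_X]
      exact fun h01 => hnode (mem_nodes_of hx h6 h01)
    · simp only [map_sub, map_mul, map_pow, map_add, map_one, eval_X]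
      exact commutator_sub_mul hp
  · refine ⟨X 6 - C 3, X 0 ^ 2 - C 2 * X 1 - X 2, X 1 ^ 2 - C 2 * X 0 - X 3, ?_, fun p hp => ?_⟩
    · simp only [map_sub, eval_X, eval_C]
      exact sub_ne_zero.2 h6
    · simp only [map_sub, map_mul, map_pow, eval_X, eval_C]
      exact ⟨beta_sub_mul_w hp, beta_sub_mul_u hp⟩

theorem eq_of_Phi_eq {p p' : Fin 3 → ℂ} (hp : p ∈ surfaceP) (hp' : p' ∈ surfaceP)
    (h : Phi p = Phi p') (hnode : Phi p ∉ nodes) : p = p' := by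
  obtain ⟨d, g, g', hd, hg⟩ := exists_fraction (eval_phiEquations hp) hnode
  have h1 : p 1 = p' 1 := by
    refine mul_left_cancel₀ hd ?_
    rw [(hg p hp).1, h, (hg p' hp').1]
  have h2 : p 2 = p' 2 := by
    have h4 := congrFun h 4
    rw [(Phi_apply p).2.2.2.2.1, (Phi_apply p').2.2.2.2.1] at h4
    exact add_right_cancel h4
  have h0 : p 0 = p' 0 := by
    have h4 := congrFun h 0
    rw [(Phi_apply p).1, (Phi_apply p').1, h1] at h4
    exact add_right_cancel h4
  ext i
  fin_cases i
  exacts [h0, h1, h2]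

theorem injective_outside_nodes : ∀ χ ∈ X2, ∀ χ' ∈ X2,
    Phi (coordsGL2 χ) = Phi (coordsGL2 χ') → χ = χ' ∨ Phi (coordsGL2 χ) ∈ nodes := by
  rw [X2_eq]
  rintro _ ⟨p, hp, rfl⟩ _ ⟨p', hp', rfl⟩ h
  rw [coordsGL2_chi hp] at h ⊢
  rw [coordsGL2_chi hp'] at h
  by_cases hnode : Phi p ∈ nodes
  · exact Or.inr hnode
  · exact Or.inl (by rw [eq_of_Phi_eq hp hp' h hnode])

/-! ### The dimension of the component of partially reducible characters -/

theorem isIntegral_eval {R A σ : Type*} [CommRing R] [CommRing A] [Algebra R A] [Algebra ℂ A]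
    (hC : ∀ c : ℂ, IsIntegral R (algebraMap ℂ A c)) {x : σ → A} (hx : ∀ i, IsIntegral R (x i))
    (f : MvPolynomial σ ℂ) : IsIntegral R (aeval x f) := by
  induction f using MvPolynomial.induction_on with
  | C c => simpa using hC c
  | add p q hp hq => simpa using hp.add hq
  | mul_X p j hp => simpa using hp.mul (hx j)

theorem aeval_pi_apply {σ ι : Type*} (x : ι → σ → ℂ) (f : MvPolynomial σ ℂ) (p : ι) :
    aeval (fun i p => x p i) f p = eval (x p) f := by
  induction f using MvPolynomial.induction_on with
  | C c => simp
  | add f g hf hg => simp only [map_add, Pi.add_apply, hf, hg]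
  | mul_X f i hf => simp only [map_mul, Pi.mul_apply, hf, aeval_X, eval_X]

/-- The functions on the surface that are given by polynomials in the values of `psi`. -/
noncomputable def psiEval : MvPolynomial KnotGroup ℂ →+* (surfaceP → ℂ) :=
  (aeval fun γ (p : surfaceP) => psi p γ : MvPolynomial KnotGroup ℂ →ₐ[ℂ] (surfaceP → ℂ)).toRingHom

theorem psiEval_apply (f : MvPolynomial KnotGroup ℂ) (p : surfaceP) :
    psiEval f p = eval (psi p) f :=
  aeval_pi_apply (fun p : surfaceP => psi p) f p

theorem mem_idealOf_XPR {f : MvPolynomial KnotGroup ℂ} : f ∈ idealOf XPR ↔ psiEval f = 0 := by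
  rw [mem_idealOf, XPR_eq]
  constructor
  · exact fun h => funext fun p => (psiEval_apply f p).trans (h _ ⟨p, p.2, rfl⟩)
  · rintro h _ ⟨p, hp, rfl⟩
    rw [← psiEval_apply f ⟨p, hp⟩, h]
    rfl

/-- The projection to the plane with coordinates `α + β` and `y + ȳ`. -/
noncomputable def planeProjection : MvPolynomial (Fin 2) ℂ →+* MvPolynomial KnotGroup ℂ :=
  (aeval ![X (coordElement 4) + X (coordElement 6), X (coordElement 0) + X (coordElement 1)] :
    MvPolynomial (Fin 2) ℂ →ₐ[ℂ] MvPolynomial KnotGroup ℂ).toRingHom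

theorem eval_psi_coordElement {p : Fin 3 → ℂ} (hp : p ∈ surfaceP) (i : Fin 8) :
    psi p (coordElement i) = Phi p i := by
  rw [← coords_psi hp, coords_eq]
  rfl

theorem psiEval_planeProjection (p : surfaceP) :
    psiEval (planeProjection (X 0)) p = Phi p 4 + Phi p 6 ∧
    psiEval (planeProjection (X 1)) p = Phi p 0 + Phi p 1 := by
  constructor
  · rw [psiEval_apply]
    simp [planeProjection, eval_psi_coordElement p.2]
  · rw [psiEval_apply]
    simp [planeProjection, eval_psi_coordElement p.2]

/-- Squaring qw − 1 − w² = v(w + 1) and using v² = (t − 1)w eliminates v. The quartic is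
palindromic, so w⁻¹ is a root as well and is integral too. -/
theorem w_quartic {p : Fin 3 → ℂ} (hp : p ∈ surfaceP) {t q : ℂ} (ht : t = Phi p 4 + Phi p 6)
    (hq : q = Phi p 0 + Phi p 1) :
    p 1 ^ 4 - (2 * q + t - 1) * p 1 ^ 3 + (q ^ 2 + 4 - 2 * t) * p 1 ^ 2 -
      (2 * q + t - 1) * p 1 + 1 = 0 := by
  have hu := mul_inv_cancel₀ (mem_surfaceP_iff.1 hp).1
  have hsq := sq_eq hp
  obtain ⟨e0, e1, -⟩ := Phi_apply p
  rw [one_div] at e0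
  rw [div_eq_mul_inv] at e1
  rw [← ht] at hsq
  have h1 : q * p 1 - 1 - p 1 ^ 2 = p 0 * (p 1 + 1) := by
    rw [hq, e0, e1]
    linear_combination (p 0 + 1) * hu
  linear_combination (q * p 1 - 1 - p 1 ^ 2 + p 0 * (p 1 + 1)) * h1 + (p 1 + 1) ^ 2 * hsq

theorem x_quadratic {p : Fin 3 → ℂ} (hp : p ∈ surfaceP) {t : ℂ} (ht : t = Phi p 4 + Phi p 6) :
    p 2 ^ 2 + (2 - t) * p 2 + (t - 2) = 0 ∧ (p 2 - 1)⁻¹ = t - p 2 - 3 := by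
  have h1 := Phi_alpha_beta hp
  have e4 := (Phi_apply p).2.2.2.2.1
  have e6 : Phi p 6 = t - p 2 - 1 := by rw [ht, e4]; ring
  rw [e4, e6] at h1
  refine ⟨by linear_combination -h1, ?_⟩
  exact inv_eq_of_mul_eq_one_right (by linear_combination h1)

/-- The functions v, w, w⁻¹, x₁ and (x₁ − 1)⁻¹ are integral over ℂ[α + β, y + ȳ], and all values of
`psi` are polynomials in them. -/
theorem exists_integral_equation (g : MvPolynomial KnotGroup ℂ) :
    ∃ P : Polynomial (MvPolynomial (Fin 2) ℂ), P.Monic ∧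
      P.eval₂ planeProjection g ∈ idealOf XPR := by
  -- Integrality is tested in the ring of all functions on the surface; the kernel of `psiEval` is
  -- the ideal of X_PR.
  let _ : Algebra (MvPolynomial (Fin 2) ℂ) (surfaceP → ℂ) := (psiEval.comp planeProjection).toAlgebra
  have hmap : ∀ f : MvPolynomial (Fin 2) ℂ, algebraMap (MvPolynomial (Fin 2) ℂ) (surfaceP → ℂ) f = psiEval (planeProjection f) := fun _ => rfl
  have ht : ∀ p : surfaceP, psiEval (planeProjection (X 0)) p = Phi p 4 + Phi p 6 :=
    fun p => (psiEval_planeProjection p).1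
  have hq : ∀ p : surfaceP, psiEval (planeProjection (X 1)) p = Phi p 0 + Phi p 1 :=
    fun p => (psiEval_planeProjection p).2
  have hC : ∀ c : ℂ, IsIntegral (MvPolynomial (Fin 2) ℂ) (algebraMap ℂ (surfaceP → ℂ) c) := by
    intro c
    have : algebraMap ℂ (surfaceP → ℂ) c = algebraMap (MvPolynomial (Fin 2) ℂ) (surfaceP → ℂ) (C c) := by
      ext p
      rw [hmap, psiEval_apply]
      simp [planeProjection]
    rw [this]
    exact isIntegral_algebraMap
  have n2 : ∀ p, psiEval (planeProjection 2) p = 2 := fun p => by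
    rw [map_ofNat planeProjection 2, map_ofNat psiEval 2]
    rfl
  have n3 : ∀ p, psiEval (planeProjection 3) p = 3 := fun p => by
    rw [map_ofNat planeProjection 3, map_ofNat psiEval 3]
    rfl
  have n4 : ∀ p, psiEval (planeProjection 4) p = 4 := fun p => by
    rw [map_ofNat planeProjection 4, map_ofNat psiEval 4]
    rfl
  have quartic : ∀ x : surfaceP → ℂ, (∀ p : surfaceP,
      x p ^ 4 - (2 * (Phi p 0 + Phi p 1) + (Phi p 4 + Phi p 6) - 1) * x p ^ 3 +
        ((Phi p 0 + Phi p 1) ^ 2 + 4 - 2 * (Phi p 4 + Phi p 6)) * x p ^ 2 -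
        (2 * (Phi p 0 + Phi p 1) + (Phi p 4 + Phi p 6) - 1) * x p + 1 = 0) → IsIntegral (MvPolynomial (Fin 2) ℂ) x := by
    intro x hx
    refine ⟨Polynomial.X ^ 4 - Polynomial.C (2 * X 1 + X 0 - 1) * Polynomial.X ^ 3 +
      Polynomial.C (X 1 ^ 2 + 4 - 2 * X 0) * Polynomial.X ^ 2 -
      Polynomial.C (2 * X 1 + X 0 - 1) * Polynomial.X + 1, by monicity!, ?_⟩
    ext p
    have h := hx p
    rw [← ht, ← hq] at h
    simpa [hmap, n2, n4] using h
  have hw : IsIntegral (MvPolynomial (Fin 2) ℂ) (fun p : surfaceP => p.1 1) :=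
    quartic _ fun p => w_quartic p.2 rfl rfl
  have hu : IsIntegral (MvPolynomial (Fin 2) ℂ) (fun p : surfaceP => (p.1 1)⁻¹) := by
    refine quartic _ fun p => ?_
    have h := w_quartic p.2 rfl rfl
    have h0 := mul_inv_cancel₀ (mem_surfaceP_iff.1 p.2).1
    set u := (p.1 1)⁻¹
    have h2 := mul_eq_zero_of_right (u ^ 4) h
    have e : ∀ k, p.1 1 ^ k * u ^ k = 1 := fun k => by rw [← mul_pow, h0, one_pow]
    have e1 := e 1
    have e2 := e 2
    have e3 := e 3
    have e4 := e 4
    linear_combination h2 - e4 + (2 * (Phi p 0 + Phi p 1) + (Phi p 4 + Phi p 6) - 1) * u * e3 -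
      ((Phi p 0 + Phi p 1) ^ 2 + 4 - 2 * (Phi p 4 + Phi p 6)) * u ^ 2 * e2 +
      (2 * (Phi p 0 + Phi p 1) + (Phi p 4 + Phi p 6) - 1) * u ^ 3 * e1
  have hx : IsIntegral (MvPolynomial (Fin 2) ℂ) (fun p : surfaceP => p.1 2) := by
    refine ⟨Polynomial.X ^ 2 + Polynomial.C (2 - X 0) * Polynomial.X + Polynomial.C (X 0 - 2),
      by monicity!, ?_⟩
    ext p
    simpa [hmap, n2] using (x_quadratic p.2 (ht p)).1
  have hr : IsIntegral (MvPolynomial (Fin 2) ℂ) (fun p : surfaceP => (p.1 2 - 1)⁻¹) := by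
    have h3 : IsIntegral (MvPolynomial (Fin 2) ℂ) (algebraMap (MvPolynomial (Fin 2) ℂ) (surfaceP → ℂ) (X 0 - 3)) := isIntegral_algebraMap
    refine (congrArg (IsIntegral (MvPolynomial (Fin 2) ℂ)) (_root_.funext fun p => ?_)).mpr (h3.sub hx)
    rw [(x_quadratic p.2 (ht p)).2, hmap]
    simp only [Pi.sub_apply, map_sub, n3]
    ring
  have hv : IsIntegral (MvPolynomial (Fin 2) ℂ) (fun p : surfaceP => p.1 0) := by
    have h3 : IsIntegral (MvPolynomial (Fin 2) ℂ) (algebraMap (MvPolynomial (Fin 2) ℂ) (surfaceP → ℂ) (X 0 - 1)) := isIntegral_algebraMap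
    refine IsIntegral.of_pow (n := 2) (by norm_num) ?_
    refine (congrArg (IsIntegral (MvPolynomial (Fin 2) ℂ)) (_root_.funext fun p => ?_)).mpr (h3.mul hw)
    have h4 := sq_eq p.2
    rw [← ht p] at h4
    simpa [hmap] using h4
  have hfun : ∀ i, IsIntegral (MvPolynomial (Fin 2) ℂ) (fun p : surfaceP => surfaceFunctions p.1 i) := by
    intro i
    fin_cases i
    exacts [hv, hw, hu, hx, hr]
  have hγ : ∀ γ, IsIntegral (MvPolynomial (Fin 2) ℂ) (fun p : surfaceP => psi p γ) := by
    intro γ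
    obtain ⟨Q, hQ⟩ := isSurfaceFamily_psi γ
    refine (congrArg (IsIntegral (MvPolynomial (Fin 2) ℂ)) (_root_.funext fun p => ?_)).mpr
      (isIntegral_eval hC hfun Q)
    exact (hQ p p.2).trans (aeval_pi_apply (fun p : surfaceP => surfaceFunctions p) Q p).symm
  obtain ⟨P, hP, hPg⟩ := isIntegral_eval hC hγ g
  refine ⟨P, hP, mem_idealOf_XPR.2 ?_⟩
  rw [Polynomial.hom_eval₂]
  exact hPg

theorem zariskiDim_XPR_le : zariskiDim XPR ≤ 2 :=
  zariskiDim_le_of_integral planeProjection exists_integral_equation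

/-! ### The lower bound for the dimension -/

theorem isClosed_singleton_zariski {σ : Type} (x : σ → ℂ) :
    IsClosed[zariskiTopology σ] {x} := by
  refine isClosed_of_forall fun y hy => funext fun i => ?_
  have := hy (X i - C (x i)) (by rintro _ rfl; simp)
  rwa [map_sub, eval_X, eval_C, sub_eq_zero] at this

theorem line_mem_surfaceP {r w : ℂ} (hr : r ^ 2 + r - 1 = 0) (hw : w ≠ 0) :
    (![0, w, r] : Fin 3 → ℂ) ∈ surfaceP := by
  refine mem_surfaceP_iff.2 ⟨hw, ?_, ?_⟩ <;> simp only [Matrix.cons_val]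
  · rintro rfl
    norm_num at hr
  · rw [hr]
    ring

theorem isIrreducible_image_line {r : ℂ} (hr : r ^ 2 + r - 1 = 0) :
    @IsIrreducible _ (zariskiTopology KnotGroup) ((fun w => psi ![0, w, r]) '' {w : ℂ | w ≠ 0}) := by
  choose Q hQ using isSurfaceFamily_psi
  have h := isIrreducible_image_nonvanishing (X 0 : MvPolynomial (Fin 1) ℂ) (X_ne_zero 0)
    (fun q γ => eval (surfaceFunctions ![0, q 0, r]) (Q γ)) fun γ => by
      refine isFraction_comp (fun i => ?_) _
      have hc : ∀ c : ℂ, IsFraction (X 0 : MvPolynomial (Fin 1) ℂ) fun _ => c := fun c => by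
        simpa using isFraction_eval (X 0 : MvPolynomial (Fin 1) ℂ) (C c)
      have h0 := isFraction_eval (X 0 : MvPolynomial (Fin 1) ℂ) (X 0)
      have h1 := isFraction_inv (dvd_refl (X 0 : MvPolynomial (Fin 1) ℂ))
      simp only [eval_X] at h0 h1
      fin_cases i
      · exact hc 0
      · exact h0
      · exact h1
      · exact hc r
      · exact hc (r - 1)⁻¹
  convert h
  ext χ
  constructor
  · rintro ⟨w, hw, rfl⟩
    exact ⟨![w], by simpa using hw, funext fun γ => (hQ γ _ (line_mem_surfaceP hr hw)).symm⟩
  · rintro ⟨q, hq, rfl⟩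
    rw [Set.mem_ofPred_eq, eval_X] at hq
    exact ⟨q 0, hq, funext fun γ => hQ γ _ (line_mem_surfaceP hr hq)⟩

theorem two_le_zariskiDim_XPR : 2 ≤ zariskiDim XPR := by
  obtain ⟨m, n, h1, h2⟩ := exists_add_mul (-1) (-1)
  have hr : m ^ 2 + m - 1 = 0 := by linear_combination m * h1 - h2
  have hirr := isIrreducible_image_line hr
  have hmem : ∀ w : ℂ, w ≠ 0 → psi ![0, w, m] ∈
      zariskiClosure ((fun w => psi ![0, w, m]) '' {w : ℂ | w ≠ 0}) := fun w hw =>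
    subset_zariskiClosure _ ⟨w, hw, rfl⟩
  -- The chain is a point, the closure of the curve v = 0, x₁ = m with m² + m = 1, and X_PR. The
  -- points w = 1, 2 differ in y = w⁻¹. The value α = m + 1 is constant on the curve, whereas α = 1
  -- at the image of (1, 1, 0).
  refine two_le_zariskiDim (Z := {psi ![0, 1, m]})
    (@isIrreducible_singleton _ (zariskiTopology KnotGroup) _) (isIrreducible_zariskiClosure hirr)
    isIrreducible_XPR (isClosed_singleton_zariski _) (isClosed_zariskiClosure _)
    ⟨Set.singleton_subset_iff.2 (hmem 1 one_ne_zero), fun h => ?_⟩ ⟨?_, fun h => ?_⟩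
  · have h3 : psi ![0, 2, m] = psi ![0, 1, m] := h (hmem 2 two_ne_zero)
    have h4 := congrFun (congrArg coords h3) 0
    rw [coords_psi (line_mem_surfaceP hr two_ne_zero),
      coords_psi (line_mem_surfaceP hr one_ne_zero), (Phi_apply _).1, (Phi_apply _).1] at h4
    simp only [Matrix.cons_val] at h4
    norm_num at h4
  · refine (@IsClosed.closure_subset_iff _ (zariskiTopology KnotGroup) _ _ isClosed_XPR).2 ?_
    rintro _ ⟨w, hw, rfl⟩
    exact psi_mem_XPR (line_mem_surfaceP hr hw)
  · have h3 := eval_coords_of_mem_zariskiClosure (h (psi_mem_XPR surface_point_mem))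
      (f := X 4 - C (m + 1)) (by
        rintro _ ⟨w, hw, rfl⟩
        rw [map_sub, eval_X, eval_C, coords_psi (line_mem_surfaceP hr hw),
          (Phi_apply _).2.2.2.2.1]
        exact sub_self _)
    rw [map_sub, eval_X, eval_C, coords_psi surface_point_mem, (Phi_apply _).2.2.2.2.1] at h3
    simp only [Matrix.cons_val] at h3
    have h4 : m = 0 := by linear_combination -h3
    rw [h4] at hr
    norm_num at hr

theorem zariskiDim_XPR : zariskiDim XPR = 2 := le_antisymm zariskiDim_XPR_le two_le_zariskiDim_XPR

/-! ### Tangent vectors of the component of partially reducible characters -/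

theorem differential_rename {σ τ : Type} (k : σ → τ) (x d : τ → ℂ) (f : MvPolynomial σ ℂ) :
    differential x d (rename k f) = differential (x ∘ k) (d ∘ k) f := by
  induction f using MvPolynomial.induction_on with
  | C c => simp
  | add f g hf hg => simp only [map_add, differential_add, hf, hg]
  | mul_X f i hf =>
    simp only [map_mul, rename_X, differential_mul, hf, differential_X, eval_X, eval_rename,
      Function.comp_apply]

theorem differential_coords_eq_zero {p : Fin 3 → ℂ} (hp : p ∈ surfaceP) {e : KnotGroup → ℂ}
    (he : e ∈ tangentSpace XPR (psi p)) {f : MvPolynomial (Fin 8) ℂ}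
    (hf : ∀ p' ∈ surfaceP, eval (Phi p') f = 0) : differential (Phi p) (coords e) f = 0 := by
  rw [← coords_psi hp, coords_eq, coords_eq, ← differential_rename]
  refine mem_tangentSpace_iff.1 he _ fun χ hχ => ?_
  rw [XPR_eq] at hχ
  obtain ⟨p', hp', rfl⟩ := hχ
  rw [eval_rename_coordElement, coords_psi hp', hf p' hp']

/-- On X_PR every value is a polynomial in the eight coordinates, so a tangent vector is determined
by its eight components. -/
theorem eq_zero_of_coords_eq_zero {p : Fin 3 → ℂ} {e : KnotGroup → ℂ}
    (he : e ∈ tangentSpace XPR (psi p)) (h0 : coords e = 0) : e = 0 := by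
  funext γ
  have h := mem_tangentSpace_iff.1 he (X γ - rename coordElement (coordPoly γ)) fun χ hχ => by
    rw [XPR_eq] at hχ
    obtain ⟨p', hp', rfl⟩ := hχ
    rw [map_sub, eval_X, eval_rename_coordElement, ← psi_apply_eq_eval hp', sub_self]
  rw [differential_sub, differential_X, differential_rename, ← coords_eq, ← coords_eq, h0,
    sub_eq_zero] at h
  rw [h]
  simp [differential]

/-- The velocity of the image of a curve in the surface. -/
theorem exists_tangent {c : ℂ → Fin 3 → ℂ} {p d : Fin 3 → ℂ} (hc0 : c 0 = p)
    (hd : ∀ i, HasDerivAt (fun t => c t i) (d i) 0) (hP : ∀ᶠ t in 𝓝 0, c t ∈ surfaceP) :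
    ∃ e ∈ tangentSpace XPR (psi p), coords e 0 = d 0 - d 1 * (p 1)⁻¹ ^ 2 ∧
      coords e 1 = d 1 + d 0 * (p 1)⁻¹ - p 0 * d 1 * (p 1)⁻¹ ^ 2 ∧ coords e 4 = d 2 ∧
      ∀ h g : MvPolynomial (Fin 8) ℂ,
        (∀ p' ∈ surfaceP, eval (Phi p') h * p' 1 = eval (Phi p') g) →
        differential (Phi p) (coords e) h * p 1 + eval (Phi p) h * d 1 =
          differential (Phi p) (coords e) g := by
  subst hc0
  have hp : c 0 ∈ surfaceP := hP.self_of_nhds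
  obtain ⟨h0, h1, -⟩ := mem_surfaceP_iff.1 hp
  have hsf : ∀ i, HasDerivAt (fun t => surfaceFunctions (c t) i)
      ((![d 0, d 1, -d 1 / c 0 1 ^ 2, d 2, -d 2 / (c 0 2 - 1) ^ 2] : Fin 5 → ℂ) i) 0 := by
    intro i
    fin_cases i
    · exact hd 0
    · exact hd 1
    · exact (hd 1).fun_inv h0
    · exact hd 2
    · exact ((hd 2).sub_const 1).fun_inv (sub_ne_zero.2 h1)
  choose Q hQ using isSurfaceFamily_psi
  have hψ : ∀ γ, HasDerivAt (fun t => psi (c t) γ) (differential (surfaceFunctions (c 0))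
      ![d 0, d 1, -d 1 / c 0 1 ^ 2, d 2, -d 2 / (c 0 2 - 1) ^ 2] (Q γ)) 0 := by
    intro γ
    refine (hasDerivAt_eval hsf (Q γ)).congr_of_eventuallyEq ?_
    filter_upwards [hP] with t ht using hQ γ _ ht
  set e : KnotGroup → ℂ := fun γ => differential (surfaceFunctions (c 0))
    ![d 0, d 1, -d 1 / c 0 1 ^ 2, d 2, -d 2 / (c 0 2 - 1) ^ 2] (Q γ)
  have hΦ : ∀ i, HasDerivAt (fun t => Phi (c t) i) (coords e i) 0 := by
    intro i
    rw [coords_eq]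
    refine (hψ (coordElement i)).congr_of_eventuallyEq ?_
    filter_upwards [hP] with t ht using (eval_psi_coordElement ht i).symm
  have hinv := (hd 1).fun_inv h0
  refine ⟨e, mem_tangentSpace_of_hasDerivAt (c := fun t => psi (c t)) hψ ?_, ?_, ?_, ?_, ?_⟩
  · filter_upwards [hP] with t ht using psi_mem_XPR ht
  · refine (hΦ 0).unique ?_
    have h := (hd 0).fun_add hinv
    refine (h.congr_deriv ?_).congr_of_eventuallyEq (.of_forall fun t => ?_)
    · field_simp
      ring
    · dsimp only
      rw [← one_div]
      exact (Phi_apply _).1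
  · refine (hΦ 1).unique ?_
    have h := (hd 1).fun_add ((hd 0).fun_mul hinv)
    refine (h.congr_deriv ?_).congr_of_eventuallyEq (.of_forall fun t => ?_)
    · field_simp
      ring
    · dsimp only
      rw [← div_eq_mul_inv]
      exact (Phi_apply _).2.1
  · refine (hΦ 4).unique ?_
    exact ((hd 2).add_const 1).congr_of_eventuallyEq (.of_forall fun t =>
      (Phi_apply _).2.2.2.2.1)
  · intro h g hhg
    refine HasDerivAt.unique ((hasDerivAt_eval hΦ h).fun_mul (hd 1)) ?_
    refine (hasDerivAt_eval hΦ g).congr_of_eventuallyEq ?_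
    filter_upwards [hP] with t ht using hhg _ ht

section Relations

variable {p : Fin 3 → ℂ} {h g g' : MvPolynomial (Fin 8) ℂ}

/-- Relations between the coordinates and fractions `g / h`, `g' / h` that represent `w`, `w⁻¹`. -/
theorem fraction_relations (hg : ∀ p ∈ surfaceP,
      eval (Phi p) h * p 1 = eval (Phi p) g ∧ eval (Phi p) h * (p 1)⁻¹ = eval (Phi p) g') :
    ∀ p ∈ surfaceP, eval (Phi p) (g * g' - h * h) = 0 ∧
      eval (Phi p) ((h * X 0 - g') * (h * X 0 - g') - (X 4 + X 6 - 1) * (g * h)) = 0 ∧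
      eval (Phi p) (h * h * X 1 - g * h - (h * X 0 - g') * g') = 0 ∧
      eval (Phi p) (h * h * X 2 - X 4 * (g * h) - g' * g') = 0 ∧
      eval (Phi p) (h * h * X 3 - X 4 * (g' * h) - g * g) = 0 ∧
      eval (Phi p) ((X 4 - C 2) * (X 6 - C 2) - 1) = 0 ∧
      eval (Phi p) (X 4 - X 5) = 0 ∧ eval (Phi p) (X 6 - X 7) = 0 := by
  intro p hp
  have hu := mul_inv_cancel₀ (mem_surfaceP_iff.1 hp).1
  obtain ⟨e0, e1, e2, e3, e4, e5, e6, e7⟩ := Phi_apply p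
  rw [one_div] at e0
  rw [div_eq_mul_inv] at e1 e3
  rw [one_div, ← inv_pow] at e2
  have hsq := sq_eq hp
  simp only [map_sub, map_mul, map_add, map_one, eval_X, eval_C, ← (hg p hp).1,
    ← (hg p hp).2]
  refine ⟨?_, ?_, ?_, ?_, ?_, ?_, ?_, ?_⟩
  · linear_combination eval (Phi p) h ^ 2 * hu
  · linear_combination eval (Phi p) h ^ 2 *
      (hsq + (Phi p 0 - (p 1)⁻¹ + p 0) * e0)
  · linear_combination eval (Phi p) h ^ 2 * (e1 - (p 1)⁻¹ * e0)
  · linear_combination eval (Phi p) h ^ 2 * (e2 - p 1 * e4)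
  · linear_combination eval (Phi p) h ^ 2 * (e3 - (p 1)⁻¹ * e4)
  · rw [Phi_alpha_beta hp, sub_self]
  · rw [e4, e5, sub_self]
  · rw [e6, e7, sub_self]

/-- The variation of the parameters `(v, w, x₁)` along a tangent vector, computed from fractions
that represent `w` and `w⁻¹`. -/
noncomputable def paramVariation (p : Fin 3 → ℂ) (h g : MvPolynomial (Fin 8) ℂ) :
    (KnotGroup → ℂ) →ₗ[ℂ] (Fin 3 → ℂ) where
  toFun e :=
    ![coords e 0 + (p 1)⁻¹ ^ 2 * ((differential (Phi p) (coords e) g -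
        p 1 * differential (Phi p) (coords e) h) / eval (Phi p) h),
      (differential (Phi p) (coords e) g - p 1 * differential (Phi p) (coords e) h) /
        eval (Phi p) h, coords e 4]
  map_add' e e' := by
    have hc : coords (e + e') = coords e + coords e' := by simp only [coords_eq]; rfl
    ext i
    fin_cases i <;> simp [hc, differential_add_right] <;> ring
  map_smul' c e := by
    have hc : coords (c • e) = c • coords e := by simp only [coords_eq]; rfl
    ext i
    fin_cases i <;> simp [hc, differential_smul_right] <;> ring

/-- Differentiating the relations for the fractions w = g/h, w⁻¹ = g'/h gives the linearized surface
equation for (dv, dw, dx₁). If these vanish, the same relations kill all eight coordinates of e. -/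
theorem paramVariation_relations (hp : p ∈ surfaceP) (hh : eval (Phi p) h ≠ 0)
    (hg : ∀ p ∈ surfaceP,
      eval (Phi p) h * p 1 = eval (Phi p) g ∧ eval (Phi p) h * (p 1)⁻¹ = eval (Phi p) g')
    {e : KnotGroup → ℂ} (he : e ∈ tangentSpace XPR (psi p)) :
    2 * p 0 * paramVariation p h g e 0 = p 1 * (1 - (Phi p 6 - 2) ^ 2) * paramVariation p h g e 2 +
        (Phi p 4 + Phi p 6 - 1) * paramVariation p h g e 1 ∧
      (paramVariation p h g e = 0 → e = 0) := by
  have hrel := fraction_relations hg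
  have r1 := differential_coords_eq_zero hp he fun p' hp' => (hrel p' hp').1
  have r2 := differential_coords_eq_zero hp he fun p' hp' => (hrel p' hp').2.1
  have r3 := differential_coords_eq_zero hp he fun p' hp' => (hrel p' hp').2.2.1
  have r4 := differential_coords_eq_zero hp he fun p' hp' => (hrel p' hp').2.2.2.1
  have r5 := differential_coords_eq_zero hp he fun p' hp' => (hrel p' hp').2.2.2.2.1
  have r6 := differential_coords_eq_zero hp he fun p' hp' => (hrel p' hp').2.2.2.2.2.1
  have r7 := differential_coords_eq_zero hp he fun p' hp' => (hrel p' hp').2.2.2.2.2.2.1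
  have r8 := differential_coords_eq_zero hp he fun p' hp' => (hrel p' hp').2.2.2.2.2.2.2
  clear hrel
  simp only [differential_sub, differential_mul, differential_add, differential_X,
    differential_one, differential_C, map_sub, map_mul, map_add, map_one, eval_X, eval_C,
    ← (hg p hp).1, ← (hg p hp).2] at r1 r2 r3 r4 r5 r6 r7 r8
  have hu := mul_inv_cancel₀ (mem_surfaceP_iff.1 hp).1
  obtain ⟨e0, e1, e2, e3, e4, -⟩ := Phi_apply p
  rw [one_div] at e0
  rw [div_eq_mul_inv] at e1 e3
  rw [one_div, ← inv_pow] at e2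
  have hsq := sq_eq hp
  have hαβ := Phi_alpha_beta hp
  obtain ⟨dw, hdw⟩ : ∃ dw, (differential (Phi p) (coords e) g -
      p 1 * differential (Phi p) (coords e) h) / eval (Phi p) h = dw := ⟨_, rfl⟩
  obtain ⟨du, hdu⟩ : ∃ du, (differential (Phi p) (coords e) g' -
      (p 1)⁻¹ * differential (Phi p) (coords e) h) / eval (Phi p) h = du := ⟨_, rfl⟩
  have hv : paramVariation p h g e =
      ![coords e 0 + (p 1)⁻¹ ^ 2 * dw, dw, coords e 4] := by
    rw [← hdw]
    rfl
  rw [div_eq_iff hh, sub_eq_iff_eq_add] at hdw hdu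
  rw [hdw, hdu] at r1
  rw [hdw, hdu] at r2
  rw [hdw, hdu] at r3
  rw [hdu, hdw] at r4
  rw [hdw, hdu] at r5
  rw [hv]
  clear hdw hdu hv hg
  simp only [Matrix.cons_val]
  set H := eval (Phi p) h
  set Dh := differential (Phi p) (coords e) h
  set u := (p 1)⁻¹
  set w := p 1
  set v := p 0
  have hH := pow_ne_zero 2 hh
  -- The differential of w⁻¹, obtained from gg' = h².
  have hduw : du = -u ^ 2 * dw := by
    refine mul_left_cancel₀ hH ?_
    linear_combination u * r1 + (-2 * Dh * H * u - H ^ 2 * du) * hu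
  -- Differentiating (α − 2)(β − 2) = 1.
  have h6 : coords e 6 = -(Phi p 6 - 2) ^ 2 * coords e 4 := by
    linear_combination (Phi p 6 - 2) * r6 - coords e 6 * hαβ
  have hplane : 2 * v * (coords e 0 - du) =
      w * (coords e 4 + coords e 6) + (Phi p 4 + Phi p 6 - 1) * dw := by
    refine mul_left_cancel₀ hH ?_
    rw [e0] at r2
    linear_combination r2 - 2 * H * Dh * hsq
  refine ⟨by rw [hduw, h6] at hplane; linear_combination hplane, fun h0 => ?_⟩
  have hw0 : dw = 0 := congrFun h0 1
  have h4 : coords e 4 = 0 := congrFun h0 2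
  have hu0 : du = 0 := by rw [hduw, hw0, mul_zero]
  have hv0 : coords e 0 + u ^ 2 * dw = 0 := congrFun h0 0
  rw [hw0, mul_zero, add_zero] at hv0
  rw [hw0, hu0, hv0] at r3
  rw [hw0, hu0, h4] at r4 r5
  have h60 : coords e 6 = 0 := by rw [h6, h4, mul_zero]
  refine eq_zero_of_coords_eq_zero he (funext fun i => ?_)
  fin_cases i
  · exact hv0
  · refine mul_left_cancel₀ hH ?_
    change H ^ 2 * coords e 1 = H ^ 2 * 0
    linear_combination r3 - 2 * H * Dh * (e1 - u * e0)
  · refine mul_left_cancel₀ hH ?_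
    change H ^ 2 * coords e 2 = H ^ 2 * 0
    linear_combination r4 - 2 * H * Dh * (e2 - w * e4)
  · refine mul_left_cancel₀ hH ?_
    change H ^ 2 * coords e 3 = H ^ 2 * 0
    linear_combination r5 - 2 * H * Dh * (e3 - u * e4)
  · exact h4
  · exact (sub_eq_zero.1 r7).symm.trans h4
  · exact h60
  · exact (sub_eq_zero.1 r8).symm.trans h60

end Relations

/-! ### Smooth and singular points -/

theorem rank_eq_two {V W : Type} [AddCommGroup V] [Module ℂ V] [AddCommGroup W] [Module ℂ W]
    {T : Submodule ℂ V} (L : V →ₗ[ℂ] W) (hL : ∀ e ∈ T, L e = 0 → e = 0) {e₁ e₂ : V}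
    (h₁ : e₁ ∈ T) (h₂ : e₂ ∈ T) (hind : LinearIndependent ℂ ![L e₁, L e₂])
    (hspan : ∀ e ∈ T, ∃ r s : ℂ, L e = r • L e₁ + s • L e₂) : Module.rank ℂ T = 2 := by
  have hind' : LinearIndependent ℂ ![e₁, e₂] := by
    refine LinearIndependent.of_comp L ?_
    convert hind using 1
    ext i
    fin_cases i <;> rfl
  have hT : T = Submodule.span ℂ (Set.range ![e₁, e₂]) := by
    refine le_antisymm (fun e he => ?_) (Submodule.span_le.2 ?_)
    · obtain ⟨r, s, hrs⟩ := hspan e he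
      have h0 : e - (r • e₁ + s • e₂) = 0 := hL _
        (T.sub_mem he (T.add_mem (T.smul_mem r h₁) (T.smul_mem s h₂))) (by simp [hrs])
      rw [sub_eq_zero.1 h0]
      exact Submodule.add_mem _ (Submodule.smul_mem _ _ (Submodule.subset_span ⟨0, rfl⟩))
        (Submodule.smul_mem _ _ (Submodule.subset_span ⟨1, rfl⟩))
    · rintro _ ⟨i, rfl⟩
      fin_cases i
      exacts [h₁, h₂]
  rw [hT, rank_span hind', Cardinal.mk_range_eq _ hind'.injective]
  simp

/-- A curve in the surface along which `x₁` is constant. -/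
theorem exists_tangent_v {p : Fin 3 → ℂ} (hp : p ∈ surfaceP) (hv : p 0 ≠ 0) :
    ∃ c : ℂ → Fin 3 → ℂ, c 0 = p ∧ (∀ i, HasDerivAt (fun t => c t i)
      ((![1, 2 * p 0 * ((p 2 - 1) / (p 2 ^ 2 + p 2 - 1)), 0] : Fin 3 → ℂ) i) 0) ∧
      ∀ᶠ t in 𝓝 0, c t ∈ surfaceP := by
  obtain ⟨h0, h1, hP⟩ := mem_surfaceP_iff.1 hp
  have h2 := quadratic_ne_zero hp hv
  refine ⟨fun t => ![p 0 + t, (p 0 + t) ^ 2 * ((p 2 - 1) / (p 2 ^ 2 + p 2 - 1)), p 2], ?_, ?_, ?_⟩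
  · ext i
    fin_cases i
    · exact add_zero _
    · simp only [Fin.mk_one, Matrix.cons_val, add_zero]
      rw [← mul_div_assoc, div_eq_iff h2]
      linear_combination -hP
    · rfl
  · have hd : HasDerivAt (fun t : ℂ => p 0 + t) 1 0 := (hasDerivAt_id 0).const_add (p 0)
    intro i
    fin_cases i
    · exact hd
    · refine ((hd.fun_pow 2).mul_const _).congr_deriv ?_
      simp
    · exact hasDerivAt_const _ _
  · have hc : ContinuousAt (fun t : ℂ => p 0 + t) 0 := by fun_prop
    filter_upwards [hc.eventually_ne (y := 0) (by simpa using hv)] with t ht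
    refine mem_surfaceP_iff.2 ⟨?_, h1, ?_⟩
    · exact mul_ne_zero (pow_ne_zero 2 ht) (div_ne_zero (sub_ne_zero.2 h1) h2)
    · simp only [Matrix.cons_val]
      linear_combination (p 0 + t) ^ 2 * div_mul_cancel₀ (p 2 - 1) h2

theorem linearIndependent_pair {x y : Fin 3 → ℂ} {i j : Fin 3} (hi : x i ≠ 0) (hj : y j ≠ 0)
    (h : y i = 0) : LinearIndependent ℂ ![x, y] := by
  rw [LinearIndependent.pair_iff]
  intro r s hrs
  have h1 := congrFun hrs i
  simp only [Pi.add_apply, Pi.smul_apply, smul_eq_mul, Pi.zero_apply, h, mul_zero, add_zero] at h1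
  have hr := (mul_eq_zero.1 h1).resolve_right hi
  have h2 := congrFun hrs j
  simp only [Pi.add_apply, Pi.smul_apply, smul_eq_mul, Pi.zero_apply, hr, zero_mul, zero_add] at h2
  exact ⟨hr, (mul_eq_zero.1 h2).resolve_right hj⟩

/-- The variation of (v, w, x₁) embeds the tangent space in the tangent plane of the surface, and
two curves in the surface show that it fills that plane. -/
theorem rank_tangentSpace_of_not_mem_nodes {p : Fin 3 → ℂ} (hp : p ∈ surfaceP)
    (hnode : Phi p ∉ nodes) : Module.rank ℂ (tangentSpace XPR (psi p)) = 2 := by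
  obtain ⟨h, g, g', hh, hg⟩ := exists_fraction (eval_phiEquations hp) hnode
  have hrel := fun e (he : e ∈ tangentSpace XPR (psi p)) => paramVariation_relations hp hh hg he
  have hcurve : ∀ (c : ℂ → Fin 3 → ℂ) (d : Fin 3 → ℂ), c 0 = p →
      (∀ i, HasDerivAt (fun t => c t i) (d i) 0) → (∀ᶠ t in 𝓝 0, c t ∈ surfaceP) →
      ∃ e ∈ tangentSpace XPR (psi p), paramVariation p h g e = d := by
    intro c d hc0 hd hP
    obtain ⟨e, he, he0, -, he4, he1⟩ := exists_tangent hc0 hd hP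
    have h1 := he1 h g fun p' hp' => (hg p' hp').1
    have h2 : (differential (Phi p) (coords e) g - p 1 * differential (Phi p) (coords e) h) /
        eval (Phi p) h = d 1 := by
      rw [div_eq_iff hh]
      linear_combination -h1
    refine ⟨e, he, ?_⟩
    ext i
    fin_cases i
    · change coords e 0 + (p 1)⁻¹ ^ 2 * _ = d 0
      rw [h2, he0]
      ring
    · exact h2
    · exact he4
  obtain ⟨h0, h1, hP⟩ := mem_surfaceP_iff.1 hp
  by_cases hv : p 0 = 0
  · obtain ⟨k, hk0, hk⟩ := exists_curveV_constant hp hv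
    obtain ⟨e₁, he₁, hd₁⟩ := hcurve _ _ (curveV_zero hp hv hk)
      (fun i => (differentiableAt_curveV hp hv k i).hasDerivAt) (curveV_mem hp hv hk0)
    obtain ⟨e₂, he₂, hd₂⟩ := hcurve (fun t => ![0, p 1 + t, p 2]) ![0, 1, 0]
      (by
        ext i
        fin_cases i
        · exact hv.symm
        · exact add_zero _
        · rfl)
      (by
        intro i
        fin_cases i
        · exact hasDerivAt_const _ _
        · exact (hasDerivAt_id (0 : ℂ)).const_add (p 1)
        · exact hasDerivAt_const _ _)
      (by
        have hc : ContinuousAt (fun t : ℂ => p 1 + t) 0 := by fun_prop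
        filter_upwards [hc.eventually_ne (y := 0) (by simpa using h0)] with t ht
        exact line_mem_surfaceP (quadratic_eq_zero hp hv).1 ht)
    have hd10 : paramVariation p h g e₁ 0 = k := by
      rw [hd₁]
      refine HasDerivAt.deriv ?_
      have hk1 := (hasDerivAt_id (0 : ℂ)).const_mul k
      rw [mul_one] at hk1
      exact hk1
    have hd20 : paramVariation p h g e₂ 0 = 0 := by rw [hd₂]; rfl
    have hd21 : paramVariation p h g e₂ 1 = 1 := by rw [hd₂]; rfl
    -- At v = 0 also K = α + β − 1 = 0, so the linearized equation reduces to dx₁ = 0 once (β − 2)²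
    -- ≠ 1.
    have hx : ∀ e ∈ tangentSpace XPR (psi p), paramVariation p h g e 2 = 0 := by
      intro e he
      have h2 := (hrel e he).1
      have hK : Phi p 4 + Phi p 6 - 1 = 0 := by
        have := sq_eq hp
        rw [hv] at this
        exact (mul_eq_zero.1 (this.symm.trans (by norm_num))).resolve_right h0
      rw [hK, hv, mul_zero, zero_mul, zero_mul, add_zero, eq_comm] at h2
      refine (mul_eq_zero.1 h2).resolve_left (mul_ne_zero h0 fun h3 => ?_)
      have h4 := Phi_alpha_beta hp
      have h5 : (5 : ℂ) = 0 := by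
        have h6 : Phi p 4 = 1 - Phi p 6 := by linear_combination hK
        rw [h6] at h4
        linear_combination (3 * Phi p 6 + 1) * (h3 - h4) + 9 * h4
      norm_num at h5
    refine rank_eq_two (paramVariation p h g) (fun e he => (hrel e he).2) he₁ he₂
      (linearIndependent_pair (i := 0) (j := 1) (hd10.trans_ne hk0) (hd21.trans_ne one_ne_zero)
        hd20) fun e he => ?_
    refine ⟨paramVariation p h g e 0 / k, paramVariation p h g e 1 -
      paramVariation p h g e 0 / k * paramVariation p h g e₁ 1, ?_⟩
    ext i
    simp only [Pi.add_apply, Pi.smul_apply, smul_eq_mul]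
    fin_cases i
    · simp only [Fin.zero_eta]
      rw [hd10, hd20, div_mul_cancel₀ _ hk0, mul_zero, add_zero]
    · simp only [Fin.mk_one]
      rw [hd21]
      ring
    · simp only [Fin.reduceFinMk]
      rw [hx e he, hx e₁ he₁, hx e₂ he₂]
      ring
  · obtain ⟨e₁, he₁, hd₁⟩ := hcurve _ _ (curveX_zero hp hv)
      (fun i => (differentiableAt_curveX hp hv i).hasDerivAt) (curveX_mem hp hv)
    obtain ⟨c, hc0, hc, hcP⟩ := exists_tangent_v hp hv
    obtain ⟨e₂, he₂, hd₂⟩ := hcurve _ _ hc0 hc hcP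
    have hd10 : paramVariation p h g e₁ 0 = 0 := by
      rw [hd₁]
      exact (hasDerivAt_const (0 : ℂ) (p 0)).deriv
    have hd12 : paramVariation p h g e₁ 2 = 1 := by
      rw [hd₁]
      exact ((hasDerivAt_id (0 : ℂ)).const_add (p 2)).deriv
    have hd20 : paramVariation p h g e₂ 0 = 1 := by rw [hd₂]; rfl
    have hd22 : paramVariation p h g e₂ 2 = 0 := by rw [hd₂]; rfl
    have hK : Phi p 4 + Phi p 6 - 1 ≠ 0 := by
      intro h2
      have := sq_eq hp
      rw [h2, zero_mul] at this
      exact pow_ne_zero 2 hv this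
    refine rank_eq_two (paramVariation p h g) (fun e he => (hrel e he).2) he₁ he₂
      (linearIndependent_pair (i := 2) (j := 0) (hd12.trans_ne one_ne_zero)
        (hd20.trans_ne one_ne_zero) hd22) fun e he => ?_
    refine ⟨paramVariation p h g e 2, paramVariation p h g e 0, ?_⟩
    -- The difference from the proposed combination has dv = dx₁ = 0, so the linearized equation
    -- says K·dw = 0, and K ≠ 0 because v ≠ 0.
    have h2 := (hrel _ (Submodule.sub_mem _ he (Submodule.add_mem _
      (Submodule.smul_mem _ (paramVariation p h g e 2) he₁)
      (Submodule.smul_mem _ (paramVariation p h g e 0) he₂)))).1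
    simp only [map_sub, map_add, map_smul, Pi.sub_apply, Pi.add_apply, Pi.smul_apply, smul_eq_mul,
      hd10, hd12, hd20, hd22] at h2
    ext i
    simp only [Pi.add_apply, Pi.smul_apply, smul_eq_mul]
    fin_cases i
    · simp only [Fin.zero_eta]
      rw [hd10, hd20]
      ring
    · simp only [Fin.mk_one]
      refine mul_left_cancel₀ hK ?_
      linear_combination -h2
    · simp only [Fin.reduceFinMk]
      rw [hd12, hd22]
      ring

/-- The eigenvalues ζ, ζs sit on the plane and ζt on the line. The conditions on s and t are
symmetric, so exchanging them gives a second preimage of the same node. -/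
theorem node_preimage {x : Fin 8 → ℂ} {ζ s t : ℂ} (hζ : ζ ^ 3 = 1)
    (hx : x = mu3Act ζ ![4, 4, 8, 8, 3, 3, 3, 3]) (hst : s + t = 3) (hs : s * t = 1) :
    (![ζ * (1 + s), ζ ^ 2 * s, 2] : Fin 3 → ℂ) ∈ surfaceP ∧
      Phi ![ζ * (1 + s), ζ ^ 2 * s, 2] = x ∧ (ζ ^ 2 * s)⁻¹ = ζ * t := by
  have hinv : ζ ^ 2 * s * (ζ * t) = 1 := by linear_combination hζ + ζ ^ 3 * hs
  have hinv' := inv_eq_of_mul_eq_one_right hinv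
  have hsq : s ^ 2 = 3 * s - 1 := by linear_combination s * hst - hs
  have htq : t ^ 2 = 3 * t - 1 := by linear_combination t * hst - hs
  refine ⟨mem_surfaceP_iff.2 ⟨left_ne_zero_of_mul (hinv.trans_ne one_ne_zero), ?_, ?_⟩,
    eq_Phi_of ?_ ?_ ?_ ?_ ?_ ?_ ?_ ?_ ?_, hinv'⟩
  all_goals simp only [hx, mu3Act, Matrix.cons_val, hinv']
  · norm_num
  · linear_combination -ζ ^ 2 * hsq
  · linear_combination -ζ * hst
  · linear_combination -ζ ^ 2 * hst - ζ ^ 2 * hs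
  · linear_combination -3 * ζ ^ 2 * hst - ζ ^ 2 * htq
  · linear_combination -3 * ζ * hst - ζ ^ 4 * hsq - ζ * (3 * s - 1) * hζ
  · norm_num
  · norm_num
  · norm_num

/-- Two tangent vectors of the branch through the preimage given by s: one along varying x₁, the
other with x₁ = 2 fixed and dv = 1, dw = 2v/5. -/
theorem exists_tangent_vertical {χ : KnotGroup → ℂ} (hχ : χ ∈ XPR) {ζ s t : ℂ} (hζ : ζ ^ 3 = 1)
    (hx : coords χ = mu3Act ζ ![4, 4, 8, 8, 3, 3, 3, 3]) (hst : s + t = 3) (hs : s * t = 1) :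
    (∃ e ∈ tangentSpace XPR χ, coords e 4 = 1) ∧
      ∃ e ∈ tangentSpace XPR χ, coords e 4 = 0 ∧ 5 * coords e 0 = 7 - 8 * t ∧
        5 * coords e 1 = ζ * (8 - 7 * t) := by
  obtain ⟨hp, hΦ, hinv⟩ := node_preimage hζ hx hst hs
  have hχp : χ = psi ![ζ * (1 + s), ζ ^ 2 * s, 2] := eq_psi_of_coords
    (fun γ => apply_eq_eval_of_mem_reducibleLocus (XPR_subset_reducibleLocus hχ) γ) hp hΦ
  have hsq : s ^ 2 = 3 * s - 1 := by linear_combination s * hst - hs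
  have htq : t ^ 2 = 3 * t - 1 := by linear_combination t * hst - hs
  have hv : (![ζ * (1 + s), ζ ^ 2 * s, 2] : Fin 3 → ℂ) 0 ≠ 0 := by
    change ζ * (1 + s) ≠ 0
    refine mul_ne_zero (fun h => by simp [h] at hζ) fun h => ?_
    have : (5 : ℂ) = 0 := by linear_combination hsq + (4 - s) * h
    norm_num at this
  rw [hχp]
  constructor
  · obtain ⟨e, he, -, -, he4, -⟩ := exists_tangent (curveX_zero hp hv)
      (fun i => (differentiableAt_curveX hp hv i).hasDerivAt) (curveX_mem hp hv)
    refine ⟨e, he, he4.trans ?_⟩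
    exact ((hasDerivAt_id (0 : ℂ)).const_add _).deriv
  · obtain ⟨c, hc0, hc, hcP⟩ := exists_tangent_v hp hv
    obtain ⟨e, he, he0, he1, he4, -⟩ := exists_tangent hc0 hc hcP
    refine ⟨e, he, he4, ?_, ?_⟩
    · rw [he0]
      simp only [Matrix.cons_val, hinv]
      have hk : ((2 : ℂ) - 1) / (2 ^ 2 + 2 - 1) = 1 / 5 := by norm_num
      rw [hk]
      linear_combination -2 * (1 + s) * t ^ 2 * hζ - 2 * htq - 2 * t * hs
    · rw [he1]
      simp only [Matrix.cons_val, hinv]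
      have hk : ((2 : ℂ) - 1) / (2 ^ 2 + 2 - 1) = 1 / 5 := by norm_num
      rw [hk]
      linear_combination -2 * ζ * (1 + s) ^ 2 * t ^ 2 * hζ - 2 * ζ * t ^ 2 * hsq
        - 10 * ζ * t * hs + 2 * ζ * hst

/-- The two branches, exchanged by s ↔ t, have different tangent directions at constant x₁; a
direction along which α varies is the third vector. -/
theorem three_le_rank_of_mem_nodes {χ : KnotGroup → ℂ} (hχ : χ ∈ XPR) (hnode : coords χ ∈ nodes) :
    3 ≤ Module.rank ℂ (tangentSpace XPR χ) := by
  obtain ⟨ζ, hζ, hx⟩ := hnode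
  obtain ⟨s, t, hst, hs⟩ := exists_add_mul 3 1
  obtain ⟨⟨e₁, h₁, a₁⟩, e₂, h₂, a₂, b₂, c₂⟩ := exists_tangent_vertical hχ hζ hx hst hs
  obtain ⟨-, e₃, h₃, a₃, b₃, c₃⟩ := exists_tangent_vertical hχ hζ hx
    ((add_comm t s).trans hst) ((mul_comm t s).trans hs)
  have hζ0 : ζ ≠ 0 := fun h => by simp [h] at hζ
  have hne : s - t ≠ 0 := by
    intro h
    have : (5 : ℂ) = 0 := by linear_combination (s + t + 3) * -hst + (s - t) * h + 4 * hs
    norm_num at this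
  have hind : LinearIndependent ℂ
      (![⟨e₁, h₁⟩, ⟨e₂, h₂⟩, ⟨e₃, h₃⟩] : Fin 3 → tangentSpace XPR χ) := by
    rw [Fintype.linearIndependent_iff]
    intro r hr
    rw [Fin.sum_univ_three] at hr
    have hr' : ∀ i, r 0 * coords e₁ i + r 1 * coords e₂ i + r 2 * coords e₃ i = 0 := fun i => by
      rw [coords_eq, coords_eq, coords_eq]
      exact congrFun (congrArg Subtype.val hr) (coordElement i)
    have r0 : r 0 = 0 := by
      have := hr' 4
      rw [a₁, a₂, a₃] at this
      linear_combination this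
    have q0 : r 1 * (7 - 8 * t) + r 2 * (7 - 8 * s) = 0 := by
      have := hr' 0
      rw [r0] at this
      linear_combination 5 * this - r 1 * b₂ - r 2 * b₃
    have q1 : r 1 * (8 - 7 * t) + r 2 * (8 - 7 * s) = 0 := by
      have := hr' 1
      rw [r0] at this
      refine mul_left_cancel₀ hζ0 ?_
      linear_combination 5 * this - r 1 * c₂ - r 2 * c₃
    -- The 2×2 system for r 1, r 2 has determinant 15(s − t), and (s − t)² = 5.
    have r1 : r 1 = 0 := by
      refine mul_right_cancel₀ hne ?_
      linear_combination (8 - 7 * s) / 15 * q0 - (7 - 8 * s) / 15 * q1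
    have r2 : r 2 = 0 := by
      refine mul_right_cancel₀ hne ?_
      linear_combination -(8 - 7 * t) / 15 * q0 + (7 - 8 * t) / 15 * q1
    intro i
    fin_cases i
    exacts [r0, r1, r2]
  have := hind.cardinal_le_rank
  simpa using this

theorem not_isSmoothPoint_iff {χ : KnotGroup → ℂ} (hχ : χ ∈ XPR) :
    ¬ IsSmoothPoint XPR χ ↔ coords χ ∈ nodes := by
  constructor
  · intro h
    by_contra hnode
    refine h ⟨hχ, ?_⟩
    rw [XPR_eq] at hχ
    obtain ⟨p, hp, rfl⟩ := hχ
    rw [coords_psi hp] at hnode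
    rw [rank_tangentSpace_of_not_mem_nodes hp hnode, zariskiDim_XPR]
    simp
  · rintro hnode ⟨-, h⟩
    have h3 := Cardinal.toENat.monotone' (three_le_rank_of_mem_nodes hχ hnode)
    rw [zariskiDim_XPR] at h
    have h2 : Cardinal.toENat (Module.rank ℂ (tangentSpace XPR χ)) = 2 :=
      WithBot.coe_inj.1 h
    change Cardinal.toENat 3 ≤ Cardinal.toENat (Module.rank ℂ (tangentSpace XPR χ)) at h3
    rw [h2] at h3
    norm_num at h3

end FigureEight

theorem proposition4p1 :
    -- the reducible locus has exactly two irreducible components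
    ({Y | FigureEight.IsIrreducibleComponent FigureEight.reducibleLocus Y} =
        {FigureEight.XTR, FigureEight.XPR} ∧
      FigureEight.XTR ≠ FigureEight.XPR) ∧
    -- the eight coordinates embed the reducible locus in affine 8-space
    FigureEight.IsIsomorphismOn FigureEight.coords FigureEight.reducibleLocus
      (FigureEight.coords '' FigureEight.reducibleLocus) ∧
    -- the component of totally reducible characters
    (FigureEight.coords '' FigureEight.XTR = FigureEight.planeTR ∧
      FigureEight.IsIsomorphismOn FigureEight.coordsY FigureEight.XTR Set.univ) ∧
    -- the component of partially reducible characters and its parametrization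
    (FigureEight.XPR ⊆ FigureEight.reducibleLocus ∧
      FigureEight.IsIrreducibleComponent FigureEight.charVarietyGL2 FigureEight.X2 ∧
      FigureEight.IsIsomorphismOn FigureEight.coordsGL2 FigureEight.X2 FigureEight.surfaceP ∧
      (fun χ => FigureEight.Phi (FigureEight.coordsGL2 χ)) '' FigureEight.X2 =
        FigureEight.coords '' FigureEight.XPR ∧
      (∀ χ ∈ FigureEight.X2, ∀ χ' ∈ FigureEight.X2,
        FigureEight.Phi (FigureEight.coordsGL2 χ) = FigureEight.Phi (FigureEight.coordsGL2 χ') →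
        χ = χ' ∨ FigureEight.Phi (FigureEight.coordsGL2 χ) ∈ FigureEight.nodes)) ∧
    -- the singular points
    ((∀ χ ∈ FigureEight.XPR,
        ¬ FigureEight.IsSmoothPoint FigureEight.XPR χ ↔
          FigureEight.coords χ ∈ FigureEight.nodes) ∧
      FigureEight.nodes ⊆ FigureEight.coords '' (FigureEight.XTR ∩ FigureEight.XPR)) ∧
    -- the intersection of the two components
    (FigureEight.coords '' (FigureEight.XTR ∩ FigureEight.XPR) =
        {p | p ∈ FigureEight.planeTR ∧ (![p 0, p 1] : Fin 2 → ℂ) ∈ FigureEight.planeCurve} ∧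
      FigureEight.IsIsomorphismOn FigureEight.coordsY (FigureEight.XTR ∩ FigureEight.XPR)
        FigureEight.planeCurve) := by
  exact ⟨FigureEight.irreducibleComponents_reducibleLocus, FigureEight.isIsomorphismOn_coords,
    ⟨FigureEight.coords_image_XTR, by
      rw [FigureEight.XTR_eq, ← Set.image_univ]
      exact FigureEight.isIsomorphismOn_coordsY_image _⟩,
    ⟨FigureEight.XPR_subset_reducibleLocus, FigureEight.isIrreducibleComponent_X2,
      FigureEight.isIsomorphismOn_coordsGL2, FigureEight.image_Phi_eq,
      FigureEight.injective_outside_nodes⟩,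
    ⟨fun _ hχ => FigureEight.not_isSmoothPoint_iff hχ, FigureEight.nodes_subset_image_inter⟩,
    FigureEight.coords_image_inter, by
      rw [FigureEight.inter_eq]
      exact FigureEight.isIsomorphismOn_coordsY_image _⟩
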